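/- Let $N\in\mathbb N$, let $H_S^{(0)},H_S^{(2)}$ be Hermitian $N\times N$ matrices, $\omega:\mathbb R\to\mathbb R$ measurable, $g\in L^2(\mathbb R)$, and $H_{S,\lambda}=H_S^{(0)}+\lambda^2H_S^{(2)}$. On $(\mathbb C\oplus\mathbb C^N)\otimes\bigotimes_{i=1}^N\mathfrak F_b(L^2(\mathbb R))$, where $\mathfrak F_b$ denotes the bosonic Fock space, let $$\hat H_{0,\lambda}=(0\oplus H_{S,\lambda})\otimes I+I\otimes\sum_{i=1}^N\int\omega(k)\,b_{k,i}^\dagger b_{k,i}\,dk,\qquad \hat H_\lambda=\hat H_{0,\lambda}+\lambda\sum_{i=1}^N\int\big(g(k)^*|0\rangle\langle i|\otimes b_{k,i}^\dagger+g(k)|i\rangle\langle 0|\otimes b_{k,i}\big)dk .$$ For a density matrix $\rho_S(0)$ on $\mathbb C\oplus\mathbb C^N$ and the vacuum $\Omega$ of the reservoirs, let $$\rho_{SI,\lambda}(t)=\operatorname{Tr}_B\Big(e^{i\hat H_{0,\lambda}\tau}e^{-i\hat H_\lambda\tau}\,\big(\rho_S(0)\otimes|\Omega\rangle\langle\Omega|\big)\,e^{i\hat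 H_\lambda\tau}e^{-i\hat H_{0,\lambda}\tau}\Big),\qquad \tau=t/\lambda^2,\ \lambda\neq0,$$ be the reduced density matrix in the interaction picture with rescaled time. Let $G(t)=\int|g(k)|^2e^{-i\omega(k)t}dk$ and $\tilde G(p)=\int_0^{\infty}e^{-pt}G(t)\,dt$. Assume that this (improper) integral converges for all $p$ with $\operatorname{Re}p\ge0$, and that $\tilde G$ is twice continuously differentiable with respect to $p$ on the closed half-plane $\operatorname{Re}p\ge0$, with bounded first derivative (derivatives on the imaginary axis are taken within the half-plane). Let $H_S^{(0)}=\sum_EE\,\Pi_E$ be the spectral decomposition, $F(-iH_S^{(0)})=\sum_EF(-iE)\Pi_E$, and let $\frac{\delta\tilde G}{\delta p}(x,y)=\frac{\tilde G(x)-\tilde G(y)}{x-y}$ for $x\ne y$ and $\tilde G'(x)$ for $x=y$. Put $$r=1-\lambda^2\tilde G'(-iH_S^{(0)}),$$ $$L=-\tilde G(-iH_S^{(0)})+\lambda^2\Big(\tilde G'(-iH_S^{(0)})\tilde G(-iH_S^{(0)})+i\sum_{E,E'}\tfrac{\delta\tilde G}{\delta p}(-iE,-iE')\,\Pi_EH_S^{(2)}\Pi_{E'}\Big),$$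 and, in block form with respect to $\mathbb C\oplus\mathbb C^N$, $$R(\rho)=\begin{pmatrix}\rho_{gg}+\operatorname{Tr}(\rho_{ee}-r\rho_{ee}r^+)&\rho_{ge}r^+\\ r\rho_{eg}&r\rho_{ee}r^+\end{pmatrix}.$$ With $H=\frac i2(L-L^+)$ and $\Gamma=-(L+L^+)$, so that $L=-iH-\frac12\Gamma$, put $$\mathcal L(\rho)=-i[0\oplus H,\rho]+\operatorname{Tr}(\Gamma\rho_{ee})\,|0\rangle\langle0|-\tfrac12\{0\oplus\Gamma,\rho\}.$$ Then: 1. For every fixed $t>0$, as $\lambda\to0$, $$\rho_{SI,\lambda}(t)=e^{\mathcal Lt}R(\rho_S(0))+O(\lambda^4)\qquad\text{and}\qquad \rho_{SI,\lambda}(t)=R(e^{\mathcal Lt}\rho_S(0))+O(\lambda^4).$$ 2. For every real $\lambda$ for which $L$ is dissipative, i.e. $\operatorname{Re}v^+Lv\le0$ for all $v$, the generator $\mathcal L$ has GKSL form: there are a Hermitian matrix $K$ on $\mathbb C^N$, an orthonormal basis $|l\rangle$ of $\mathbb C^N$ and $\Gamma_l\ge0$ with $$\mathcal L(\rho)=-i[0\oplus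 K,\rho]+\sum_l\Gamma_l\Big(|0\rangle\langle l|\rho|l\rangle\langle0|-\tfrac12\{|l\rangle\langle0|0\rangle\langle l|,\rho\}\Big)\quad\text{for all }\rho.$$ 3. For every real $\lambda$: if $|l\rangle$ is an orthonormal basis of eigenvectors of $L$ with eigenvalues $-i\varepsilon_l-\Gamma_l/2$, where $\varepsilon_l,\Gamma_l$ are real, then the formula in 2 holds with this basis, these $\Gamma_l$, and with $0\oplus K=\sum_l\varepsilon_l|l\rangle\langle l|$; and $\Gamma_l\ge0$ for all $l$ if $L$ is dissipative. 4. If $\operatorname{Re}\tilde G(-iE)\neq0$ for all eigenvalues $E$ of $H_S^{(0)}$, then $L$ is dissipative for all sufficiently small $\lambda\neq0$. -/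

import Mathlib

open MeasureTheory Filter Topology Matrix
open scoped ComplexConjugate ComplexOrder

namespace MultiLevel

noncomputable section

/-! ### The Hilbert space `(ℂ ⊕ ℂ^N) ⊗ ⨂_{i=1}^N 𝔉_b(L²(ℝ))` -/

/-- Levels of the system: `inl ()` is the ground level `|0⟩`, `inr i` the `i`-th excited level. -/
abbrev Level (N : ℕ) := Unit ⊕ Fin N

/-- A boson is described by the number `i` of its reservoir and by its momentum `k`. The space
`L²` of this type is `L²(ℝ) ⊕ ⋯ ⊕ L²(ℝ)`, whose bosonic Fock space is the tensor product of the
bosonic Fock spaces of the `N` reservoirs. -/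
abbrev Mode (N : ℕ) := Fin N × ℝ

/-- Counting measure in the reservoir number, Lebesgue measure in the momentum. -/
def modeMeasure (N : ℕ) : Measure (Mode N) := (Measure.count : Measure (Fin N)).prod volume

instance (N : ℕ) : SigmaFinite (modeMeasure N) := by
  unfold modeMeasure; infer_instance

/-- The reference measure on configurations of `n` bosons. -/
def confMeasure (N n : ℕ) : Measure (Fin n → Mode N) := Measure.pi fun _ => modeMeasure N

theorem measurePreserving_perm (N n : ℕ) (σ : Equiv.Perm (Fin n)) :
    MeasurePreserving (fun x : Fin n → Mode N => x ∘ σ) (confMeasure N n) (confMeasure N n) := by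
  unfold confMeasure
  have h := measurePreserving_piCongrLeft (fun _ : Fin n => modeMeasure N) σ.symm
  convert h using 1
  funext x j
  have := MeasurableEquiv.piCongrLeft_apply_apply (β := fun _ : Fin n => Mode N) σ.symm x (σ j)
  simpa using this.symm

/-- The `n`-boson space: the permutation invariant elements of `L²`. -/
def bosonSpace (N n : ℕ) : Submodule ℂ (Lp ℂ 2 (confMeasure N n)) :=
  ⨅ σ : Equiv.Perm (Fin n),
    LinearMap.eqLocus (Lp.compMeasurePreservingₗ ℂ _ (measurePreserving_perm N n σ)) LinearMap.id

theorem isClosed_bosonSpace (N n : ℕ) :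
    IsClosed (bosonSpace N n : Set (Lp ℂ 2 (confMeasure N n))) := by
  unfold bosonSpace
  rw [Submodule.coe_iInf]
  refine isClosed_iInter fun σ => ?_
  exact isClosed_eq
    (Lp.compMeasurePreservingₗᵢ ℂ _ (measurePreserving_perm N n σ)).continuous continuous_id

instance (N n : ℕ) : CompleteSpace (bosonSpace N n) :=
  (isClosed_bosonSpace N n).completeSpace_coe

/-- The bosonic Fock space of the `N` reservoirs: the Hilbert sum of the `n`-boson spaces. -/
def Fock (N : ℕ) : Type := lp (fun n : ℕ => bosonSpace N n) 2

instance (N : ℕ) : NormedAddCommGroup (Fock N) :=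
  inferInstanceAs (NormedAddCommGroup (lp (fun n : ℕ => bosonSpace N n) 2))
instance (N : ℕ) : InnerProductSpace ℂ (Fock N) :=
  inferInstanceAs (InnerProductSpace ℂ (lp (fun n : ℕ => bosonSpace N n) 2))
instance (N : ℕ) : CompleteSpace (Fock N) :=
  inferInstanceAs (CompleteSpace (lp (fun n : ℕ => bosonSpace N n) 2))

/-- The `n`-boson component of a vector of Fock space. -/
def Fock.component {N : ℕ} (φ : Fock N) (n : ℕ) : bosonSpace N n :=
  (show lp (fun n : ℕ => bosonSpace N n) 2 from φ).1 n

/-- The Hilbert space of the system and the reservoirs, as the Hilbert sum over the levels. -/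
def TotalSpace (N : ℕ) : Type := PiLp 2 fun _ : Level N => Fock N

instance (N : ℕ) : NormedAddCommGroup (TotalSpace N) :=
  inferInstanceAs (NormedAddCommGroup (PiLp 2 fun _ : Level N => Fock N))
instance (N : ℕ) : InnerProductSpace ℂ (TotalSpace N) :=
  inferInstanceAs (InnerProductSpace ℂ (PiLp 2 fun _ : Level N => Fock N))
instance (N : ℕ) : CompleteSpace (TotalSpace N) :=
  inferInstanceAs (CompleteSpace (PiLp 2 fun _ : Level N => Fock N))

/-- The component `(⟨s| ⊗ I) ψ`. -/
def TotalSpace.component {N : ℕ} (ψ : TotalSpace N) (s : Level N) : Fock N :=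
  (show PiLp 2 (fun _ : Level N => Fock N) from ψ).ofLp s

instance (N : ℕ) : IsFiniteMeasure (confMeasure N 0) := by
  unfold confMeasure
  rw [Measure.pi_of_empty]
  infer_instance

/-- The vacuum vector `|Ω⟩`. -/
def vacuum (N : ℕ) : Fock N :=
  lp.single (E := fun n : ℕ => bosonSpace N n) 2 0 ⟨Lp.const 2 (confMeasure N 0) (1 : ℂ), by
    unfold bosonSpace
    rw [Submodule.mem_iInf]
    intro σ
    change Lp.compMeasurePreserving _ (measurePreserving_perm N 0 σ) _ = _
    apply Lp.ext
    refine (Lp.coeFn_compMeasurePreserving _ _).trans ?_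
    refine Eventually.of_forall fun x => ?_
    rw [Function.comp_apply, Subsingleton.elim (x ∘ σ) x]
    rfl⟩

/-- `|s⟩ ⊗ φ`. -/
def ket {N : ℕ} (s : Level N) (φ : Fock N) : TotalSpace N :=
  PiLp.single (β := fun _ : Level N => Fock N) 2 s φ

/-! ### The Hamiltonian -/

/-- Wave functions of a vector of Fock space: one function of `n` bosons for every `n`. -/
abbrev WaveFunctions (N : ℕ) := ∀ n : ℕ, (Fin n → Mode N) → ℂ

def Fock.waveFunctions {N : ℕ} (φ : Fock N) : WaveFunctions N :=
  fun n => (φ.component n : Lp ℂ 2 (confMeasure N n))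

/-- `∫ f(k) b_{k,i} dk`. -/
def annihilation {N : ℕ} (i : Fin N) (f : ℝ → ℂ) (Φ : WaveFunctions N) : WaveFunctions N :=
  fun n x => (Real.sqrt (n + 1) : ℂ) * ∫ k : ℝ, f k * Φ (n + 1) (Fin.cons (i, k) x)

/-- `∫ f(k) b†_{k,i} dk`. -/
def creation {N : ℕ} (i : Fin N) (f : ℝ → ℂ) (Φ : WaveFunctions N) : WaveFunctions N
  | 0 => fun _ => 0
  | n + 1 => fun x => ((Real.sqrt (n + 1))⁻¹ : ℂ) *
      ∑ j : Fin (n + 1), if (x j).1 = i then f (x j).2 * Φ n (fun l => x (j.succAbove l)) else 0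

/-- `∑ᵢ ∫ ω(k) b†_{k,i} b_{k,i} dk`. -/
def fieldEnergy {N : ℕ} (ω : ℝ → ℝ) (Φ : WaveFunctions N) : WaveFunctions N :=
  fun n x => ((∑ j : Fin n, ω (x j).2 : ℝ) : ℂ) * Φ n x

/-- The interaction
`∑ᵢ ∫ (g(k)^* |0⟩⟨i| ⊗ b†_{k,i} + g(k) |i⟩⟨0| ⊗ b_{k,i}) dk`. -/
def interaction {N : ℕ} (g : ℝ → ℂ) (Ψ : Level N → WaveFunctions N) :
    Level N → WaveFunctions N
  | .inl _ => fun n x => ∑ i : Fin N, creation i (fun k => conj (g k)) (Ψ (.inr i)) n x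
  | .inr i => annihilation i g (Ψ (.inl ()))

/-- `0 ⊕ A`. -/
def excitedBlock {N : ℕ} (A : Matrix (Fin N) (Fin N) ℂ) : Matrix (Level N) (Level N) ℂ :=
  fromBlocks 0 0 0 A

/-- The Hamiltonian `(0 ⊕ H_S) ⊗ I + I ⊗ H_B + c H_I` on families of wave functions. -/
def formalHamiltonian {N : ℕ} (ω : ℝ → ℝ) (g : ℝ → ℂ) (HS : Matrix (Fin N) (Fin N) ℂ) (c : ℝ)
    (Ψ : Level N → WaveFunctions N) : Level N → WaveFunctions N :=
  fun s n x => (∑ s' : Level N, excitedBlock HS s s' * Ψ s' n x) + fieldEnergy ω (Ψ s) n x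
    + (c : ℂ) * interaction g Ψ s n x

/-- `ψ` is a vector with finitely many bosons on which the Hamiltonian is defined (as a square
integrable function), and its value there is `χ`. These vectors form a core: the Hamiltonian
commutes with the number of excitations, and in each sector with a given number of excitations
it is a bounded perturbation of a multiplication operator. -/
def HamiltonianGraph {N : ℕ} (ω : ℝ → ℝ) (g : ℝ → ℂ) (HS : Matrix (Fin N) (Fin N) ℂ) (c : ℝ)
    (ψ χ : TotalSpace N) : Prop :=
  (∃ M : ℕ, ∀ s n, M ≤ n → (ψ.component s).component n = 0) ∧
  ∀ s n, (χ.component s).waveFunctions n =ᵐ[confMeasure N n]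
    formalHamiltonian ω g HS c (fun s' => (ψ.component s').waveFunctions) s n

/-- `U t = e^{-iHt}`: a strongly continuous unitary group whose generator is `-iH` on the domain
of the operator `H` with the given graph. -/
structure IsUnitaryGroup {N : ℕ} (graph : TotalSpace N → TotalSpace N → Prop)
    (U : ℝ → TotalSpace N ≃ₗᵢ[ℂ] TotalSpace N) : Prop where
  zero : ∀ ψ, U 0 ψ = ψ
  add : ∀ t s ψ, U (t + s) ψ = U t (U s ψ)
  continuous : ∀ ψ, Continuous fun t => U t ψ
  generator : ∀ ψ χ, graph ψ χ → HasDerivAt (fun t => U t ψ) (-Complex.I • χ) 0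

/-! ### States -/

/-- Density matrices. -/
def IsDensityMatrix {N : ℕ} (ρ : Matrix (Level N) (Level N) ℂ) : Prop :=
  ρ.PosSemidef ∧ ρ.trace = 1

/-- `ρ ⊗ |Ω⟩⟨Ω|`. -/
def initialState {N : ℕ} (ρ : Matrix (Level N) (Level N) ℂ) : TotalSpace N →L[ℂ] TotalSpace N :=
  ∑ s, ∑ s', ρ s s' • InnerProductSpace.rankOne ℂ (ket s (vacuum N)) (ket s' (vacuum N))

/-- The index set of a Hilbert basis of the Fock space. -/
def fockBasisSet (N : ℕ) : Set (Fock N) := (exists_hilbertBasis ℂ (Fock N)).choose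

/-- A Hilbert basis of the Fock space. -/
def fockBasis (N : ℕ) : HilbertBasis (fockBasisSet N) ℂ (Fock N) :=
  (exists_hilbertBasis ℂ (Fock N)).choose_spec.choose

/-- The partial trace over the reservoirs. -/
def partialTrace {N : ℕ} (T : TotalSpace N →L[ℂ] TotalSpace N) :
    Matrix (Level N) (Level N) ℂ :=
  Matrix.of fun s s' =>
    ∑' e : fockBasisSet N, inner ℂ (ket s (fockBasis N e)) (T (ket s' (fockBasis N e)))

/-- A unitary as a bounded operator. -/
def toOp {N : ℕ} (U : TotalSpace N ≃ₗᵢ[ℂ] TotalSpace N) : TotalSpace N →L[ℂ] TotalSpace N :=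
  (U.toContinuousLinearEquiv : TotalSpace N →L[ℂ] TotalSpace N)

/-- The reduced density matrix in the interaction picture,
`Tr_B (e^{iH₀t} e^{-iHt} (ρ ⊗ |Ω⟩⟨Ω|) e^{iHt} e^{-iH₀t})`, where `U t = e^{-iHt}` is the full and
`U₀ t = e^{-iH₀t}` the free evolution. -/
def reducedState {N : ℕ} (U₀ U : ℝ → TotalSpace N ≃ₗᵢ[ℂ] TotalSpace N)
    (ρ : Matrix (Level N) (Level N) ℂ) (t : ℝ) : Matrix (Level N) (Level N) ℂ :=
  partialTrace (toOp (U₀ t).symm ∘L toOp (U t) ∘L initialState ρ ∘L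
    toOp (U t).symm ∘L toOp (U₀ t))

/-! ### The reservoir correlation function and its Laplace transform -/

/-- `G(t) = ∫ |g(k)|² e^{-iω(k)t} dk`. -/
def corr (ω : ℝ → ℝ) (g : ℝ → ℂ) (t : ℝ) : ℂ :=
  ∫ k : ℝ, ((‖g k‖ ^ 2 : ℝ) : ℂ) * Complex.exp (-Complex.I * ω k * t)

/-- The integral `∫₀^∞ e^{-pt} G(t) dt` converges (as an improper integral) to `l`. -/
def LaplaceConverges (G : ℝ → ℂ) (p l : ℂ) : Prop :=
  Tendsto (fun T : ℝ => ∫ t in (0 : ℝ)..T, Complex.exp (-p * t) * G t) atTop (𝓝 l)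

/-- The Laplace transform `∫₀^∞ e^{-pt} G(t) dt`. -/
def laplace (G : ℝ → ℂ) (p : ℂ) : ℂ :=
  limUnder atTop fun T : ℝ => ∫ t in (0 : ℝ)..T, Complex.exp (-p * t) * G t

/-- The closed right half-plane. -/
def rightHalfPlane : Set ℂ := {p | 0 ≤ p.re}

/-- The derivative with respect to `p`, one-sided on the imaginary axis. -/
def derivRHP (F : ℂ → ℂ) (p : ℂ) : ℂ := derivWithin F rightHalfPlane p

/-- The difference derivative. -/
def diffQuot (F : ℂ → ℂ) (x y : ℂ) : ℂ :=
  if x = y then derivRHP F x else (F x - F y) / (x - y)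

/-! ### Functions of Hermitian matrices -/

/-- The set of eigenvalues of a Hermitian matrix. -/
def eigSet {N : ℕ} {A : Matrix (Fin N) (Fin N) ℂ} (hA : A.IsHermitian) : Finset ℝ :=
  Finset.univ.image hA.eigenvalues

/-- The eigenprojector `Π_E`. -/
def eigProj {N : ℕ} {A : Matrix (Fin N) (Fin N) ℂ} (hA : A.IsHermitian) (E : ℝ) :
    Matrix (Fin N) (Fin N) ℂ :=
  (hA.eigenvectorUnitary : Matrix (Fin N) (Fin N) ℂ) *
    Matrix.diagonal (fun α => if hA.eigenvalues α = E then 1 else 0) *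
    (hA.eigenvectorUnitary : Matrix (Fin N) (Fin N) ℂ)ᴴ

/-- `F(-iA) = ∑_E F(-iE) Π_E`. -/
def funAt {N : ℕ} {A : Matrix (Fin N) (Fin N) ℂ} (hA : A.IsHermitian) (F : ℂ → ℂ) :
    Matrix (Fin N) (Fin N) ℂ :=
  ∑ E ∈ eigSet hA, F (-Complex.I * E) • eigProj hA E

/-- The function of `B` and of two copies of `-iA` acting after and before `B`:
`∑_{E,E'} F(-iE, -iE') Π_E B Π_{E'}`. -/
def orderedFun {N : ℕ} {A : Matrix (Fin N) (Fin N) ℂ} (hA : A.IsHermitian) (F : ℂ → ℂ → ℂ)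
    (B : Matrix (Fin N) (Fin N) ℂ) : Matrix (Fin N) (Fin N) ℂ :=
  ∑ E ∈ eigSet hA, ∑ E' ∈ eigSet hA,
    F (-Complex.I * E) (-Complex.I * E') • (eigProj hA E * B * eigProj hA E')

/-- `r = 1 - λ² G̃'(-iH₀)`. -/
def rMatrix {N : ℕ} {H0 : Matrix (Fin N) (Fin N) ℂ} (h0 : H0.IsHermitian) (Gt : ℂ → ℂ)
    (lam : ℝ) : Matrix (Fin N) (Fin N) ℂ :=
  1 - (lam : ℂ) ^ 2 • funAt h0 (derivRHP Gt)

/-- `L = -G̃(-iH₀) + λ² (G̃'(-iH₀) G̃(-iH₀) + i ∑_{E,E'} (δG̃/δp)(-iE,-iE') Π_E H₂ Π_{E'})`. -/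
def LMatrix {N : ℕ} {H0 : Matrix (Fin N) (Fin N) ℂ} (h0 : H0.IsHermitian)
    (H2 : Matrix (Fin N) (Fin N) ℂ) (Gt : ℂ → ℂ) (lam : ℝ) : Matrix (Fin N) (Fin N) ℂ :=
  -funAt h0 Gt + (lam : ℂ) ^ 2 •
    (funAt h0 (derivRHP Gt) * funAt h0 Gt + Complex.I • orderedFun h0 (diffQuot Gt) H2)

/-! ### Superoperators -/

/-- `R(ρ)`, with blocks `ρ_gg + Tr(ρ_ee - r ρ_ee r⁺)`, `ρ_ge r⁺`, `r ρ_eg`, `r ρ_ee r⁺`. -/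
def renormMatrix {N : ℕ} (r : Matrix (Fin N) (Fin N) ℂ) (ρ : Matrix (Level N) (Level N) ℂ) :
    Matrix (Level N) (Level N) ℂ :=
  fromBlocks
    (ρ.toBlocks₁₁ + Matrix.of fun _ _ => (ρ.toBlocks₂₂ - r * ρ.toBlocks₂₂ * rᴴ).trace)
    (ρ.toBlocks₁₂ * rᴴ)
    (r * ρ.toBlocks₂₁)
    (r * ρ.toBlocks₂₂ * rᴴ)

/-- `|0⟩⟨0|`. -/
def groundProj (N : ℕ) : Matrix (Level N) (Level N) ℂ := Matrix.single (Sum.inl ()) (Sum.inl ()) 1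

/-- The Hermitian matrix `(i/2)(L - L⁺)`, so that `L = -i (i/2)(L - L⁺) - (1/2)(-(L + L⁺))`. -/
def effHam {N : ℕ} (L : Matrix (Fin N) (Fin N) ℂ) : Matrix (Fin N) (Fin N) ℂ :=
  (Complex.I / 2) • (L - Lᴴ)

/-- The decay matrix `-(L + L⁺)`. -/
def decay {N : ℕ} (L : Matrix (Fin N) (Fin N) ℂ) : Matrix (Fin N) (Fin N) ℂ := -(L + Lᴴ)

/-- The generator `𝓛` built from `L = -iH - Γ/2`:
`𝓛(ρ) = -i[0 ⊕ H, ρ] + Tr(Γ ρ_ee) |0⟩⟨0| - (1/2){0 ⊕ Γ, ρ}`. -/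
def generator {N : ℕ} (L : Matrix (Fin N) (Fin N) ℂ) :
    Module.End ℂ (Matrix (Level N) (Level N) ℂ) where
  toFun ρ :=
    -Complex.I • (excitedBlock (effHam L) * ρ - ρ * excitedBlock (effHam L))
      + (decay L * ρ.toBlocks₂₂).trace • groundProj N
      - (1 / 2 : ℂ) • (excitedBlock (decay L) * ρ + ρ * excitedBlock (decay L))
  map_add' ρ σ := by
    have h : (ρ + σ).toBlocks₂₂ = ρ.toBlocks₂₂ + σ.toBlocks₂₂ := rfl
    rw [h]
    simp only [mul_add, add_mul, trace_add, add_smul, smul_add, smul_sub]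
    abel
  map_smul' c ρ := by
    have h : (c • ρ).toBlocks₂₂ = c • ρ.toBlocks₂₂ := rfl
    rw [h]
    simp only [mul_smul_comm, smul_mul_assoc, trace_smul, RingHom.id_apply, smul_add, smul_sub,
      smul_smul, smul_eq_mul, mul_comm]

/-- `e^{𝓛t} ρ`, as the exponential series. -/
def semigroup {N : ℕ} (𝓛 : Module.End ℂ (Matrix (Level N) (Level N) ℂ)) (t : ℝ)
    (ρ : Matrix (Level N) (Level N) ℂ) : Matrix (Level N) (Level N) ℂ :=
  ∑' n : ℕ, ((t : ℂ) ^ n / (n.factorial : ℂ)) • (𝓛 ^ n) ρ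

/-- `Re v⁺ L v ≤ 0` for all `v`. -/
def IsDissipative {N : ℕ} (L : Matrix (Fin N) (Fin N) ℂ) : Prop :=
  ∀ v : Fin N → ℂ, (star v ⬝ᵥ (L *ᵥ v)).re ≤ 0

/-- `|0⟩` as a vector of `ℂ ⊕ ℂ^N`. -/
def groundKet (N : ℕ) : Level N → ℂ := Sum.elim (fun _ => 1) (fun _ => 0)

/-- A vector of `ℂ^N` as a vector of `ℂ ⊕ ℂ^N`. -/
def excitedKet {N : ℕ} (v : EuclideanSpace ℂ (Fin N)) : Level N → ℂ :=
  Sum.elim (fun _ => 0) (fun i => v i)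

/-- `|u⟩⟨v|`. -/
def ketBra {N : ℕ} (u v : Level N → ℂ) : Matrix (Level N) (Level N) ℂ := vecMulVec u (star v)

/-- The Gorini--Kossakowski--Sudarshan--Lindblad form with Hamiltonian `H`, jump operators
`|0⟩⟨v_l|` and rates `Γ_l`:
`-i[H, ρ] + ∑_l Γ_l (|0⟩⟨v_l| ρ |v_l⟩⟨0| - (1/2){|v_l⟩⟨0|0⟩⟨v_l|, ρ})`. -/
def gkslForm {N : ℕ} (H : Matrix (Level N) (Level N) ℂ)
    (v : OrthonormalBasis (Fin N) ℂ (EuclideanSpace ℂ (Fin N))) (Γ : Fin N → ℝ)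
    (ρ : Matrix (Level N) (Level N) ℂ) : Matrix (Level N) (Level N) ℂ :=
  -Complex.I • (H * ρ - ρ * H) + ∑ l, (Γ l : ℂ) •
    (ketBra (groundKet N) (excitedKet (v l)) * ρ * ketBra (excitedKet (v l)) (groundKet N)
      - (1 / 2 : ℂ) •
        (ketBra (excitedKet (v l)) (groundKet N) * ketBra (groundKet N) (excitedKet (v l)) * ρ
          + ρ * (ketBra (excitedKet (v l)) (groundKet N)
            * ketBra (groundKet N) (excitedKet (v l)))))

/-- `A(λ) = B(λ) + O(λ⁴)` as `λ → 0`, `λ ≠ 0` (entrywise, equivalently in any norm). -/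
def EqUpToFourthOrder {N : ℕ} (A B : ℝ → Matrix (Level N) (Level N) ℂ) : Prop :=
  ∀ s s', (fun lam => A lam s s' - B lam s s') =O[𝓝[≠] (0 : ℝ)] fun lam => lam ^ 4

end

end MultiLevel

namespace MultiLevel

/-! ### Laplace transforms of bounded functions -/

/-! The Hamiltonian conserves the number of excitations, and `|0⟩Ω` is stationary. An initial vector
`|j⟩Ω` therefore evolves into `∑ᵢ Vᵢⱼ |i⟩Ω` plus `|0⟩` tensored with a one-boson state. Unitarity
fixes the inner products of the one-boson parts, so the whole reduced state is `renormMatrix V ρ`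
with `V = amplitude U₀ U t` (`reducedState_eq_renormMatrix`). Since `renormMatrix A ∘ renormMatrix B
= renormMatrix (A * B)` and `e^{𝓛t}` is `renormMatrix (e^{tL})` (`renormMatrix_mul`,
`semigroup_eq`), claim 1 reduces to a statement about matrices: `V(t/λ²)` equals both `e^{tL} r` and
`r e^{tL}` up to `O(λ⁴)`.

All reservoirs have the same coupling `g`, so the memory kernel is the scalar `G`. In an eigenvector
of `H_{S,λ}` with eigenvalue `κ`, an amplitude solves `x' = -iκx - λ² ∫₀ᵗ G(s) x(t-s) ds`
(`duhamel`, `hasDerivAt_amplitude`). Put `ε = λ²`, `z = -iκ`. On the rescaled time, with the free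
phase removed, its Laplace transform is `x(0) / (q + G̃(z + εq))`. Replacing `G̃(z + εq)` by its
linear Taylor polynomial, and `1 + εG̃'(z)` by `1/β` with `β = 1 - εG̃'(z)`, gives `x(0) / (q/β +
G̃(z))`, which is the transform of `x(0) β exp(-G̃(z)βt)`.

The error is estimated by inversion on `Re q = 1`. The difference of the resolvents decays only like
`ε/|q|`, so its derivative in `ξ` is inverted instead, at the price of a factor `1/t`. That
derivative is `O(ε/(1+ξ²))` everywhere, which gives `O(ε²)` for `|ξ| > 1/ε`. On `|ξ| ≤ 1/ε` it is
`O(ε²)` with derivative `O(ε²/(1+ξ²))`, and an integration by parts gives `O(ε²)` again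
(`exists_resolvent_diff_deriv`, `norm_oscillatory_integral_le`, `volterra_asymptotics`). Hence a
global bound is needed for `G̃'` only, and a local one for `G̃''`. The denominators stay away from
zero because `Re G̃ ≥ 0`.

This gives `r` and `L` as functions of `H_{S,λ}`, which commute. First-order perturbation theory
with divided differences (`norm_hermFun_sub_sub_le`) expresses them by `H_S⁽⁰⁾` and `H_S⁽²⁾` with an
error `O(λ⁴)`.

For the GKSL form it suffices to diagonalize `Γ = -(L + L⁺)`, which is nonnegative exactly when `L`
is dissipative. For small `λ` the term `-G̃(-iH_S⁽⁰⁾)` dominates `L`, and `Re G̃ ≥ 0` turns `Re G̃ ≠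
0` into strict positivity. -/

theorem norm_cexp_neg_mul (p : ℂ) (t : ℝ) :
    ‖Complex.exp (-p * t)‖ = Real.exp (-p.re * t) := by
  rw [Complex.norm_exp]; simp

theorem integrableOn_cexp_mul {f : ℝ → ℂ} {B : ℝ} (hf : AEStronglyMeasurable f)
    (hB : ∀ t, 0 < t → ‖f t‖ ≤ B) {p : ℂ} (hp : 0 < p.re) :
    IntegrableOn (fun t : ℝ => Complex.exp (-p * t) * f t) (Set.Ioi 0) := by
  refine Integrable.mono' (g := fun t => Real.exp (-p.re * t) * B)
    ((exp_neg_integrableOn_Ioi 0 hp).mul_const B) ?_ ?_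
  · exact (Continuous.aestronglyMeasurable (by fun_prop)).mul hf.restrict
  · refine (ae_restrict_mem measurableSet_Ioi).mono fun t ht => ?_
    rw [norm_mul, norm_cexp_neg_mul]
    exact mul_le_mul_of_nonneg_left (hB t ht) (Real.exp_pos _).le

theorem laplace_eq_integral {f : ℝ → ℂ} {B : ℝ} (hf : Continuous f)
    (hB : ∀ t, ‖f t‖ ≤ B) {p : ℂ} (hp : 0 < p.re) :
    laplace f p = ∫ t in Set.Ioi (0 : ℝ), Complex.exp (-p * t) * f t :=
  Tendsto.limUnder_eq (intervalIntegral_tendsto_integral_Ioi 0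
    (integrableOn_cexp_mul hf.aestronglyMeasurable (fun t _ => hB t) hp) tendsto_id)

theorem tendsto_cexp_mul_atTop {f : ℝ → ℂ} {B : ℝ}
    (hB : ∀ t, 0 < t → ‖f t‖ ≤ B) {p : ℂ} (hp : 0 < p.re) :
    Tendsto (fun t : ℝ => Complex.exp (-p * t) * f t) atTop (𝓝 0) := by
  have h1 : Tendsto (fun t : ℝ => Real.exp (-p.re * t) * B) atTop (𝓝 0) := by
    have h : Tendsto (fun t : ℝ => p.re * t) atTop atTop := tendsto_id.const_mul_atTop hp
    have := ((Real.tendsto_exp_neg_atTop_nhds_zero.comp h).mul_const B)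
    simpa [Function.comp_def] using this
  refine squeeze_zero_norm' ?_ h1
  filter_upwards [eventually_gt_atTop 0] with t ht
  rw [norm_mul, norm_cexp_neg_mul]
  exact mul_le_mul_of_nonneg_left (hB t ht) (Real.exp_pos _).le

/-- The Laplace transform of a bounded solution of a scalar Volterra equation. -/
theorem laplace_volterra {G x : ℝ → ℂ} {B C : ℝ} (hG : Continuous G) (hGB : ∀ t, ‖G t‖ ≤ B)
    (hx : Continuous x) (hxC : ∀ t, ‖x t‖ ≤ C) (a e : ℂ)
    (hderiv : ∀ t, 0 < t → HasDerivAt x (a * x t - e * ∫ s in (0 : ℝ)..t, G s * x (t - s)) t)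
    {p : ℂ} (hp : 0 < p.re) :
    (∫ t in Set.Ioi (0 : ℝ), Complex.exp (-p * t) * x t) * (p - a + e * laplace G p) = x 0 := by
  have hGi := integrableOn_cexp_mul hG.aestronglyMeasurable (fun t _ => hGB t) hp
  have hxi := integrableOn_cexp_mul hx.aestronglyMeasurable (fun t _ => hxC t) hp
  -- Splitting `e^{-pt} = e^{-ps} e^{-p(t-s)}` makes the damped memory term a convolution of two
  -- integrable functions, whose integral is a product.
  have hconv : ∀ t : ℝ, (∫ s in (0 : ℝ)..t, (ContinuousLinearMap.mul ℝ ℂ)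
      (Complex.exp (-p * s) * G s) (Complex.exp (-p * (t - s : ℝ)) * x (t - s)))
      = Complex.exp (-p * t) * ∫ s in (0 : ℝ)..t, G s * x (t - s) := by
    intro t
    rw [← intervalIntegral.integral_const_mul]
    refine intervalIntegral.integral_congr fun s _ => ?_
    simp only [ContinuousLinearMap.mul_apply']
    rw [show -p * (t : ℂ) = -p * s + -p * (t - s : ℝ) by push_cast; ring, Complex.exp_add]
    ring
  have h1 := integral_posConvolution hGi hxi (ContinuousLinearMap.mul ℝ ℂ)
  have h1' := integrable_posConvolution hGi hxi (ContinuousLinearMap.mul ℝ ℂ)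
  have h1i : IntegrableOn (fun t : ℝ => Complex.exp (-p * t) *
      ∫ s in (0 : ℝ)..t, G s * x (t - s)) (Set.Ioi 0) := by
    refine h1'.integrableOn.congr_fun (fun t ht => ?_) measurableSet_Ioi
    simp only [posConvolution, Set.indicator_of_mem ht, hconv]
  rw [setIntegral_congr_fun measurableSet_Ioi fun t _ => hconv t,
    ContinuousLinearMap.mul_apply'] at h1
  rw [← laplace_eq_integral hG hGB hp] at h1
  have hd : ∀ t ∈ Set.Ioi (0 : ℝ), HasDerivAt (fun t : ℝ => Complex.exp (-p * t) * x t)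
      ((a - p) * (Complex.exp (-p * t) * x t)
        - e * (Complex.exp (-p * t) * ∫ s in (0 : ℝ)..t, G s * x (t - s))) t := by
    intro t ht
    have he : HasDerivAt (fun t : ℝ => Complex.exp (-p * t)) (Complex.exp (-p * t) * -p) t := by
      have : HasDerivAt (fun t : ℝ => -p * (t : ℂ)) (-p) t := by
        simpa using (Complex.ofRealCLM.hasDerivAt (x := t)).const_mul (-p)
      exact this.cexp
    convert! he.mul (hderiv t ht) using 1
    ring
  have hint := ((hxi.const_mul (a - p)).sub (h1i.const_mul e))
  -- The total derivative of `e^{-pt} x(t)` integrates to `-x(0)`, the value at infinity being zero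
  -- because `x` is bounded.
  have key := integral_Ioi_of_hasDerivAt_of_tendsto
    (Continuous.continuousWithinAt (by fun_prop)) hd hint
    (tendsto_cexp_mul_atTop (fun t _ => hxC t) hp)
  rw [integral_sub (hxi.const_mul _) (h1i.const_mul _), integral_const_mul, integral_const_mul,
    h1] at key
  simp only [Complex.ofReal_zero, mul_zero, Complex.exp_zero, one_mul, zero_sub] at key
  linear_combination -key

/-! ### The correlation function -/

section corr

variable {ω : ℝ → ℝ} {g : ℝ → ℂ}

theorem integrable_norm_sq (hg : MemLp g 2 volume) : Integrable fun k => ‖g k‖ ^ 2 := by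
  have h : MemLp g ((2 : ℕ) : ENNReal) volume := by simpa using hg
  exact h.integrable_norm_pow (by norm_num)

theorem norm_corr_integrand (k t : ℝ) :
    ‖((‖g k‖ ^ 2 : ℝ) : ℂ) * Complex.exp (-Complex.I * ω k * t)‖ = ‖g k‖ ^ 2 := by
  rw [norm_mul, Complex.norm_exp]
  simp

theorem aestronglyMeasurable_corr_integrand (hω : Measurable ω) (hg : MemLp g 2 volume) (t : ℝ) :
    AEStronglyMeasurable
      (fun k : ℝ => ((‖g k‖ ^ 2 : ℝ) : ℂ) * Complex.exp (-Complex.I * ω k * t)) volume := by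
  refine AEStronglyMeasurable.mul ?_ ?_
  · exact Complex.continuous_ofReal.comp_aestronglyMeasurable
      (integrable_norm_sq hg).aestronglyMeasurable
  · exact Measurable.aestronglyMeasurable (by fun_prop)

theorem continuous_corr (hω : Measurable ω) (hg : MemLp g 2 volume) : Continuous (corr ω g) :=
  continuous_of_dominated (fun t => aestronglyMeasurable_corr_integrand hω hg t)
    (fun t => Eventually.of_forall fun k => (norm_corr_integrand k t).le) (integrable_norm_sq hg)
    (Eventually.of_forall fun k => by fun_prop)

theorem norm_corr_le (t : ℝ) : ‖corr ω g t‖ ≤ ∫ k, ‖g k‖ ^ 2 := by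
  refine (norm_integral_le_integral_norm _).trans (le_of_eq ?_)
  simp_rw [norm_corr_integrand]

/-- By Fubini the transform is `∫ |g(k)|² / (p + iω(k)) dk`, and every `1/(p + iω)` lies in the
right half-plane. -/
theorem laplace_corr_re_nonneg (hω : Measurable ω) (hg : MemLp g 2 volume) {p : ℂ}
    (hp : 0 < p.re) : 0 ≤ (laplace (corr ω g) p).re := by
  rw [laplace_eq_integral (continuous_corr hω hg) norm_corr_le hp]
  have hint : Integrable (Function.uncurry fun (t k : ℝ) =>
      Complex.exp (-p * t) * (((‖g k‖ ^ 2 : ℝ) : ℂ) * Complex.exp (-Complex.I * ω k * t)))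
      ((volume.restrict (Set.Ioi 0)).prod volume) := by
    have h1 := (exp_neg_integrableOn_Ioi 0 hp).mul_prod (integrable_norm_sq hg)
    refine h1.mono' ?_ ?_
    · refine AEStronglyMeasurable.mul (Measurable.aestronglyMeasurable (by fun_prop))
        (AEStronglyMeasurable.mul ?_ (Measurable.aestronglyMeasurable (by fun_prop)))
      exact (Complex.continuous_ofReal.comp_aestronglyMeasurable
        (integrable_norm_sq hg).aestronglyMeasurable).comp_snd
    · refine Eventually.of_forall fun z => ?_
      simp only [Function.uncurry]
      rw [norm_mul, norm_corr_integrand, norm_cexp_neg_mul]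
  have h2 : (∫ t in Set.Ioi (0 : ℝ), Complex.exp (-p * t) * corr ω g t)
      = ∫ k : ℝ, ((‖g k‖ ^ 2 : ℝ) : ℂ) * (1 / (p + Complex.I * ω k)) := by
    simp_rw [corr, ← integral_const_mul]
    rw [integral_integral_swap hint]
    refine integral_congr_ae (Eventually.of_forall fun k => ?_)
    have hre : (-p - Complex.I * ω k).re < 0 := by simpa using hp
    have h3 := integral_exp_mul_complex_Ioi hre 0
    simp only [Complex.ofReal_zero, mul_zero, Complex.exp_zero] at h3
    beta_reduce
    rw [show (1 : ℂ) / (p + Complex.I * ω k) = -1 / (-p - Complex.I * ω k) by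
      rw [show -p - Complex.I * ω k = -(p + Complex.I * ω k) by ring, neg_div_neg_eq], ← h3,
      ← integral_const_mul]
    refine integral_congr_ae (Eventually.of_forall fun t => ?_)
    simp only
    rw [show (-p - Complex.I * ω k) * (t : ℂ) = -p * t + -Complex.I * ω k * t by ring,
      Complex.exp_add]
    ring
  have h4 : Integrable fun k : ℝ => ((‖g k‖ ^ 2 : ℝ) : ℂ) * (1 / (p + Complex.I * ω k)) := by
    refine ((integrable_norm_sq hg).mul_const (1 / p.re)).mono' ?_ ?_
    · refine AEStronglyMeasurable.mul (Complex.continuous_ofReal.comp_aestronglyMeasurable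
        (integrable_norm_sq hg).aestronglyMeasurable) (Measurable.aestronglyMeasurable ?_)
      fun_prop
    · refine Eventually.of_forall fun k => ?_
      have h5 : p.re ≤ ‖p + Complex.I * ω k‖ := by
        have := Complex.re_le_norm (p + Complex.I * ω k)
        simpa using this
      rw [norm_mul, norm_div, norm_one, Complex.norm_real, norm_pow, norm_norm]
      gcongr
  rw [h2, ← RCLike.re_eq_complex_re, ← integral_re h4]
  refine integral_nonneg fun k => ?_
  simp only [RCLike.re_eq_complex_re, Complex.re_ofReal_mul]
  refine mul_nonneg (by positivity) ?_
  rw [one_div, Complex.inv_re]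
  refine div_nonneg ?_ (Complex.normSq_nonneg _)
  simpa using hp.le

end corr

/-! ### Inversion of the Laplace transform -/

open FourierTransform in
/-- Inversion of the Laplace transform on the line `Re p = 1`, after an integration by parts. -/
theorem laplace_inversion_of_hasDerivAt {f : ℝ → ℂ} {C : ℝ} (hf : Continuous f)
    (hC : ∀ t, 0 < t → ‖f t‖ ≤ C * Real.exp (t / 2)) {F F' : ℝ → ℂ}
    (hF : ∀ ξ : ℝ, (∫ t in Set.Ioi (0 : ℝ),
      Complex.exp (-(1 + 2 * Real.pi * Complex.I * ξ) * t) * f t) = F ξ)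
    (hF' : ∀ ξ, HasDerivAt F (F' ξ) ξ) (hi : Integrable F') {t : ℝ} (ht : 0 < t) :
    -(2 * Real.pi * Complex.I) * t * (Complex.exp (-t) * f t)
      = ∫ ξ : ℝ, Complex.exp ((2 * Real.pi * t * ξ : ℝ) * Complex.I) * F' ξ := by
  -- The Laplace transform at `1 + 2πiξ` is the Fourier transform of `e^{-t} f` cut off at `0`. The
  -- growth `e^{t/2}` allowed for `f` still leaves `u` and `t u` integrable.
  set u : ℝ → ℂ := (Set.Ioi (0 : ℝ)).indicator fun t => Complex.exp (-t) * f t with hu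
  have hC0 : 0 ≤ C := by
    have := (norm_nonneg _).trans (hC 1 one_pos)
    exact nonneg_of_mul_nonneg_left this (Real.exp_pos _)
  have hbound : ∀ t : ℝ, 0 < t → ‖Complex.exp (-t) * f t‖ ≤ C * Real.exp (-(1 / 2) * t) := by
    intro t ht
    rw [norm_mul, Complex.norm_exp]
    calc Real.exp (-(t : ℂ)).re * ‖f t‖ ≤ Real.exp (-t) * (C * Real.exp (t / 2)) := by
          simp only [Complex.neg_re, Complex.ofReal_re]
          gcongr
          exact hC t ht
      _ = C * Real.exp (-(1 / 2) * t) := by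
          rw [mul_left_comm, ← Real.exp_add]; congr 2; ring
  have hmeas : AEStronglyMeasurable (fun t : ℝ => Complex.exp (-t) * f t) volume :=
    Continuous.aestronglyMeasurable (by fun_prop)
  have hui : Integrable u := by
    rw [hu, integrable_indicator_iff measurableSet_Ioi]
    refine ((exp_neg_integrableOn_Ioi 0 (b := 1 / 2) (by norm_num)).const_mul C).mono'
      hmeas.restrict ?_
    exact (ae_restrict_mem measurableSet_Ioi).mono fun t ht => hbound t ht
  have htui : Integrable fun t : ℝ => t • u t := by
    have h1 : (fun t : ℝ => t • u t)
        = (Set.Ioi (0 : ℝ)).indicator fun t : ℝ => t • (Complex.exp (-t) * f t) := by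
      funext t; simp only [hu, Set.indicator]; split_ifs <;> simp
    rw [h1, integrable_indicator_iff measurableSet_Ioi]
    refine ((exp_neg_integrableOn_Ioi 0 (b := 1 / 4) (by norm_num)).const_mul (4 * C)).mono'
      (Continuous.aestronglyMeasurable (by fun_prop)) ?_
    refine (ae_restrict_mem measurableSet_Ioi).mono fun t (ht : 0 < t) => ?_
    rw [norm_smul, Real.norm_of_nonneg ht.le]
    have h2 : t ≤ 4 * Real.exp (1 / 4 * t) := by
      have := Real.add_one_le_exp (1 / 4 * t); linarith
    calc t * ‖Complex.exp (-t) * f t‖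
        ≤ (4 * Real.exp (1 / 4 * t)) * (C * Real.exp (-(1 / 2) * t)) := by
          gcongr; exact hbound t ht
      _ = 4 * C * Real.exp (-(1 / 4) * t) := by
          rw [show -(1 / 4) * t = 1 / 4 * t + -(1 / 2) * t by ring, Real.exp_add]; ring
  have hFu : 𝓕 u = F := by
    funext ξ
    rw [← hF, Real.fourier_eq', ← integral_indicator measurableSet_Ioi]
    refine integral_congr_ae (Eventually.of_forall fun t => ?_)
    simp only [hu, Set.indicator]
    split_ifs
    · simp only [smul_eq_mul]
      rw [← mul_assoc, ← Complex.exp_add]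
      congr 2
      simp only [RCLike.inner_apply, conj_trivial]
      push_cast; ring
    · simp
  -- Fourier inversion is applied to `-2πit u`, whose transform `F'` is integrable, whereas `F`
  -- itself need not be.
  have hder : 𝓕 (fun t : ℝ => (-2 * Real.pi * Complex.I * t) • u t) = F' := by
    funext ξ
    have h := Real.hasDerivAt_fourier hui htui ξ
    rw [hFu] at h
    exact h.unique (hF' ξ)
  have hvi : Integrable fun t : ℝ => (-2 * Real.pi * Complex.I * t) • u t := by
    convert! htui.const_mul (-2 * Real.pi * Complex.I) using 2 with t
    simp only [smul_eq_mul, Complex.real_smul]; ring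
  -- Pointwise inversion needs continuity at `t`; the cut at `0` is harmless since `t > 0`.
  have hcont : ContinuousAt (fun t : ℝ => (-2 * Real.pi * Complex.I * t) • u t) t := by
    have h1 : ContinuousAt (fun t : ℝ =>
        (-2 * Real.pi * Complex.I * t) • (Complex.exp (-t) * f t)) t :=
      Continuous.continuousAt (by fun_prop)
    refine h1.congr ?_
    filter_upwards [Ioi_mem_nhds ht] with s hs
    rw [hu, Set.indicator_of_mem hs]
  have hinv := hvi.fourierInv_fourier_eq (hder ▸ hi) hcont
  rw [hder, Real.fourierInv_eq'] at hinv
  rw [hu, Set.indicator_of_mem (Set.mem_Ioi.2 ht)] at hinv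
  rw [show -(2 * Real.pi * Complex.I) * (t : ℂ) * (Complex.exp (-t) * f t)
    = (-2 * Real.pi * Complex.I * t) • (Complex.exp (-t) * f t) by simp [smul_eq_mul], ← hinv]
  refine integral_congr_ae (Eventually.of_forall fun ξ => ?_)
  simp only [smul_eq_mul, RCLike.inner_apply, conj_trivial]
  congr 4; ring

/-- An oscillatory integral of a function which is small on a long interval, together with its
derivative, and decays quadratically. -/
theorem norm_oscillatory_integral_le {k k' : ℝ → ℂ} {K ε t : ℝ} (hK : 0 ≤ K) (hε : 0 < ε)
    (ht : 0 < t)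
    (hk : ∀ ξ, HasDerivAt k (k' ξ) ξ) (hk' : Continuous k')
    (hglob : ∀ ξ, ‖k ξ‖ ≤ K * ε * (1 + ξ ^ 2)⁻¹)
    (hloc : ∀ ξ, |ξ| ≤ 1 / ε → ‖k ξ‖ ≤ K * ε ^ 2)
    (hloc' : ∀ ξ, |ξ| ≤ 1 / ε → ‖k' ξ‖ ≤ K * ε ^ 2 * (1 + ξ ^ 2)⁻¹) :
    Integrable k ∧ ‖∫ ξ : ℝ, Complex.exp ((2 * Real.pi * t * ξ : ℝ) * Complex.I) * k ξ‖
      ≤ K * (2 + 1 / t) * ε ^ 2 := by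
  have hkc : Continuous k := continuous_iff_continuousAt.2 fun ξ => (hk ξ).continuousAt
  have hint : Integrable k :=
    (integrable_inv_one_add_sq.const_mul (K * ε)).mono' hkc.aestronglyMeasurable
      (Eventually.of_forall hglob)
  refine ⟨hint, ?_⟩
  set c : ℂ := 2 * Real.pi * t * Complex.I with hc
  have hc0 : c ≠ 0 := by
    simp [hc, Real.pi_ne_zero, ht.ne']
  have hcn : ‖c‖ = 2 * Real.pi * t := by
    simp [hc, abs_of_pos Real.pi_pos, abs_of_pos ht]
  have hexp : ∀ ξ : ℝ, Complex.exp ((2 * Real.pi * t * ξ : ℝ) * Complex.I)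
      = Complex.exp (c * ξ) := by
    intro ξ; congr 1; rw [hc]; push_cast; ring
  have hnorm : ∀ ξ : ℝ, ‖Complex.exp (c * ξ)‖ = 1 := by
    intro ξ; rw [← hexp, Complex.norm_exp_ofReal_mul_I]
  simp_rw [hexp]
  set X := 1 / ε with hX
  have hX0 : 0 < X := by positivity
  have hei : Integrable fun ξ : ℝ => Complex.exp (c * ξ) * k ξ := by
    refine hint.norm.mono' (Continuous.aestronglyMeasurable (by fun_prop)) ?_
    exact Eventually.of_forall fun ξ => by rw [norm_mul, hnorm, one_mul]
  have hinv : ∫ ξ in -X..X, (1 + ξ ^ 2)⁻¹ = 2 * Real.arctan X := by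
    rw [integral_inv_one_add_sq, Real.arctan_neg]; ring
  -- the tails
  have htail : ‖∫ ξ in (Set.Ioc (-X) X)ᶜ, Complex.exp (c * ξ) * k ξ‖ ≤ K * 2 * ε ^ 2 := by
    have h1 : ‖∫ ξ in (Set.Ioc (-X) X)ᶜ, Complex.exp (c * ξ) * k ξ‖
        ≤ ∫ ξ in (Set.Ioc (-X) X)ᶜ, K * ε * (1 + ξ ^ 2)⁻¹ := by
      refine norm_integral_le_of_norm_le (integrable_inv_one_add_sq.const_mul _).integrableOn ?_
      exact Eventually.of_forall fun ξ => by rw [norm_mul, hnorm, one_mul]; exact hglob ξ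
    refine h1.trans ?_
    have h2 := integral_add_compl (measurableSet_Ioc (a := -X) (b := X)) integrable_inv_one_add_sq
    rw [← intervalIntegral.integral_of_le (by linarith), hinv, integral_univ_inv_one_add_sq] at h2
    rw [integral_const_mul]
    -- The mass of `(1 + ξ²)⁻¹` beyond `1/ε` is `2 arctan ε ≤ 2ε`; this supplies the second factor
    -- `ε` missing from the global bound.
    have h3 : ∫ ξ in (Set.Ioc (-X) X)ᶜ, (1 + ξ ^ 2)⁻¹ = 2 * Real.arctan X⁻¹ := by
      rw [Real.arctan_inv_of_pos hX0]; linarith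
    have h4 : Real.arctan X⁻¹ ≤ ε := by
      have : X⁻¹ = ε := by simp [hX]
      rw [this]
      have h5 := Real.le_tan (Real.arctan_nonneg.2 hε.le) (Real.arctan_lt_pi_div_two ε)
      rwa [Real.tan_arctan] at h5
    rw [h3]
    calc K * ε * (2 * Real.arctan X⁻¹) ≤ K * ε * (2 * ε) := by gcongr
      _ = _ := by ring
  -- the central part
  have hcent : ‖∫ ξ in -X..X, Complex.exp (c * ξ) * k ξ‖ ≤ K * (1 / t) * ε ^ 2 := by
    have hv : ∀ ξ : ℝ, HasDerivAt (fun ξ : ℝ => Complex.exp (c * ξ) / c) (Complex.exp (c * ξ)) ξ := by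
      intro ξ
      have h1 : HasDerivAt (fun ξ : ℝ => c * (ξ : ℂ)) c ξ := by
        simpa using (Complex.ofRealCLM.hasDerivAt (x := ξ)).const_mul c
      convert! h1.cexp.div_const c using 1
      field_simp
    -- A bound `ε²` on an interval of length `2/ε` would only give `O(ε)`. After an integration by
    -- parts the bound of `k'` is integrable uniformly in `ε`.
    have hparts := intervalIntegral.integral_mul_deriv_eq_deriv_mul (a := -X) (b := X)
      (fun ξ _ => hk ξ) (fun ξ _ => hv ξ) (hk'.intervalIntegrable _ _)
      (Continuous.intervalIntegrable (by fun_prop) _ _)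
    have hcomm : (∫ ξ in -X..X, Complex.exp (c * ξ) * k ξ)
        = ∫ ξ in -X..X, k ξ * Complex.exp (c * ξ) := by simp_rw [mul_comm]
    rw [hcomm, hparts]
    have hb : ∀ ξ : ℝ, |ξ| ≤ X → ‖k ξ * (Complex.exp (c * ξ) / c)‖
        ≤ K * ε ^ 2 / (2 * Real.pi * t) := by
      intro ξ hξ
      rw [norm_mul, norm_div, hnorm, hcn, mul_one_div]
      gcongr
      exact hloc ξ hξ
    have hm : ‖∫ ξ in -X..X, k' ξ * (Complex.exp (c * ξ) / c)‖
        ≤ K * ε ^ 2 / (2 * Real.pi * t) * Real.pi := by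
      have h1 : ‖∫ ξ in -X..X, k' ξ * (Complex.exp (c * ξ) / c)‖
          ≤ ∫ ξ in -X..X, K * ε ^ 2 / (2 * Real.pi * t) * (1 + ξ ^ 2)⁻¹ := by
        refine intervalIntegral.norm_integral_le_of_norm_le (by linarith) ?_
          (integrable_inv_one_add_sq.const_mul _).intervalIntegrable
        refine Eventually.of_forall fun ξ hξ => ?_
        rw [norm_mul, norm_div, hnorm, hcn, mul_one_div, div_mul_eq_mul_div]
        gcongr
        exact hloc' ξ (abs_le.2 ⟨hξ.1.le, hξ.2⟩)
      refine h1.trans ?_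
      rw [intervalIntegral.integral_const_mul, hinv]
      have : 2 * Real.arctan X ≤ Real.pi := by linarith [Real.arctan_lt_pi_div_two X]
      gcongr
    have h5 := hb X (abs_of_pos hX0).le
    have h6 := hb (-X) (by rw [abs_neg, abs_of_pos hX0])
    have hpi := Real.pi_gt_three
    calc _ ≤ K * ε ^ 2 / (2 * Real.pi * t) + K * ε ^ 2 / (2 * Real.pi * t)
          + K * ε ^ 2 / (2 * Real.pi * t) * Real.pi := by
          refine (norm_sub_le _ _).trans (add_le_add ((norm_sub_le _ _).trans
            (add_le_add h5 h6)) hm)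
      _ = K * ε ^ 2 / t * ((2 + Real.pi) / (2 * Real.pi)) := by field_simp; ring
      _ ≤ K * ε ^ 2 / t * 1 := by
          gcongr
          rw [div_le_one (by positivity)]; linarith
      _ = _ := by ring
  rw [← integral_add_compl (measurableSet_Ioc (a := -X) (b := X)) hei,
    ← intervalIntegral.integral_of_le (by linarith)]
  calc _ ≤ K * (1 / t) * ε ^ 2 + K * 2 * ε ^ 2 := (norm_add_le _ _).trans (add_le_add hcent htail)
    _ = _ := by ring

/-! ### Scalar Volterra equations in the weak coupling limit -/

/-- Quantitative form of: `F` is twice continuously differentiable on the closed half-plane, with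
nonnegative real part and bounded first derivative; `z` is a point of the imaginary axis. -/
structure HalfPlaneBounds (F F' F'' : ℂ → ℂ) (M : ℝ) (z : ℂ) : Prop where
  one_le : 1 ≤ M
  re_eq : z.re = 0
  hasDerivAt : ∀ p : ℂ, 0 < p.re → HasDerivAt F (F' p) p
  hasDerivAt' : ∀ p : ℂ, 0 < p.re → HasDerivAt F' (F'' p) p
  continuousOn : ContinuousOn F'' {p | 0 < p.re}
  re_nonneg : ∀ p : ℂ, 0 ≤ p.re → 0 ≤ (F p).re
  norm_le : ‖F z‖ ≤ M
  norm_deriv_le : ∀ p : ℂ, 0 ≤ p.re → ‖F' p‖ ≤ M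
  lipschitz : ∀ p : ℂ, 0 ≤ p.re → ‖F p - F z‖ ≤ M * ‖p - z‖
  taylor : ∀ p : ℂ, 0 ≤ p.re → ‖p - z‖ ≤ 8 → ‖F p - F z - F' z * (p - z)‖ ≤ M * ‖p - z‖ ^ 2
  lipschitz' : ∀ p : ℂ, 0 ≤ p.re → ‖p - z‖ ≤ 8 → ‖F' p - F' z‖ ≤ M * ‖p - z‖
  norm_deriv2_le : ∀ p : ℂ, 0 ≤ p.re → ‖p - z‖ ≤ 8 → ‖F'' p‖ ≤ M

/-- Bounds for the derivative of `-E u v`, and its derivative. -/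
theorem norm_product_derivs_le {E E₁ E₂ u u₁ u₂ v v₁ v₂ : ℂ} {e₀ e₁ e₂ D s : ℝ} (hs : 0 ≤ s)
    (hD : 1 ≤ D) (he₁ : 0 ≤ e₁)
    (hE : ‖E‖ ≤ e₀) (hE₁ : ‖E₁‖ ≤ e₁) (hE₂ : ‖E₂‖ ≤ e₂)
    (hu : ‖u‖ ≤ D * s) (hu₁ : ‖u₁‖ ≤ 14 * D ^ 2 * s ^ 2) (hu₂ : ‖u₂‖ ≤ 500 * D ^ 3 * s ^ 3)
    (hv : ‖v‖ ≤ D * s) (hv₁ : ‖v₁‖ ≤ 14 * D ^ 2 * s ^ 2) (hv₂ : ‖v₂‖ ≤ 500 * D ^ 3 * s ^ 3) :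
    ‖-(E₂ * (u * v) + 2 * (E₁ * (u₁ * v + u * v₁)) + E * (u₂ * v + 2 * (u₁ * v₁) + u * v₂))‖
        ≤ 1400 * D ^ 4 * (e₂ * s ^ 2 + e₁ * s ^ 3 + e₀ * s ^ 4) := by
  have he₀ : 0 ≤ e₀ := (norm_nonneg _).trans hE
  have he₂ : 0 ≤ e₂ := (norm_nonneg _).trans hE₂
  have hD2 : D ^ 2 ≤ D ^ 4 := pow_le_pow_right₀ hD (by norm_num)
  have hD3 : D ^ 3 ≤ D ^ 4 := pow_le_pow_right₀ hD (by norm_num)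
  have hD4 : 0 ≤ D ^ 4 := by positivity
  calc _ ≤ ‖E₂‖ * (‖u‖ * ‖v‖) + 2 * (‖E₁‖ * (‖u₁‖ * ‖v‖ + ‖u‖ * ‖v₁‖))
        + ‖E‖ * (‖u₂‖ * ‖v‖ + 2 * (‖u₁‖ * ‖v₁‖) + ‖u‖ * ‖v₂‖) := by
        rw [norm_neg]
        refine (norm_add₃_le).trans ?_
        simp only [norm_mul, Complex.norm_ofNat]
        gcongr
        · exact (norm_add_le _ _).trans (by simp)
        · exact (norm_add₃_le).trans (by simp)
    _ ≤ e₂ * (D * s * (D * s)) + 2 * (e₁ * (14 * D ^ 2 * s ^ 2 * (D * s)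
          + D * s * (14 * D ^ 2 * s ^ 2)))
        + e₀ * (500 * D ^ 3 * s ^ 3 * (D * s) + 2 * (14 * D ^ 2 * s ^ 2 * (14 * D ^ 2 * s ^ 2))
          + D * s * (500 * D ^ 3 * s ^ 3)) := by gcongr
    _ = D ^ 2 * (e₂ * s ^ 2) + 56 * D ^ 3 * (e₁ * s ^ 3) + 1392 * D ^ 4 * (e₀ * s ^ 4) := by ring
    _ ≤ 1400 * D ^ 4 * (e₂ * s ^ 2) + 1400 * D ^ 4 * (e₁ * s ^ 3)
        + 1400 * D ^ 4 * (e₀ * s ^ 4) := by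
        gcongr <;> linarith
    _ = _ := by ring

/-- In the application `s = 1/|q|`, `u` and `v` are reciprocals of denominators of size at least a
multiple of `|q|`, and `E` is the difference of these denominators. Each derivative of `u` or `v`
gains a factor `s`. -/
theorem norm_product_deriv_le {E E₁ u u₁ v v₁ : ℂ} {e₀ e₁ D s : ℝ} (hs : 0 ≤ s)
    (hD : 1 ≤ D) (hE : ‖E‖ ≤ e₀) (hE₁ : ‖E₁‖ ≤ e₁)
    (hu : ‖u‖ ≤ D * s) (hu₁ : ‖u₁‖ ≤ 14 * D ^ 2 * s ^ 2)
    (hv : ‖v‖ ≤ D * s) (hv₁ : ‖v₁‖ ≤ 14 * D ^ 2 * s ^ 2) :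
    ‖-(E₁ * (u * v) + E * (u₁ * v + u * v₁))‖ ≤ 28 * D ^ 3 * (e₁ * s ^ 2 + e₀ * s ^ 3) := by
  have he₀ : 0 ≤ e₀ := (norm_nonneg _).trans hE
  have he₁ : 0 ≤ e₁ := (norm_nonneg _).trans hE₁
  have hD2 : D ^ 2 ≤ D ^ 3 := pow_le_pow_right₀ hD (by norm_num)
  have hD3 : 0 ≤ D ^ 3 := by positivity
  calc _ ≤ ‖E₁‖ * (‖u‖ * ‖v‖) + ‖E‖ * (‖u₁‖ * ‖v‖ + ‖u‖ * ‖v₁‖) := by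
        rw [norm_neg]
        refine (norm_add_le _ _).trans ?_
        simp only [norm_mul]
        gcongr
        exact (norm_add_le _ _).trans (by simp)
    _ ≤ e₁ * (D * s * (D * s)) + e₀ * (14 * D ^ 2 * s ^ 2 * (D * s)
          + D * s * (14 * D ^ 2 * s ^ 2)) := by gcongr
    _ = D ^ 2 * (e₁ * s ^ 2) + 28 * D ^ 3 * (e₀ * s ^ 3) := by ring
    _ ≤ 28 * D ^ 3 * (e₁ * s ^ 2) + 28 * D ^ 3 * (e₀ * s ^ 3) := by
        gcongr; linarith
    _ = _ := by ring

/-! ### Comparison of the exact and the effective resolvent on `Re q = 1`. -/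

namespace HalfPlaneBounds

variable {F F' F'' : ℂ → ℂ} {M : ℝ} {z : ℂ}

section

variable (h : HalfPlaneBounds F F' F'' M z) {ε : ℝ} (hε : 0 < ε) (hεM : 48 * M ^ 2 * ε ≤ 1)
include h hε hεM

theorem eps_mul_le : M * ε ≤ 1 / 48 ∧ ε ≤ 1 / 48 := by
  have h1 := h.one_le
  have h2 : M * ε ≤ M ^ 2 * ε := by gcongr; nlinarith
  have h3 : ε ≤ M * ε := by nlinarith
  constructor <;> linarith

theorem norm_renorm : ‖ε * F' z‖ ≤ M * ε ∧ 1 / 2 ≤ ‖1 - ε * F' z‖ := by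
  have h1 : ‖ε * F' z‖ ≤ M * ε := by
    rw [norm_mul, Complex.norm_real, Real.norm_of_nonneg hε.le, mul_comm]
    gcongr
    exact h.norm_deriv_le z h.re_eq.ge
  refine ⟨h1, ?_⟩
  have h2 := norm_sub_norm_le (1 : ℂ) (ε * F' z)
  have h3 := (h.eps_mul_le hε hεM).1
  rw [norm_one] at h2
  linarith

theorem norm_renorm_inv_sub_one : ‖(1 - ε * F' z)⁻¹ - 1‖ ≤ 2 * M * ε
    ∧ ‖(1 - ε * F' z)⁻¹‖ ≤ 2 := by
  obtain ⟨h1, h2⟩ := h.norm_renorm hε hεM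
  have h3 : (1 - ε * F' z) ≠ 0 := by
    intro h0; rw [h0, norm_zero] at h2; norm_num at h2
  have h4 : ‖(1 - ε * F' z)⁻¹‖ ≤ 2 := by
    rw [norm_inv]
    exact inv_le_of_inv_le₀ (by norm_num) (by linarith)
  refine ⟨?_, h4⟩
  rw [show (1 - ε * F' z)⁻¹ - 1 = ε * F' z * (1 - ε * F' z)⁻¹ by field_simp; ring, norm_mul]
  have := mul_le_mul h1 h4 (norm_nonneg _) ((norm_nonneg _).trans h1)
  linarith

set_option maxHeartbeats 1000000 in
/-- The difference of the two resolvents, as a function on the line `Re q = 1`, is small. -/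
theorem exists_resolvent_diff_deriv :
    ∃ k k' : ℝ → ℂ,
      (∀ ξ : ℝ, HasDerivAt (fun ξ : ℝ =>
        (1 + 2 * Real.pi * Complex.I * ξ + F (ε * (1 + 2 * Real.pi * Complex.I * ξ) + z))⁻¹
        - ((1 + 2 * Real.pi * Complex.I * ξ) * (1 - ε * F' z)⁻¹ + F z)⁻¹) (k ξ) ξ) ∧
      (∀ ξ, HasDerivAt k (k' ξ) ξ) ∧ Continuous k' ∧
      (∀ ξ, ‖k ξ‖ ≤ 200000 * (16 * M) ^ 6 * ε * (1 + ξ ^ 2)⁻¹) ∧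
      (∀ ξ, |ξ| ≤ 1 / ε → ‖k ξ‖ ≤ 200000 * (16 * M) ^ 6 * ε ^ 2) ∧
      (∀ ξ, |ξ| ≤ 1 / ε → ‖k' ξ‖ ≤ 200000 * (16 * M) ^ 6 * ε ^ 2 * (1 + ξ ^ 2)⁻¹) := by
  have hM := h.one_le
  obtain ⟨hMε, hε1⟩ := h.eps_mul_le hε hεM
  obtain ⟨hβ1, hβ2⟩ := h.norm_renorm_inv_sub_one hε hεM
  set B : ℂ := (1 - ε * F' z)⁻¹ with hB
  set c : ℂ := 2 * Real.pi * Complex.I with hc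
  have hpi3 := Real.pi_gt_three
  have hpi4 := Real.pi_lt_d2
  have hcn : ‖c‖ = 2 * Real.pi := by simp [hc, abs_of_pos Real.pi_pos]
  have hc7 : ‖c‖ ≤ 7 := by rw [hcn]; linarith
  have hcc : ‖c ^ 2‖ ≤ 40 := by rw [norm_pow, hcn]; nlinarith
  set q : ℝ → ℂ := fun ξ => 1 + c * ξ with hq
  set p : ℝ → ℂ := fun ξ => ε * q ξ + z with hp
  have hqre : ∀ ξ, (q ξ).re = 1 := by intro ξ; simp [hq, hc]
  have hpre : ∀ ξ, 0 < (p ξ).re := by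
    intro ξ
    have : (p ξ).re = ε := by simp [hp, hqre, h.re_eq]
    rw [this]; exact hε
  have hqn : ∀ ξ, ‖q ξ‖ ^ 2 = 1 + (2 * Real.pi) ^ 2 * ξ ^ 2 := by
    intro ξ
    rw [← Complex.normSq_eq_norm_sq, Complex.normSq_apply]
    simp [hq, hc]; ring
  have hq1 : ∀ ξ, 1 ≤ ‖q ξ‖ := fun ξ => by
    have := Complex.re_le_norm (q ξ); rwa [hqre] at this
  have hq0 : ∀ ξ, 0 < ‖q ξ‖ := fun ξ => one_pos.trans_le (hq1 ξ)
  have hs2 : ∀ ξ, (‖q ξ‖⁻¹) ^ 2 ≤ (1 + ξ ^ 2)⁻¹ := by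
    intro ξ
    rw [inv_pow, hqn]
    have h1 : 1 * ξ ^ 2 ≤ (2 * Real.pi) ^ 2 * ξ ^ 2 := by gcongr; nlinarith
    gcongr
    linarith
  have hpz : ∀ ξ, p ξ - z = ε * q ξ := fun ξ => by simp [hp]
  have hpzn : ∀ ξ, ‖p ξ - z‖ = ε * ‖q ξ‖ := fun ξ => by
    rw [hpz, norm_mul, Complex.norm_real, Real.norm_of_nonneg hε.le]
  -- The radius 8 in `HalfPlaneBounds` originates here: `ε|q| ≤ ε + 2π ≤ 1 + 7` on the central
  -- range.
  have hloc : ∀ ξ, |ξ| ≤ 1 / ε → ε * ‖q ξ‖ ≤ 8 := by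
    intro ξ hξ
    have h1 : ‖q ξ‖ ≤ 1 + ‖c‖ * |ξ| := by
      refine (norm_add_le _ _).trans ?_
      rw [norm_one, norm_mul, Complex.norm_real, Real.norm_eq_abs]
    have h2 : ε * |ξ| ≤ 1 := by rw [le_div_iff₀ hε] at hξ; linarith
    calc ε * ‖q ξ‖ ≤ ε * (1 + ‖c‖ * |ξ|) := by gcongr
      _ = ε + ‖c‖ * (ε * |ξ|) := by ring
      _ ≤ 1 + 7 * 1 := by gcongr; linarith
      _ = 8 := by norm_num
  have hdq : ∀ ξ, HasDerivAt q c ξ := by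
    intro ξ
    have h1 : HasDerivAt (fun ξ : ℝ => 1 + c * (ξ : ℂ)) c ξ := by
      simpa using ((Complex.ofRealCLM.hasDerivAt (x := ξ)).const_mul c).const_add 1
    exact h1
  have hdp : ∀ ξ, HasDerivAt p (ε * c) ξ := fun ξ => ((hdq ξ).const_mul _).add_const _
  -- `P` is the denominator of the exact transform and `Q` that of the effective exponential; the
  -- function studied is `1/P - 1/Q = -(P - Q)/(PQ)`.
  set P : ℝ → ℂ := fun ξ => q ξ + F (p ξ) with hP
  set P₁ : ℝ → ℂ := fun ξ => c * (1 + ε * F' (p ξ)) with hP1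
  set P₂ : ℝ → ℂ := fun ξ => c ^ 2 * (ε ^ 2 * F'' (p ξ)) with hP2
  set Q : ℝ → ℂ := fun ξ => q ξ * B + F z with hQ
  have hdP : ∀ ξ, HasDerivAt P (P₁ ξ) ξ := by
    intro ξ
    convert! (hdq ξ).add ((h.hasDerivAt _ (hpre ξ)).comp ξ (hdp ξ)) using 1
    simp only [hP1]; ring
  have hdP₁ : ∀ ξ, HasDerivAt P₁ (P₂ ξ) ξ := by
    intro ξ
    convert! ((((h.hasDerivAt' _ (hpre ξ)).comp ξ (hdp ξ)).const_mul (ε : ℂ)).const_add 1).const_mul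
      c using 1
    simp only [hP2]; ring
  have hdQ : ∀ ξ, HasDerivAt Q (c * B) ξ := fun ξ => ((hdq ξ).mul_const _).add_const _
  have hP₂c : Continuous P₂ := by
    have : Continuous fun ξ => F'' (p ξ) := by
      refine h.continuousOn.comp_continuous ?_ hpre
      exact continuous_iff_continuousAt.2 fun ξ => (hdp ξ).continuousAt
    exact continuous_const.mul (continuous_const.mul this)
  -- the difference of the denominators
  set E : ℝ → ℂ := fun ξ => P ξ - Q ξ with hE
  set E₁ : ℝ → ℂ := fun ξ => P₁ ξ - c * B with hE1
  have hdE : ∀ ξ, HasDerivAt E (E₁ ξ) ξ := fun ξ => (hdP ξ).sub (hdQ ξ)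
  have hdE₁ : ∀ ξ, HasDerivAt E₁ (P₂ ξ) ξ := fun ξ => (hdP₁ ξ).sub_const _
  -- Globally only the Lipschitz bound of `F` is available, so `E` is of first order in `ε`.
  have hEg : ∀ ξ, ‖E ξ‖ ≤ 3 * M * ε * ‖q ξ‖ := by
    intro ξ
    have h1 : E ξ = (F (p ξ) - F z) - q ξ * (B - 1) := by simp only [hE, hP, hQ]; ring
    rw [h1]
    calc _ ≤ ‖F (p ξ) - F z‖ + ‖q ξ‖ * ‖B - 1‖ := (norm_sub_le _ _).trans (by rw [norm_mul])
      _ ≤ M * (ε * ‖q ξ‖) + ‖q ξ‖ * (2 * M * ε) := by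
          gcongr
          exact (h.lipschitz _ (hpre ξ).le).trans (by rw [hpzn])
      _ = _ := by ring
  have hE₁g : ∀ ξ, ‖E₁ ξ‖ ≤ 21 * M * ε := by
    intro ξ
    have h1 : E₁ ξ = c * (ε * F' (p ξ) - (B - 1)) := by simp only [hE1, hP1]; ring
    rw [h1, norm_mul]
    calc _ ≤ 7 * (ε * M + 2 * M * ε) := by
          gcongr
          refine (norm_sub_le _ _).trans (add_le_add ?_ hβ1)
          rw [norm_mul, Complex.norm_real, Real.norm_of_nonneg hε.le]
          gcongr
          exact h.norm_deriv_le _ (hpre ξ).le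
      _ = _ := by ring
  -- This makes `q(B - 1)` agree with the linear Taylor term `εqF'(z)` up to second order in `ε`, so
  -- that near `z` only the Taylor remainder and `εF'(z)(B - 1)q` survive in `E`.
  have hbB : B - 1 = ε * F' z * B := by
    have h2 := (h.norm_renorm hε hεM).2
    have h3 : (1 - ε * F' z) ≠ 0 := by
      intro h0; rw [h0, norm_zero] at h2; norm_num at h2
    rw [hB]; field_simp; ring
  have hbn : ‖F' z‖ ≤ M := h.norm_deriv_le z h.re_eq.ge
  have hEl : ∀ ξ, |ξ| ≤ 1 / ε → ‖E ξ‖ ≤ 3 * M ^ 2 * ε ^ 2 * ‖q ξ‖ ^ 2 := by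
    intro ξ hξ
    have h1 : E ξ = (F (p ξ) - F z - F' z * (p ξ - z)) - q ξ * (ε * F' z * (B - 1)) := by
      rw [hpz]
      have : E ξ = (F (p ξ) - F z) - q ξ * (B - 1) := by simp only [hE, hP, hQ]; ring
      rw [this]
      linear_combination (-q ξ) * hbB
    rw [h1]
    calc _ ≤ M * (ε * ‖q ξ‖) ^ 2 + ‖q ξ‖ * (ε * M * (2 * M * ε)) := by
          refine (norm_sub_le _ _).trans (add_le_add ?_ ?_)
          · rw [← hpzn]; exact h.taylor _ (hpre ξ).le (by rw [hpzn]; exact hloc ξ hξ)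
          · rw [norm_mul, norm_mul, norm_mul, Complex.norm_real, Real.norm_of_nonneg hε.le]
            gcongr
      _ = M * ε ^ 2 * ‖q ξ‖ ^ 2 + 2 * M ^ 2 * ε ^ 2 * ‖q ξ‖ := by ring
      _ ≤ M ^ 2 * ε ^ 2 * ‖q ξ‖ ^ 2 + 2 * M ^ 2 * ε ^ 2 * ‖q ξ‖ ^ 2 := by
          gcongr
          · nlinarith
          · nlinarith [hq1 ξ]
      _ = _ := by ring
  have hE₁l : ∀ ξ, |ξ| ≤ 1 / ε → ‖E₁ ξ‖ ≤ 21 * M ^ 2 * ε ^ 2 * ‖q ξ‖ := by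
    intro ξ hξ
    have h1 : E₁ ξ = c * (ε * ((F' (p ξ) - F' z) - F' z * (B - 1))) := by
      have : E₁ ξ = c * (ε * F' (p ξ) - (B - 1)) := by simp only [hE1, hP1]; ring
      rw [this]
      linear_combination (-c) * hbB
    rw [h1, norm_mul c, norm_mul (ε : ℂ), Complex.norm_real, Real.norm_of_nonneg hε.le]
    calc _ ≤ 7 * (ε * (M * (ε * ‖q ξ‖) + M * (2 * M * ε))) := by
          gcongr
          refine (norm_sub_le _ _).trans (add_le_add ?_ ?_)
          · rw [← hpzn]; exact h.lipschitz' _ (hpre ξ).le (by rw [hpzn]; exact hloc ξ hξ)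
          · rw [norm_mul]; gcongr
      _ = 7 * (M * ε ^ 2 * ‖q ξ‖ + 2 * M ^ 2 * ε ^ 2 * 1) := by ring
      _ ≤ 7 * (M ^ 2 * ε ^ 2 * ‖q ξ‖ + 2 * M ^ 2 * ε ^ 2 * ‖q ξ‖) := by
          gcongr
          · nlinarith
          · exact hq1 ξ
      _ = _ := by ring
  have hE₂l : ∀ ξ, |ξ| ≤ 1 / ε → ‖P₂ ξ‖ ≤ 40 * M * ε ^ 2 := by
    intro ξ hξ
    simp only [hP2]
    rw [norm_mul, norm_mul, norm_pow (ε : ℂ), Complex.norm_real, Real.norm_of_nonneg hε.le]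
    calc _ ≤ 40 * (ε ^ 2 * M) := by
          gcongr
          exact h.norm_deriv2_le _ (hpre ξ).le (by rw [hpzn]; exact hloc ξ hξ)
      _ = _ := by ring
  -- lower bounds for the denominators
  have hPlow : ∀ ξ, ‖q ξ‖ ≤ 8 * M * ‖P ξ‖ := by
    intro ξ
    have h1 : 1 ≤ ‖P ξ‖ := by
      have h2 := Complex.re_le_norm (P ξ)
      have h3 := h.re_nonneg (p ξ) (hpre ξ).le
      simp only [hP, Complex.add_re, hqre] at h2 ⊢
      linarith
    have h4 : ‖q ξ‖ - M - M * (ε * ‖q ξ‖) ≤ ‖P ξ‖ := by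
      have h5 : q ξ = P ξ - F z - (F (p ξ) - F z) := by simp only [hP]; ring
      have h6 := norm_sub_le (P ξ - F z) (F (p ξ) - F z)
      have h7 := norm_sub_le (P ξ) (F z)
      have h8 := h.lipschitz (p ξ) (hpre ξ).le
      rw [← h5] at h6
      rw [hpzn] at h8
      linarith [h.norm_le]
    have h9 : M * (ε * ‖q ξ‖) ≤ 1 / 48 * ‖q ξ‖ := by
      rw [← mul_assoc]; gcongr
    nlinarith [hq0 ξ]
  -- The sign of `Re Q` is not controlled directly, so `Q` is treated as a perturbation of `P`.
  have hQlow : ∀ ξ, ‖q ξ‖ ≤ 16 * M * ‖Q ξ‖ := by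
    intro ξ
    have h1 : ‖P ξ‖ ≤ ‖E ξ‖ + ‖Q ξ‖ := by
      have := norm_add_le (E ξ) (Q ξ)
      simpa [hE] using this
    have h2 := hEg ξ
    have h3 := hPlow ξ
    -- The constant 48 in the smallness condition is what makes `24M²ε ≤ 1/2`.
    have h4 : 8 * M * (3 * M * ε * ‖q ξ‖) ≤ 1 / 2 * ‖q ξ‖ := by
      have := mul_le_mul_of_nonneg_right hεM (hq0 ξ).le
      nlinarith
    nlinarith [hq0 ξ]
  have hP0 : ∀ ξ, P ξ ≠ 0 := by
    intro ξ h0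
    have := hPlow ξ
    rw [h0, norm_zero, mul_zero] at this
    linarith [hq0 ξ]
  have hQ0 : ∀ ξ, Q ξ ≠ 0 := by
    intro ξ h0
    have := hQlow ξ
    rw [h0, norm_zero, mul_zero] at this
    linarith [hq0 ξ]
  set D : ℝ := 16 * M with hD
  have hD1 : 1 ≤ D := by rw [hD]; linarith
  set s : ℝ → ℝ := fun ξ => ‖q ξ‖⁻¹ with hs
  have hs0 : ∀ ξ, 0 < s ξ := fun ξ => inv_pos.2 (hq0 ξ)
  have hs1 : ∀ ξ, s ξ ≤ 1 := fun ξ => inv_le_one_of_one_le₀ (hq1 ξ)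
  have hsq : ∀ ξ, s ξ * ‖q ξ‖ = 1 := fun ξ => inv_mul_cancel₀ (hq0 ξ).ne'
  set u : ℝ → ℂ := fun ξ => (P ξ)⁻¹ with hu
  set v : ℝ → ℂ := fun ξ => (Q ξ)⁻¹ with hv
  have hun : ∀ ξ, ‖u ξ‖ ≤ D * s ξ := by
    intro ξ
    have h1 := hPlow ξ
    have h2 : 0 < ‖P ξ‖ := norm_pos_iff.2 (hP0 ξ)
    simp only [hu, hs, norm_inv]
    rw [← div_eq_mul_inv, inv_le_comm₀ h2 (by positivity [hq0 ξ]), inv_div,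
      div_le_iff₀ (by linarith)]
    nlinarith [hq0 ξ]
  have hvn : ∀ ξ, ‖v ξ‖ ≤ D * s ξ := by
    intro ξ
    have h1 := hQlow ξ
    have h2 : 0 < ‖Q ξ‖ := norm_pos_iff.2 (hQ0 ξ)
    simp only [hv, hs, norm_inv]
    rw [← div_eq_mul_inv, inv_le_comm₀ h2 (by positivity [hq0 ξ]), inv_div,
      div_le_iff₀ (by linarith)]
    nlinarith [hq0 ξ]
  have hP₁n : ∀ ξ, ‖P₁ ξ‖ ≤ 14 := by
    intro ξ
    simp only [hP1]
    rw [norm_mul]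
    calc _ ≤ 7 * (1 + ε * M) := by
          gcongr
          refine (norm_add_le _ _).trans ?_
          rw [norm_one, norm_mul, Complex.norm_real, Real.norm_of_nonneg hε.le]
          gcongr
          exact h.norm_deriv_le _ (hpre ξ).le
      _ ≤ 14 := by linarith
  have hQ₁n : ‖c * B‖ ≤ 14 := by
    rw [norm_mul]
    calc _ ≤ 7 * (2 : ℝ) := by gcongr
      _ = 14 := by norm_num
  set u₁ : ℝ → ℂ := fun ξ => -(P₁ ξ * u ξ ^ 2) with hu1
  set u₂ : ℝ → ℂ := fun ξ => 2 * (P₁ ξ ^ 2 * u ξ ^ 3) - P₂ ξ * u ξ ^ 2 with hu2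
  set v₁ : ℝ → ℂ := fun ξ => -(c * B * v ξ ^ 2) with hv1
  set v₂ : ℝ → ℂ := fun ξ => 2 * ((c * B) ^ 2 * v ξ ^ 3) with hv2
  have hdu : ∀ ξ, HasDerivAt u (u₁ ξ) ξ := by
    intro ξ
    convert! (hdP ξ).inv (hP0 ξ) using 1
    simp only [hu1, hu]
    field_simp
  have hdv : ∀ ξ, HasDerivAt v (v₁ ξ) ξ := by
    intro ξ
    convert! (hdQ ξ).inv (hQ0 ξ) using 1
    simp only [hv1, hv]
    field_simp
  have hdu₁ : ∀ ξ, HasDerivAt u₁ (u₂ ξ) ξ := by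
    intro ξ
    convert! ((hdP₁ ξ).mul ((hdu ξ).pow 2)).neg using 1
    simp only [hu2, hu1, Pi.pow_apply]; push_cast; ring
  have hdv₁ : ∀ ξ, HasDerivAt v₁ (v₂ ξ) ξ := by
    intro ξ
    convert! (((hdv ξ).pow 2).const_mul (c * B)).neg using 1
    simp only [hv2, hv1]; push_cast; ring
  have hu₁n : ∀ ξ, ‖u₁ ξ‖ ≤ 14 * D ^ 2 * s ξ ^ 2 := by
    intro ξ
    simp only [hu1]
    rw [norm_neg, norm_mul, norm_pow]
    calc _ ≤ 14 * (D * s ξ) ^ 2 := by gcongr; exacts [hP₁n ξ, hun ξ]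
      _ = _ := by ring
  have hv₁n : ∀ ξ, ‖v₁ ξ‖ ≤ 14 * D ^ 2 * s ξ ^ 2 := by
    intro ξ
    simp only [hv1]
    rw [norm_neg, norm_mul, norm_pow]
    calc _ ≤ 14 * (D * s ξ) ^ 2 := by gcongr; exact hvn ξ
      _ = _ := by ring
  have hu₂n : ∀ ξ, |ξ| ≤ 1 / ε → ‖u₂ ξ‖ ≤ 500 * D ^ 3 * s ξ ^ 3 := by
    intro ξ hξ
    -- On the central range `ε ≤ 8s`, so the factor `ε²` in `P₂` can be traded for the power of `s`
    -- needed to match the term `P₁² u³`.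
    have h1 : ε ^ 2 ≤ s ξ := by
      have h2 := hloc ξ hξ
      have h3 : ε ≤ 8 * s ξ := by
        calc ε = s ξ * (ε * ‖q ξ‖) := by rw [mul_left_comm, hsq, mul_one]
          _ ≤ s ξ * 8 := by gcongr
          _ = _ := by ring
      nlinarith
    simp only [hu2]
    have hsn := (hs0 ξ).le
    calc _ ≤ 2 * (‖P₁ ξ‖ ^ 2 * ‖u ξ‖ ^ 3) + ‖P₂ ξ‖ * ‖u ξ‖ ^ 2 := by
          refine (norm_sub_le _ _).trans ?_
          simp only [norm_mul, norm_pow, Complex.norm_ofNat, le_refl]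
      _ ≤ 2 * (14 ^ 2 * (D * s ξ) ^ 3) + 40 * M * s ξ * (D * s ξ) ^ 2 := by
          gcongr
          · exact hP₁n ξ
          · exact hun ξ
          · exact (hE₂l ξ hξ).trans (by gcongr)
          · exact hun ξ
      _ = (392 * D ^ 3 + 40 * M * D ^ 2) * s ξ ^ 3 := by ring
      _ ≤ 500 * D ^ 3 * s ξ ^ 3 := by
          gcongr
          have h5 : 40 * M * D ^ 2 ≤ 40 * D * D ^ 2 := by gcongr; linarith
          nlinarith [pow_pos (one_pos.trans_le hD1) 3]
  have hv₂n : ∀ ξ, ‖v₂ ξ‖ ≤ 500 * D ^ 3 * s ξ ^ 3 := by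
    intro ξ
    have hsn := (hs0 ξ).le
    simp only [hv2]
    rw [norm_mul, norm_mul, norm_pow, norm_pow, Complex.norm_ofNat]
    calc _ ≤ 2 * (14 ^ 2 * (D * s ξ) ^ 3) := by gcongr; exact hvn ξ
      _ = 392 * (D ^ 3 * s ξ ^ 3) := by ring
      _ ≤ 500 * (D ^ 3 * s ξ ^ 3) := by gcongr; norm_num
      _ = _ := by ring
  set k : ℝ → ℂ := fun ξ => -(E₁ ξ * (u ξ * v ξ) + E ξ * (u₁ ξ * v ξ + u ξ * v₁ ξ)) with hk
  set k' : ℝ → ℂ := fun ξ => -(P₂ ξ * (u ξ * v ξ) + 2 * (E₁ ξ * (u₁ ξ * v ξ + u ξ * v₁ ξ))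
    + E ξ * (u₂ ξ * v ξ + 2 * (u₁ ξ * v₁ ξ) + u ξ * v₂ ξ)) with hk'
  have hMD : 16 * M = D := hD.symm
  refine ⟨k, k', ?_, ?_, ?_, ?_, ?_, ?_⟩
  · intro ξ
    have h1 : (fun ξ : ℝ => (1 + c * ξ + F (ε * (1 + c * ξ) + z))⁻¹ - ((1 + c * ξ) * B + F z)⁻¹)
        = fun ξ => -(E ξ * (u ξ * v ξ)) := by
      funext ξ
      change (P ξ)⁻¹ - (Q ξ)⁻¹ = -((P ξ - Q ξ) * ((P ξ)⁻¹ * (Q ξ)⁻¹))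
      have := hP0 ξ; have := hQ0 ξ
      field_simp; ring
    rw [h1]
    exact ((hdE ξ).mul ((hdu ξ).mul (hdv ξ))).neg
  · intro ξ
    convert! (((hdE₁ ξ).mul ((hdu ξ).mul (hdv ξ))).add ((hdE ξ).mul
      (((hdu₁ ξ).mul (hdv ξ)).add ((hdu ξ).mul (hdv₁ ξ))))).neg using 1
    simp only [hk', Pi.mul_apply, Pi.add_apply]; ring
  · have c1 : ∀ {f f' : ℝ → ℂ}, (∀ ξ, HasDerivAt f (f' ξ) ξ) → Continuous f := fun hf =>
      continuous_iff_continuousAt.2 fun ξ => (hf ξ).continuousAt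
    have := c1 hdE; have := c1 hdE₁; have := c1 hdP₁; have := c1 hdu; have := c1 hdv
    fun_prop
  · intro ξ
    have hsn := (hs0 ξ).le
    have h1 := norm_product_deriv_le hsn hD1 (hEg ξ) (hE₁g ξ) (hun ξ) (hu₁n ξ) (hvn ξ) (hv₁n ξ)
    refine h1.trans ?_
    -- The growth of `E` in `|q|` is paid for by the extra factor `s = 1/|q|`, leaving `s² ≤ (1 +
    -- ξ²)⁻¹`.
    calc 28 * D ^ 3 * (21 * M * ε * s ξ ^ 2 + 3 * M * ε * ‖q ξ‖ * s ξ ^ 3)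
        = 28 * D ^ 3 * (21 * M * ε * s ξ ^ 2 + 3 * M * ε * (s ξ * ‖q ξ‖) * s ξ ^ 2) := by ring
      _ = 42 * D ^ 3 * (16 * M) * ε * s ξ ^ 2 := by rw [hsq]; ring
      _ = 42 * D ^ 4 * ε * s ξ ^ 2 := by rw [hMD]; ring
      _ ≤ 200000 * D ^ 6 * ε * (1 + ξ ^ 2)⁻¹ := by
          gcongr
          · norm_num
          · norm_num
          · exact hs2 ξ
  · intro ξ hξ
    have hsn := (hs0 ξ).le
    have h1 := norm_product_deriv_le hsn hD1 (hEl ξ hξ) (hE₁l ξ hξ) (hun ξ) (hu₁n ξ) (hvn ξ)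
      (hv₁n ξ)
    refine h1.trans ?_
    calc 28 * D ^ 3 * (21 * M ^ 2 * ε ^ 2 * ‖q ξ‖ * s ξ ^ 2
          + 3 * M ^ 2 * ε ^ 2 * ‖q ξ‖ ^ 2 * s ξ ^ 3)
        = 28 * D ^ 3 * (21 * M ^ 2 * ε ^ 2 * (s ξ * ‖q ξ‖) * s ξ
          + 3 * M ^ 2 * ε ^ 2 * (s ξ * ‖q ξ‖) ^ 2 * s ξ) := by ring
      _ = 672 / 256 * D ^ 3 * (16 * M) ^ 2 * ε ^ 2 * s ξ := by rw [hsq]; ring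
      _ = 672 / 256 * D ^ 5 * ε ^ 2 * s ξ := by rw [hMD]; ring
      _ ≤ 200000 * D ^ 6 * ε ^ 2 * 1 := by
          gcongr
          · norm_num
          · norm_num
          · exact hs1 ξ
      _ = _ := by ring
  · intro ξ hξ
    have hsn := (hs0 ξ).le
    have h1 := norm_product_derivs_le hsn hD1 (by positivity) (hEl ξ hξ) (hE₁l ξ hξ) (hE₂l ξ hξ)
      (hun ξ) (hu₁n ξ) (hu₂n ξ hξ) (hvn ξ) (hv₁n ξ) (hv₂n ξ)
    refine h1.trans ?_
    calc 1400 * D ^ 4 * (40 * M * ε ^ 2 * s ξ ^ 2 + 21 * M ^ 2 * ε ^ 2 * ‖q ξ‖ * s ξ ^ 3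
          + 3 * M ^ 2 * ε ^ 2 * ‖q ξ‖ ^ 2 * s ξ ^ 4)
        = 1400 * D ^ 4 * (40 * M * ε ^ 2 * s ξ ^ 2 + 21 * M ^ 2 * ε ^ 2 * (s ξ * ‖q ξ‖) * s ξ ^ 2
          + 3 * M ^ 2 * ε ^ 2 * (s ξ * ‖q ξ‖) ^ 2 * s ξ ^ 2) := by ring
      _ = 1400 * D ^ 4 * (40 * M + 24 * M ^ 2) * ε ^ 2 * s ξ ^ 2 := by rw [hsq]; ring
      _ ≤ 1400 * D ^ 4 * (64 * M ^ 2) * ε ^ 2 * s ξ ^ 2 := by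
          gcongr; nlinarith
      _ = 350 * D ^ 4 * (16 * M) ^ 2 * ε ^ 2 * s ξ ^ 2 := by ring
      _ = 350 * D ^ 6 * ε ^ 2 * s ξ ^ 2 := by rw [hMD]; ring
      _ ≤ 200000 * D ^ 6 * ε ^ 2 * (1 + ξ ^ 2)⁻¹ := by
          gcongr
          · norm_num
          · exact hs2 ξ

end

end HalfPlaneBounds

/-! ### Solutions of the Volterra equation in the time domain. -/

section volterra

variable {G x : ℝ → ℂ} {B C : ℝ} (hG : Continuous G) (hGB : ∀ t, ‖G t‖ ≤ B)
    (hx : Continuous x) (hxC : ∀ t, ‖x t‖ ≤ C)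
include hG hGB hx hxC

/-- A bounded solution of the Volterra equation with initial value zero vanishes. -/
theorem volterra_eq_zero {z : ℂ} {ε : ℝ}
    (hderiv : ∀ t, 0 < t → HasDerivAt x (z * x t - ε * ∫ s in (0 : ℝ)..t, G s * x (t - s)) t)
    (hre : ∀ p : ℂ, 0 < p.re → 0 ≤ (laplace G p).re) (hz : z.re = 0) (hε : 0 ≤ ε)
    (hx0 : x 0 = 0) {t : ℝ} (ht : 0 < t) : x t = 0 := by
  have hC : 0 ≤ C := (norm_nonneg _).trans (hxC 0)
  have hF : ∀ ξ : ℝ, (∫ t in Set.Ioi (0 : ℝ),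
      Complex.exp (-(1 + 2 * Real.pi * Complex.I * ξ) * t) * x t) = 0 := by
    intro ξ
    have hp : (1 + 2 * Real.pi * Complex.I * ξ : ℂ).re = 1 := by simp
    have h1 := laplace_volterra hG hGB hx hxC z ε hderiv (hp ▸ one_pos)
    rw [hx0] at h1
    -- On `Re p = 1` the factor `p - z + εG̃(p)` has real part at least `1`, so the transform itself
    -- must vanish.
    refine (mul_eq_zero.1 h1).resolve_right fun h0 => ?_
    have h2 := congrArg Complex.re h0
    have h3 := mul_nonneg hε (hre _ (hp ▸ one_pos))
    rw [Complex.add_re, Complex.sub_re, hp, hz, Complex.re_ofReal_mul, Complex.zero_re] at h2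
    linarith
  have h2 := laplace_inversion_of_hasDerivAt hx (C := C)
    (fun t ht => (hxC t).trans (le_mul_of_one_le_right hC (Real.one_le_exp (by linarith))))
    hF (fun ξ => hasDerivAt_const ξ 0) (integrable_zero _ _ _) ht
  simpa [Real.pi_ne_zero, ht.ne', Complex.exp_ne_zero] using h2

-- With `p = εq + z` the transforms of both functions become the two resolvents of
-- `exists_resolvent_diff_deriv`, times `x(0)`. Keeping the factor `‖x 0‖` in the bound makes
-- amplitudes with initial value zero vanish exactly, which is used for the off-diagonal matrix
-- elements.
set_option maxHeartbeats 400000 in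
theorem volterra_asymptotics {F' F'' : ℂ → ℂ} {M : ℝ} {z : ℂ}
    (h : HalfPlaneBounds (laplace G) F' F'' M z) {ε : ℝ} (hε : 0 < ε) (hεM : 48 * M ^ 2 * ε ≤ 1)
    (hderiv : ∀ t, 0 < t → HasDerivAt x (z * x t - ε * ∫ s in (0 : ℝ)..t, G s * x (t - s)) t)
    {t : ℝ} (ht : 0 < t) :
    ‖Complex.exp (-z * (t / ε : ℝ)) * x (t / ε)
        - x 0 * ((1 - ε * F' z) * Complex.exp (-(laplace G z * (1 - ε * F' z)) * t))‖
      ≤ ‖x 0‖ * (200000 * (16 * M) ^ 6 * (2 + 1 / t) * Real.exp t / (2 * Real.pi * t)) * ε ^ 2 := by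
  obtain ⟨k, k', hk, hk', hk'c, hglob, hloc, hloc'⟩ := h.exists_resolvent_diff_deriv hε hεM
  obtain ⟨hMε, hε1⟩ := h.eps_mul_le hε hεM
  obtain ⟨hβ1, hβ2⟩ := h.norm_renorm hε hεM
  have hM := h.one_le
  set a := laplace G z with ha
  set β : ℂ := 1 - ε * F' z with hβ
  have hC0 : 0 ≤ C := (norm_nonneg _).trans (hxC 0)
  have hβ0 : β ≠ 0 := by
    intro h0; rw [h0, norm_zero] at hβ2; norm_num at hβ2
  have hβ3 : ‖β‖ ≤ 2 := by
    have := norm_sub_le (1 : ℂ) (ε * F' z)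
    rw [norm_one] at this
    linarith
  have hare : 0 ≤ a.re := h.re_nonneg z h.re_eq.ge
  -- `β` is not real, so `Re(aβ)` may be slightly negative; the bound `1/2` keeps the exponential
  -- within the growth `e^{t/2}` admitted by the inversion.
  have haβ : -(a * β).re ≤ 1 / 2 := by
    have h1 : (a * β).re = a.re - (a * (ε * F' z)).re := by rw [hβ, mul_sub, mul_one, Complex.sub_re]
    have h2 : (a * (ε * F' z)).re ≤ M * (M * ε) := by
      refine (Complex.re_le_norm _).trans ?_
      rw [norm_mul]
      gcongr
      exact h.norm_le
    rw [h1]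
    nlinarith
  have hez : ∀ s : ℝ, ‖Complex.exp (-z * s)‖ = 1 := by
    intro s; rw [norm_cexp_neg_mul, h.re_eq]; simp
  set f : ℝ → ℂ := fun t => Complex.exp (-z * (t / ε : ℝ)) * x (t / ε)
    - x 0 * (β * Complex.exp (-(a * β) * t)) with hf
  have hfc : Continuous f := by fun_prop
  have hfb : ∀ t, 0 < t → ‖f t‖ ≤ (C + ‖x 0‖ * 2) * Real.exp (t / 2) := by
    intro t ht
    have h1 : ‖Complex.exp (-(a * β) * t)‖ ≤ Real.exp (t / 2) := by
      rw [norm_cexp_neg_mul]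
      refine Real.exp_le_exp.2 ?_
      nlinarith
    calc ‖f t‖ ≤ 1 * C + ‖x 0‖ * (2 * Real.exp (t / 2)) := by
          refine (norm_sub_le _ _).trans (add_le_add ?_ ?_)
          · rw [norm_mul, hez]; gcongr; exact hxC _
          · rw [norm_mul, norm_mul]; gcongr
      _ ≤ C * Real.exp (t / 2) + ‖x 0‖ * (2 * Real.exp (t / 2)) := by
          rw [one_mul]
          gcongr
          exact le_mul_of_one_le_right hC0 (Real.one_le_exp (by linarith))
      _ = _ := by ring
  have hF : ∀ ξ : ℝ, (∫ t in Set.Ioi (0 : ℝ),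
      Complex.exp (-(1 + 2 * Real.pi * Complex.I * ξ) * t) * f t)
      = x 0 * ((1 + 2 * Real.pi * Complex.I * ξ
          + laplace G (ε * (1 + 2 * Real.pi * Complex.I * ξ) + z))⁻¹
        - ((1 + 2 * Real.pi * Complex.I * ξ) * β⁻¹ + a)⁻¹) := by
    intro ξ
    set q : ℂ := 1 + 2 * Real.pi * Complex.I * ξ with hq
    have hqre : q.re = 1 := by simp [hq]
    have hpre : 0 < (ε * q + z).re := by simp [hqre, h.re_eq, hε]
    have h1 := laplace_volterra hG hGB hx hxC z ε hderiv hpre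
    have hI1 : (∫ t in Set.Ioi (0 : ℝ), Complex.exp (-q * t) *
        (Complex.exp (-z * (t / ε : ℝ)) * x (t / ε)))
        = ε * ∫ s in Set.Ioi (0 : ℝ), Complex.exp (-(ε * q + z) * s) * x s := by
      have h2 := integral_comp_mul_left_Ioi
        (fun s : ℝ => Complex.exp (-(ε * q + z) * s) * x s) 0 (inv_pos.2 hε)
      rw [mul_zero, inv_inv, Complex.real_smul] at h2
      rw [← h2]
      refine setIntegral_congr_fun measurableSet_Ioi fun t _ => ?_
      rw [← mul_assoc, ← Complex.exp_add, div_eq_inv_mul]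
      congr 2
      have : (ε : ℂ) ≠ 0 := by exact_mod_cast hε.ne'
      push_cast
      field_simp
      ring
    have hres : (-(q + a * β)).re < 0 := by
      rw [Complex.neg_re, Complex.add_re, hqre]; linarith
    have hI2 : (∫ t in Set.Ioi (0 : ℝ), Complex.exp (-q * t) *
        (x 0 * (β * Complex.exp (-(a * β) * t)))) = x 0 * (q * β⁻¹ + a)⁻¹ := by
      have h2 := integral_exp_mul_complex_Ioi hres 0
      have h3 : (q * β⁻¹ + a)⁻¹ = β * (-Complex.exp (-(q + a * β) * (0 : ℝ)) / -(q + a * β)) := by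
        have h4 : q + a * β ≠ 0 := by
          intro h0; rw [h0] at hres; simp at hres
        rw [Complex.ofReal_zero, mul_zero, Complex.exp_zero, neg_div_neg_eq, mul_one_div,
          ← inv_div]
        congr 1
        field_simp
      rw [h3, ← h2, ← mul_assoc, ← integral_const_mul]
      refine setIntegral_congr_fun measurableSet_Ioi fun t _ => ?_
      rw [show -(q + a * β) * (t : ℂ) = -q * t + -(a * β) * t by ring, Complex.exp_add]
      ring
    have hi1 : IntegrableOn (fun t : ℝ => Complex.exp (-q * t) *
        (Complex.exp (-z * (t / ε : ℝ)) * x (t / ε))) (Set.Ioi 0) :=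
      integrableOn_cexp_mul (B := C) (Continuous.aestronglyMeasurable (by fun_prop))
        (fun t _ => by rw [norm_mul, hez, one_mul]; exact hxC _) (hqre ▸ one_pos)
    have hi2 : IntegrableOn (fun t : ℝ => Complex.exp (-q * t) *
        (x 0 * (β * Complex.exp (-(a * β) * t)))) (Set.Ioi 0) := by
      refine IntegrableOn.congr_fun
        ((integrableOn_exp_mul_complex_Ioi hres 0).const_mul (x 0 * β)) (fun t _ => ?_)
        measurableSet_Ioi
      rw [show -(q + a * β) * (t : ℂ) = -q * t + -(a * β) * t by ring, Complex.exp_add]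
      ring
    simp only [hf, mul_sub]
    rw [integral_sub hi1 hi2, hI1, hI2]
    congr 1
    have hεc : (ε : ℂ) ≠ 0 := by exact_mod_cast hε.ne'
    have h5 : (q + laplace G (ε * q + z)) ≠ 0 := by
      intro h0
      have h6 := congrArg Complex.re h0
      rw [Complex.add_re, hqre, Complex.zero_re] at h6
      linarith [h.re_nonneg _ hpre.le]
    rw [← h1]
    field_simp
    ring
  have hFd : ∀ ξ : ℝ, HasDerivAt (fun ξ : ℝ => x 0 * ((1 + 2 * Real.pi * Complex.I * ξ
          + laplace G (ε * (1 + 2 * Real.pi * Complex.I * ξ) + z))⁻¹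
        - ((1 + 2 * Real.pi * Complex.I * ξ) * β⁻¹ + a)⁻¹)) (x 0 * k ξ) ξ :=
    fun ξ => (hk ξ).const_mul _
  obtain ⟨hki, hosc⟩ := norm_oscillatory_integral_le (K := 200000 * (16 * M) ^ 6) (by positivity)
    hε ht hk' hk'c hglob hloc hloc'
  have hinv := laplace_inversion_of_hasDerivAt hfc hfb hF hFd (hki.const_mul _) ht
  simp_rw [mul_left_comm _ (x 0)] at hinv
  rw [integral_const_mul] at hinv
  have hn := congrArg norm hinv
  rw [norm_mul, norm_mul, norm_mul, norm_mul, Complex.norm_exp] at hn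
  have hpi := Real.pi_pos
  simp only [norm_neg, norm_mul, Complex.norm_ofNat, Complex.norm_real, Complex.norm_I,
    Real.norm_of_nonneg hpi.le, Real.norm_of_nonneg ht.le, Complex.neg_re, Complex.ofReal_re,
    mul_one] at hn
  have h6 : 2 * Real.pi * t * (Real.exp (-t) * ‖f t‖)
      ≤ ‖x 0‖ * (200000 * (16 * M) ^ 6 * (2 + 1 / t) * ε ^ 2) := by
    rw [hn]; gcongr
  have h7 : ‖f t‖ = (2 * Real.pi * t * (Real.exp (-t) * ‖f t‖)) * (Real.exp t / (2 * Real.pi * t)) := by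
    rw [Real.exp_neg]
    have := Real.exp_pos t
    field_simp
  change ‖f t‖ ≤ _
  rw [h7]
  calc _ ≤ ‖x 0‖ * (200000 * (16 * M) ^ 6 * (2 + 1 / t) * ε ^ 2) * (Real.exp t / (2 * Real.pi * t)) := by
        gcongr
    _ = _ := by ring

end volterra

/-! ### Functions on the closed half-plane -/

theorem convex_rightHalfPlane : Convex ℝ rightHalfPlane := convex_halfSpace_re_ge 0

/-- A convex set with an interior point has unique derivatives, which makes `derivRHP` meaningful on
the imaginary axis. -/
theorem uniqueDiffOn_rightHalfPlane : UniqueDiffOn ℂ rightHalfPlane := by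
  refine uniqueDiffOn_convex_of_isRCLikeNormedField convex_rightHalfPlane ?_
  refine ⟨1, mem_interior.2 ⟨{p | 0 < p.re}, fun p hp => ?_, ?_, ?_⟩⟩
  · exact le_of_lt (show 0 < p.re from hp)
  · exact isOpen_lt continuous_const Complex.continuous_re
  · simp

theorem rightHalfPlane_mem_nhds {p : ℂ} (hp : 0 < p.re) : rightHalfPlane ∈ 𝓝 p :=
  mem_of_superset ((isOpen_lt continuous_const Complex.continuous_re).mem_nhds hp)
    fun q (hq : 0 < q.re) => hq.le

theorem imagAxis_mem (κ : ℝ) : -Complex.I * κ ∈ rightHalfPlane := by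
  simp [rightHalfPlane]

theorem sub_eq_diffQuot_mul (F : ℂ → ℂ) (x y : ℂ) : F x - F y = diffQuot F x y * (x - y) := by
  unfold diffQuot
  split_ifs with h
  · simp [h]
  · rw [div_mul_cancel₀ _ (sub_ne_zero.2 h)]

section

variable {F : ℂ → ℂ} (hF : ContDiffOn ℂ 2 F rightHalfPlane)
include hF

theorem hasDerivWithinAt_derivRHP {p : ℂ} (hp : p ∈ rightHalfPlane) :
    HasDerivWithinAt F (derivRHP F p) rightHalfPlane p :=
  ((hF.differentiableOn (by norm_num)) p hp).hasDerivWithinAt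

theorem contDiffOn_derivRHP : ContDiffOn ℂ 1 (derivRHP F) rightHalfPlane := by
  have h : ContDiffOn ℂ (1 + 1) F rightHalfPlane := by
    convert! hF using 1
  exact ((contDiffOn_succ_iff_derivWithin uniqueDiffOn_rightHalfPlane).1 h).2.2

/-- The sign passes to the imaginary axis by continuity, approaching `p` along `p + s` with `s > 0`.
-/
theorem re_nonneg_of_re_pos (hre : ∀ p : ℂ, 0 < p.re → 0 ≤ (F p).re) {p : ℂ} (hp : 0 ≤ p.re) :
    0 ≤ (F p).re := by
  have h1 : Tendsto (fun s : ℝ => p + s) (𝓝[>] 0) (𝓝[rightHalfPlane] p) := by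
    refine tendsto_nhdsWithin_iff.2 ⟨?_, ?_⟩
    · refine Tendsto.mono_left (Continuous.tendsto' (by fun_prop) _ _ (by simp)) nhdsWithin_le_nhds
    · filter_upwards [self_mem_nhdsWithin] with s hs
      simp only [rightHalfPlane, Set.mem_ofPred_eq, Complex.add_re, Complex.ofReal_re]
      linarith [Set.mem_Ioi.1 hs]
  have h2 := (Complex.continuous_re.tendsto _).comp (((hF.continuousOn) p hp).tendsto.comp h1)
  refine ge_of_tendsto h2 ?_
  filter_upwards [self_mem_nhdsWithin] with s hs
  refine hre _ ?_
  simp only [Complex.add_re, Complex.ofReal_re]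
  linarith [Set.mem_Ioi.1 hs]

/-- The second derivative is only assumed continuous, so a bound comes from compactness of
half-discs. -/
theorem exists_bound_deriv2 (R : ℝ) : ∃ M : ℝ, 0 ≤ M ∧
    ∀ p ∈ Metric.closedBall (0 : ℂ) R ∩ rightHalfPlane,
      ‖derivWithin (derivRHP F) rightHalfPlane p‖ ≤ M := by
  have hcl : IsClosed rightHalfPlane := isClosed_le continuous_const Complex.continuous_re
  have hK : IsCompact (Metric.closedBall (0 : ℂ) R ∩ rightHalfPlane) :=
    (isCompact_closedBall 0 R).inter_right hcl
  have hc := ((contDiffOn_derivRHP hF).continuousOn_derivWithin uniqueDiffOn_rightHalfPlane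
    (by norm_num)).mono (Set.inter_subset_right (s := Metric.closedBall (0 : ℂ) R))
  obtain ⟨M, hM⟩ := hK.exists_bound_of_continuousOn hc
  exact ⟨max M 0, le_max_right _ _, fun p hp => (hM p hp).trans (le_max_left _ _)⟩

theorem derivRHP_lipschitz {R M : ℝ}
    (hM : ∀ p ∈ Metric.closedBall (0 : ℂ) R ∩ rightHalfPlane,
      ‖derivWithin (derivRHP F) rightHalfPlane p‖ ≤ M) {p q : ℂ}
    (hp : p ∈ Metric.closedBall (0 : ℂ) R ∩ rightHalfPlane)
    (hq : q ∈ Metric.closedBall (0 : ℂ) R ∩ rightHalfPlane) :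
    ‖derivRHP F q - derivRHP F p‖ ≤ M * ‖q - p‖ := by
  refine Convex.norm_image_sub_le_of_norm_hasDerivWithin_le (fun x hx => ?_) hM
    ((convex_closedBall 0 R).inter convex_rightHalfPlane) hp hq
  exact ((((contDiffOn_derivRHP hF).differentiableOn (by norm_num)) x hx.2).hasDerivWithinAt).mono
    Set.inter_subset_right

theorem derivRHP_taylor {R M : ℝ} (h0 : 0 ≤ M)
    (hM : ∀ p ∈ Metric.closedBall (0 : ℂ) R ∩ rightHalfPlane,
      ‖derivWithin (derivRHP F) rightHalfPlane p‖ ≤ M) {p q : ℂ}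
    (hp : p ∈ Metric.closedBall (0 : ℂ) R ∩ rightHalfPlane)
    (hq : q ∈ Metric.closedBall (0 : ℂ) R ∩ rightHalfPlane) :
    ‖F q - F p - derivRHP F p * (q - p)‖ ≤ M * ‖q - p‖ ^ 2 := by
  -- The mean value inequality is applied to `F(x) - F'(p)(x - p)`. Cutting down to the ball about
  -- `p` keeps the set convex and bounds the derivative by `M‖q - p‖`.
  set K := (Metric.closedBall (0 : ℂ) R ∩ rightHalfPlane) ∩ Metric.closedBall p ‖q - p‖ with hK
  have hconv : Convex ℝ K := ((convex_closedBall 0 R).inter convex_rightHalfPlane).inter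
    (convex_closedBall _ _)
  have hd : ∀ x ∈ K, HasDerivWithinAt (fun x => F x - derivRHP F p * (x - p))
      (derivRHP F x - derivRHP F p) K x := by
    intro x hx
    have h1 := (hasDerivWithinAt_derivRHP hF hx.1.2).mono
      (Set.inter_subset_left.trans Set.inter_subset_right : K ⊆ rightHalfPlane)
    have h2 : HasDerivWithinAt (fun x => derivRHP F p * (x - p)) (derivRHP F p) K x := by
      simpa using ((hasDerivWithinAt_id x K).sub_const p).const_mul (derivRHP F p)
    exact h1.sub h2
  have hb : ∀ x ∈ K, ‖derivRHP F x - derivRHP F p‖ ≤ M * ‖q - p‖ := by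
    intro x hx
    refine (derivRHP_lipschitz hF hM hp hx.1).trans ?_
    gcongr
    exact mem_closedBall_iff_norm.1 hx.2
  have h3 := Convex.norm_image_sub_le_of_norm_hasDerivWithin_le hd hb hconv
    (x := p) (y := q) ⟨hp, Metric.mem_closedBall_self (norm_nonneg _)⟩
    ⟨hq, mem_closedBall_iff_norm.2 le_rfl⟩
  simp only [sub_self, mul_zero, sub_zero] at h3
  rw [sub_right_comm] at h3
  linarith

theorem lipschitz_of_norm_derivRHP_le {C : ℝ}
    (hC : ∀ p ∈ rightHalfPlane, ‖derivRHP F p‖ ≤ C) {p q : ℂ} (hp : p ∈ rightHalfPlane)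
    (hq : q ∈ rightHalfPlane) : ‖F q - F p‖ ≤ C * ‖q - p‖ :=
  Convex.norm_image_sub_le_of_norm_hasDerivWithin_le
    (fun _ hx => hasDerivWithinAt_derivRHP hF hx) hC convex_rightHalfPlane hp hq

/-- One `M` serves the whole segment `|κ| ≤ R`. This uniformity is needed because the eigenvalues of
`H_{S,λ}` move with `λ`. -/
theorem exists_halfPlaneBounds (hre : ∀ p : ℂ, 0 < p.re → 0 ≤ (F p).re)
    (hbdd : ∃ C : ℝ, ∀ p ∈ rightHalfPlane, ‖derivRHP F p‖ ≤ C) (R : ℝ) :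
    ∃ M : ℝ, ∀ κ : ℝ, |κ| ≤ R → HalfPlaneBounds F (derivRHP F)
      (derivWithin (derivRHP F) rightHalfPlane) M (-Complex.I * κ) := by
  obtain ⟨C, hC⟩ := hbdd
  obtain ⟨M₂, hM₂0, hM₂⟩ := exists_bound_deriv2 hF (R + 8)
  have hC0 : 0 ≤ C := (norm_nonneg _).trans (hC 0 (by simp [rightHalfPlane]))
  set M := 1 + C + M₂ + (‖F 0‖ + C * |R|) with hMdef
  have hCM : C ≤ M := by
    have := mul_nonneg hC0 (abs_nonneg R); have := norm_nonneg (F 0); linarith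
  have hM₂M : M₂ ≤ M := by
    have := mul_nonneg hC0 (abs_nonneg R); have := norm_nonneg (F 0); linarith
  have hLip := fun p hp q hq => lipschitz_of_norm_derivRHP_le hF hC (p := p) (q := q) hp hq
  refine ⟨M, fun κ hκ => ?_⟩
  have hz := imagAxis_mem κ
  have hzn : ‖-Complex.I * (κ : ℂ)‖ ≤ R := by simpa using hκ
  have hzK : -Complex.I * (κ : ℂ) ∈ Metric.closedBall (0 : ℂ) (R + 8) ∩ rightHalfPlane :=
    ⟨by rw [mem_closedBall_zero_iff]; linarith, hz⟩
  have hK : ∀ p : ℂ, 0 ≤ p.re → ‖p - -Complex.I * κ‖ ≤ 8 →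
      p ∈ Metric.closedBall (0 : ℂ) (R + 8) ∩ rightHalfPlane := by
    intro p hp h8
    refine ⟨?_, hp⟩
    rw [mem_closedBall_zero_iff]
    have := norm_le_norm_add_norm_sub' p (-Complex.I * κ)
    linarith
  refine ⟨?_, by simp, ?_, ?_, ?_, ?_, ?_, ?_, ?_, ?_, ?_, ?_⟩
  · have := mul_nonneg hC0 (abs_nonneg R); have := norm_nonneg (F 0); linarith
  · exact fun p hp => (hasDerivWithinAt_derivRHP hF hp.le).hasDerivAt (rightHalfPlane_mem_nhds hp)
  · exact fun p hp => ((((contDiffOn_derivRHP hF).differentiableOn (by norm_num)) p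
      hp.le).hasDerivWithinAt).hasDerivAt (rightHalfPlane_mem_nhds hp)
  · exact ((contDiffOn_derivRHP hF).continuousOn_derivWithin uniqueDiffOn_rightHalfPlane
      (by norm_num)).mono fun p (hp : 0 < p.re) => hp.le
  · exact fun p hp => re_nonneg_of_re_pos hF hre hp
  · have h1 := hLip 0 (by simp [rightHalfPlane]) _ hz
    rw [sub_zero] at h1
    have h2 : ‖-Complex.I * (κ : ℂ)‖ ≤ |R| := hzn.trans (le_abs_self R)
    have h3 := norm_le_norm_add_norm_sub' (F (-Complex.I * κ)) (F 0)
    have h4 : C * ‖-Complex.I * (κ : ℂ)‖ ≤ C * |R| := by gcongr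
    linarith
  · exact fun p hp => (hC p hp).trans hCM
  · exact fun p hp => (hLip _ hz p hp).trans (by gcongr)
  · exact fun p hp h8 => (derivRHP_taylor hF hM₂0 hM₂ hzK (hK p hp h8)).trans (by gcongr)
  · exact fun p hp h8 => (derivRHP_lipschitz hF hM₂ hzK (hK p hp h8)).trans (by gcongr)
  · exact fun p hp h8 => (hM₂ p (hK p hp h8)).trans hM₂M

/-! ### Difference quotients on the imaginary axis -/

theorem continuous_derivRHP_axis : Continuous fun y : ℝ => derivRHP F (-Complex.I * y) :=
  (contDiffOn_derivRHP hF).continuousOn.comp_continuous (by fun_prop) imagAxis_mem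

/-- As a mean of the derivative along the axis, the difference quotient needs no distinction between
equal and distinct points, and it inherits Lipschitz continuity from `derivRHP F`. -/
theorem diffQuot_axis_eq_integral (x y : ℝ) :
    diffQuot F (-Complex.I * x) (-Complex.I * y)
      = ∫ s in (0 : ℝ)..1, derivRHP F (-Complex.I * ((x + s * (y - x) : ℝ) : ℂ)) := by
  by_cases hxy : x = y
  · subst hxy
    simp [diffQuot]
  have hd : ∀ t : ℝ, HasDerivAt (fun y : ℝ => F (-Complex.I * y))
      (-Complex.I * derivRHP F (-Complex.I * t)) t := by
    intro t
    have h1 : HasDerivAt (fun y : ℝ => -Complex.I * (y : ℂ)) (-Complex.I) t := by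
      simpa using (Complex.ofRealCLM.hasDerivAt (x := t)).const_mul (-Complex.I)
    have h2 := HasDerivWithinAt.scomp_hasDerivAt t
      (hasDerivWithinAt_derivRHP hF (imagAxis_mem t)) h1 imagAxis_mem
    simpa [Function.comp_def, smul_eq_mul] using h2
  have h3 := intervalIntegral.integral_unitInterval_deriv_eq_sub (𝕜 := ℝ) (z₀ := x) (z₁ := y - x)
    (f := fun y : ℝ => F (-Complex.I * y))
    (f' := fun t : ℝ => -Complex.I * derivRHP F (-Complex.I * t))
    (Continuous.continuousOn (by
      have := continuous_derivRHP_axis hF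
      exact continuous_const.mul (this.comp (by fun_prop)))) (fun t _ => hd _)
  rw [intervalIntegral.integral_const_mul, Complex.real_smul, add_sub_cancel] at h3
  have h4 : (-Complex.I * (x : ℂ)) ≠ -Complex.I * y := by
    simpa using hxy
  unfold diffQuot
  rw [if_neg h4, div_eq_iff (sub_ne_zero.2 h4)]
  simp only [smul_eq_mul] at h3
  push_cast at h3 ⊢
  linear_combination h3

theorem exists_diffQuot_bounds (R : ℝ) : ∃ M : ℝ, 0 ≤ M ∧
    (∀ x y : ℝ, |x| ≤ R → |y| ≤ R →
      ‖derivRHP F (-Complex.I * x) - derivRHP F (-Complex.I * y)‖ ≤ M * |x - y|) ∧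
    (∀ x y y' : ℝ, |x| ≤ R → |y| ≤ R → |y'| ≤ R →
      ‖diffQuot F (-Complex.I * x) (-Complex.I * y) - diffQuot F (-Complex.I * x) (-Complex.I * y')‖
        ≤ M * |y - y'|) := by
  obtain ⟨M, hM0, hM⟩ := exists_bound_deriv2 hF R
  have hmem : ∀ x : ℝ, |x| ≤ R → -Complex.I * x ∈ Metric.closedBall (0 : ℂ) R ∩ rightHalfPlane :=
    fun x hx => ⟨by simpa using hx, imagAxis_mem x⟩
  have hL : ∀ x y : ℝ, |x| ≤ R → |y| ≤ R →
      ‖derivRHP F (-Complex.I * x) - derivRHP F (-Complex.I * y)‖ ≤ M * |x - y| := by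
    intro x y hx hy
    have h1 := derivRHP_lipschitz hF hM (hmem y hy) (hmem x hx)
    rwa [← mul_sub, norm_mul, norm_neg, Complex.norm_I, one_mul, ← Complex.ofReal_sub,
      Complex.norm_real, Real.norm_eq_abs] at h1
  refine ⟨M, hM0, hL, fun x y y' hx hy hy' => ?_⟩
  have hc := continuous_derivRHP_axis hF
  have hi : ∀ y : ℝ, IntervalIntegrable
      (fun s : ℝ => derivRHP F (-Complex.I * ((x + s * (y - x) : ℝ) : ℂ))) volume 0 1 :=
    fun y => Continuous.intervalIntegrable
      (hc.comp (show Continuous fun s : ℝ => x + s * (y - x) by fun_prop)) _ _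
  rw [diffQuot_axis_eq_integral hF, diffQuot_axis_eq_integral hF,
    ← intervalIntegral.integral_sub (hi y) (hi y')]
  have hseg : ∀ y s : ℝ, |y| ≤ R → 0 ≤ s → s ≤ 1 → |x + s * (y - x)| ≤ R := by
    intro y s hy h0 h1
    rw [abs_le] at *
    constructor <;> nlinarith
  have h2 := intervalIntegral.norm_integral_le_of_norm_le_const (a := (0 : ℝ)) (b := 1)
    (C := M * |y - y'|)
    (f := fun s : ℝ => derivRHP F (-Complex.I * ((x + s * (y - x) : ℝ) : ℂ))
      - derivRHP F (-Complex.I * ((x + s * (y' - x) : ℝ) : ℂ))) (fun s hs => ?_)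
  · simpa using h2
  · rw [Set.uIoc_of_le zero_le_one] at hs
    refine (hL _ _ (hseg y s hy hs.1.le hs.2) (hseg y' s hy' hs.1.le hs.2)).trans ?_
    rw [show x + s * (y - x) - (x + s * (y' - x)) = s * (y - y') by ring, abs_mul,
      abs_of_pos hs.1]
    have := mul_le_of_le_one_left (abs_nonneg (y - y')) hs.2
    gcongr

end

/-! ### Vectors of the total space -/

section vectors

variable {N : ℕ}

@[simp] theorem TotalSpace.component_add (ψ χ : TotalSpace N) (s : Level N) :
    (ψ + χ).component s = ψ.component s + χ.component s := rfl

@[simp] theorem TotalSpace.component_smul (c : ℂ) (ψ : TotalSpace N) (s : Level N) :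
    (c • ψ).component s = c • ψ.component s := rfl

/-- The component of a vector, as a linear map. -/
def TotalSpace.componentₗ (s : Level N) : TotalSpace N →ₗ[ℂ] Fock N where
  toFun ψ := ψ.component s
  map_add' _ _ := rfl
  map_smul' _ _ := rfl

@[simp] theorem TotalSpace.component_sum {ι : Type*} (t : Finset ι) (ψ : ι → TotalSpace N)
    (s : Level N) : (∑ i ∈ t, ψ i).component s = ∑ i ∈ t, (ψ i).component s :=
  map_sum (TotalSpace.componentₗ s) ψ t

theorem TotalSpace.ext {ψ χ : TotalSpace N} (h : ∀ s, ψ.component s = χ.component s) : ψ = χ :=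
  PiLp.ext (p := 2) (α := fun _ : Level N => Fock N) h

theorem component_ket (s s' : Level N) (φ : Fock N) :
    (ket s φ).component s' = if s' = s then φ else 0 := by
  change (PiLp.single (β := fun _ : Level N => Fock N) 2 s φ).ofLp s' = _
  rw [PiLp.single_apply]

@[simp] theorem component_ket_same (s : Level N) (φ : Fock N) : (ket s φ).component s = φ := by
  rw [component_ket, if_pos rfl]

theorem component_ket_ne {s s' : Level N} (h : s' ≠ s) (φ : Fock N) :
    (ket s φ).component s' = 0 := by
  rw [component_ket, if_neg h]

theorem inner_eq_sum_component (ψ χ : TotalSpace N) :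
    inner ℂ ψ χ = ∑ s, inner ℂ (ψ.component s) (χ.component s) :=
  PiLp.inner_apply (𝕜 := ℂ) (f := fun _ : Level N => Fock N) ψ χ

theorem inner_ket_left (s : Level N) (φ : Fock N) (ψ : TotalSpace N) :
    inner ℂ (ket s φ) ψ = inner ℂ φ (ψ.component s) := by
  rw [inner_eq_sum_component, Finset.sum_eq_single s]
  · simp
  · intro b _ hb; rw [component_ket_ne hb, inner_zero_left]
  · simp

theorem inner_ket_right (s : Level N) (φ : Fock N) (ψ : TotalSpace N) :
    inner ℂ ψ (ket s φ) = inner ℂ (ψ.component s) φ := by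
  rw [← inner_conj_symm, inner_ket_left, inner_conj_symm]

theorem inner_ket_ket (s s' : Level N) (φ φ' : Fock N) :
    inner ℂ (ket s φ) (ket s' φ') = if s = s' then inner ℂ φ φ' else 0 := by
  rw [inner_ket_left, component_ket]
  split_ifs <;> simp

/-- `φ ↦ |s⟩ ⊗ φ`. -/
noncomputable def ketₗᵢ (s : Level N) : Fock N →ₗᵢ[ℂ] TotalSpace N where
  toFun := ket s
  map_add' φ φ' := by
    refine TotalSpace.ext fun s' => ?_
    rw [TotalSpace.component_add]
    simp only [component_ket]; split_ifs <;> simp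
  map_smul' c φ := by
    refine TotalSpace.ext fun s' => ?_
    rw [RingHom.id_apply, TotalSpace.component_smul]
    simp only [component_ket]; split_ifs <;> simp
  norm_map' φ := by
    have h : ‖ket s φ‖ ^ 2 = ‖φ‖ ^ 2 := by
      have h1 := inner_ket_ket s s φ φ
      rw [if_pos rfl, inner_self_eq_norm_sq_to_K, inner_self_eq_norm_sq_to_K] at h1
      exact_mod_cast h1
    exact (pow_left_inj₀ (norm_nonneg _) (norm_nonneg _) two_ne_zero).1 h

/-! ### The Fock space -/

@[simp] theorem Fock.component_add (φ χ : Fock N) (n : ℕ) :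
    (φ + χ).component n = φ.component n + χ.component n := rfl

@[simp] theorem Fock.component_smul (c : ℂ) (φ : Fock N) (n : ℕ) :
    (c • φ).component n = c • φ.component n := rfl

theorem waveFunctions_eq_zero {φ : Fock N} {n : ℕ} (h : φ.component n = 0) :
    φ.waveFunctions n =ᵐ[confMeasure N n] 0 := by
  unfold Fock.waveFunctions
  rw [h]
  exact Lp.coeFn_zero _ _ _

theorem waveFunctions_add (φ χ : Fock N) (n : ℕ) :
    (φ + χ).waveFunctions n =ᵐ[confMeasure N n]
      fun x => φ.waveFunctions n x + χ.waveFunctions n x := by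
  unfold Fock.waveFunctions
  rw [Fock.component_add, Submodule.coe_add]
  exact Lp.coeFn_add _ _

theorem waveFunctions_smul (c : ℂ) (φ : Fock N) (n : ℕ) :
    (c • φ).waveFunctions n =ᵐ[confMeasure N n] fun x => c * φ.waveFunctions n x := by
  unfold Fock.waveFunctions
  rw [Fock.component_smul, Submodule.coe_smul]
  exact Lp.coeFn_smul _ _

/-- The vector with a single nonzero component. -/
noncomputable def fockSingle (n : ℕ) : bosonSpace N n →L[ℂ] Fock N :=
  lp.singleContinuousLinearMap ℂ (fun n : ℕ => bosonSpace N n) 2 n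

theorem component_fockSingle_same (n : ℕ) (f : bosonSpace N n) :
    (fockSingle n f).component n = f :=
  lp.single_apply_self (E := fun n : ℕ => bosonSpace N n) 2 n f

theorem component_fockSingle_ne {n m : ℕ} (h : m ≠ n) (f : bosonSpace N n) :
    (fockSingle n f).component m = 0 :=
  lp.single_apply_ne (E := fun n : ℕ => bosonSpace N n) 2 n f h

theorem vacuum_component_ne {n : ℕ} (h : n ≠ 0) : (vacuum N).component n = 0 :=
  lp.single_apply_ne 2 0 _ h

theorem confMeasure_zero : confMeasure N 0 = Measure.dirac isEmptyElim := by
  unfold confMeasure; exact Measure.pi_of_empty _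

theorem vacuum_waveFunctions_zero : (vacuum N).waveFunctions 0 =ᵐ[confMeasure N 0] fun _ => 1 := by
  have h : ((vacuum N).component 0 : Lp ℂ 2 (confMeasure N 0))
      = Lp.const 2 (confMeasure N 0) (1 : ℂ) := by
    have := lp.single_apply_self (E := fun n : ℕ => bosonSpace N n) 2 0
      ((vacuum N).component 0)
    unfold vacuum Fock.component
    exact congrArg Subtype.val (lp.single_apply_self (E := fun n : ℕ => bosonSpace N n) 2 0 _)
  unfold Fock.waveFunctions
  rw [h]
  exact Lp.coeFn_const 2 (confMeasure N 0) (1 : ℂ)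

theorem norm_vacuum : ‖vacuum N‖ = 1 := by
  have h : ‖vacuum N‖ = ‖Lp.const 2 (confMeasure N 0) (1 : ℂ)‖ :=
    lp.norm_single (E := fun n : ℕ => bosonSpace N n) (by norm_num) 0 _
  have : NeZero (confMeasure N 0) := ⟨by rw [confMeasure_zero]; exact Measure.dirac_ne_zero⟩
  rw [h, Lp.norm_const 2 _ _ (by norm_num), confMeasure_zero]
  simp

theorem inner_vacuum_vacuum : inner ℂ (vacuum N) (vacuum N) = 1 := by
  rw [inner_self_eq_norm_sq_to_K, norm_vacuum]; simp

/-! ### One-boson vectors -/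

theorem mode_ae {p : Mode N → Prop} : (∀ᵐ m ∂modeMeasure N, p m) → ∀ i, ∀ᵐ k : ℝ, p (i, k) := by
  intro h
  exact Measure.ae_count_iff.1 (Measure.ae_ae_of_ae_prod h)

theorem measurePreserving_conf_one :
    MeasurePreserving (fun x : Fin 1 → Mode N => x 0) (confMeasure N 1) (modeMeasure N) :=
  measurePreserving_funUnique (modeMeasure N) (Fin 1)

/-- Counting measure restricted to one reservoir is a point mass, leaving Lebesgue measure in the
momentum. Thus `L²(ℝ)` embeds isometrically into the one-boson functions. -/
theorem measurePreserving_momentum (i : Fin N) :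
    MeasurePreserving (fun x : Fin 1 → Mode N => (x 0).2)
      ((confMeasure N 1).restrict {x | (x 0).1 = i}) volume := by
  have h1 : MeasurePreserving (Prod.snd : Mode N → ℝ)
      ((modeMeasure N).restrict {m | m.1 = i}) volume := by
    have h2 : (modeMeasure N).restrict {m | m.1 = i}
        = (Measure.dirac i).prod (volume : Measure ℝ) := by
      have h3 : ({m | m.1 = i} : Set (Mode N)) = {i} ×ˢ Set.univ := by ext m; simp
      rw [h3, modeMeasure, ← Measure.prod_restrict, Measure.restrict_univ,
        Measure.restrict_singleton, Measure.count_singleton, one_smul]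
    rw [h2]
    exact measurePreserving_snd
  have h4 := measurePreserving_conf_one.restrict_preimage (s := {m : Mode N | m.1 = i})
    (measurable_fst (measurableSet_singleton i))
  exact h1.comp h4

theorem measurableSet_reservoir (i : Fin N) :
    MeasurableSet {x : Fin 1 → Mode N | (x 0).1 = i} :=
  ((measurable_pi_apply 0).fst) (measurableSet_singleton i)

theorem memLp_oneBoson (i : Fin N) (f : Lp ℂ 2 (volume : Measure ℝ)) :
    MemLp ({x : Fin 1 → Mode N | (x 0).1 = i}.indicator (f ∘ fun x => (x 0).2)) 2
      (confMeasure N 1) :=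
  (memLp_indicator_iff_restrict (measurableSet_reservoir i)).2
    ((Lp.memLp f).comp_measurePreserving (measurePreserving_momentum i))

theorem momentum_ae {p : ℝ → Prop} (h : ∀ᵐ k, p k) (i : Fin N) :
    ∀ᵐ x ∂confMeasure N 1, (x 0).1 = i → p (x 0).2 := by
  have h1 := (measurePreserving_momentum i).quasiMeasurePreserving.ae h
  exact (ae_restrict_iff' (measurableSet_reservoir i)).1 h1

/-- The wave function of a boson in reservoir `i` with momentum distribution `f`. -/
noncomputable def oneBosonWave (i : Fin N) :
    Lp ℂ 2 (volume : Measure ℝ) →ₗᵢ[ℂ] Lp ℂ 2 (confMeasure N 1) where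
  toFun f := (memLp_oneBoson i f).toLp _
  map_add' f g := by
    refine Lp.ext ?_
    filter_upwards [(memLp_oneBoson i (f + g)).coeFn_toLp, (memLp_oneBoson i f).coeFn_toLp,
      (memLp_oneBoson i g).coeFn_toLp, Lp.coeFn_add ((memLp_oneBoson i f).toLp _)
        ((memLp_oneBoson i g).toLp _), momentum_ae (Lp.coeFn_add f g) i] with x h1 h2 h3 h4 h5
    rw [h1, h4, Pi.add_apply, h2, h3]
    by_cases hx : (x 0).1 = i
    · simpa [Set.indicator, hx] using h5 hx
    · simp [Set.indicator, hx]
  map_smul' c f := by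
    refine Lp.ext ?_
    filter_upwards [(memLp_oneBoson i (c • f)).coeFn_toLp, (memLp_oneBoson i f).coeFn_toLp,
      Lp.coeFn_smul c ((memLp_oneBoson i f).toLp _),
      momentum_ae (Lp.coeFn_smul c f) i] with x h1 h2 h4 h5
    rw [RingHom.id_apply, h1, h4, Pi.smul_apply, h2]
    by_cases hx : (x 0).1 = i
    · simpa [Set.indicator, hx] using h5 hx
    · simp [Set.indicator, hx]
  norm_map' f := by
    change ‖(memLp_oneBoson i f).toLp _‖ = ‖f‖
    rw [Lp.norm_toLp, eLpNorm_indicator_eq_eLpNorm_restrict (measurableSet_reservoir i),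
      eLpNorm_comp_measurePreserving (Lp.aestronglyMeasurable f) (measurePreserving_momentum i),
      Lp.norm_def]

theorem coeFn_oneBosonWave (i : Fin N) (f : Lp ℂ 2 (volume : Measure ℝ)) :
    oneBosonWave i f =ᵐ[confMeasure N 1] fun x => if (x 0).1 = i then f (x 0).2 else 0 :=
  (memLp_oneBoson i f).coeFn_toLp.trans (Eventually.of_forall fun x => by
    simp [Set.indicator])

theorem oneBosonWave_mem (i : Fin N) (f : Lp ℂ 2 (volume : Measure ℝ)) :
    oneBosonWave i f ∈ bosonSpace N 1 := by
  unfold bosonSpace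
  rw [Submodule.mem_iInf]
  intro σ
  change Lp.compMeasurePreserving _ (measurePreserving_perm N 1 σ) _ = _
  refine Lp.ext ((Lp.coeFn_compMeasurePreserving _ _).trans (Eventually.of_forall fun x => ?_))
  have h : x ∘ σ = x := by rw [Subsingleton.elim σ 1]; rfl
  rw [Function.comp_apply, h]; rfl

/-- `|0⟩ ⊗ ∫ f(k) b†_{k,i} dk Ω`. -/
noncomputable def oneBoson (i : Fin N) : Lp ℂ 2 (volume : Measure ℝ) →L[ℂ] TotalSpace N :=
  (ketₗᵢ (Sum.inl ())).toContinuousLinearMap ∘L fockSingle 1 ∘L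
    ((oneBosonWave i).toContinuousLinearMap.codRestrict (bosonSpace N 1) (oneBosonWave_mem i))

theorem oneBoson_component_inr (i j : Fin N) (f : Lp ℂ 2 (volume : Measure ℝ)) :
    (oneBoson i f).component (Sum.inr j) = 0 :=
  component_ket_ne (by simp) _

theorem oneBoson_component_ne (i : Fin N) (f : Lp ℂ 2 (volume : Measure ℝ)) (s : Level N) {n : ℕ}
    (hn : n ≠ 1) : ((oneBoson i f).component s).component n = 0 := by
  rcases s with ⟨⟩ | j
  · rw [show (oneBoson i f).component (Sum.inl ()) = fockSingle 1 ⟨oneBosonWave i f, _⟩ from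
      component_ket_same _ _]
    exact component_fockSingle_ne hn _
  · rw [oneBoson_component_inr]; rfl

theorem oneBoson_waveFunctions (i : Fin N) (f : Lp ℂ 2 (volume : Measure ℝ)) :
    ((oneBoson i f).component (Sum.inl ())).waveFunctions 1 =ᵐ[confMeasure N 1]
      fun x => if (x 0).1 = i then f (x 0).2 else 0 := by
  have h : ((oneBoson i f).component (Sum.inl ())).component 1
      = ⟨oneBosonWave i f, oneBosonWave_mem i f⟩ := by
    rw [show (oneBoson i f).component (Sum.inl ()) = fockSingle 1 ⟨oneBosonWave i f, _⟩ from
      component_ket_same _ _]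
    exact component_fockSingle_same 1 _
  unfold Fock.waveFunctions
  rw [h]
  exact coeFn_oneBosonWave i f

end vectors

section sector

variable {N : ℕ}

/-! ### The sectors with at most one excitation -/

instance (n : ℕ) : SigmaFinite (confMeasure N n) := by
  unfold confMeasure; infer_instance

/-- The only configuration of zero bosons has positive mass, so almost everywhere means everywhere.
-/
theorem ae_conf_zero {p : (Fin 0 → Mode N) → Prop} (h : ∀ᵐ x ∂confMeasure N 0, p x) (x) : p x := by
  rw [confMeasure_zero, ae_dirac_eq] at h
  rw [Subsingleton.elim x isEmptyElim]
  exact h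

/-- `annihilation` evaluates a wave function, defined only up to null sets, at `Fin.cons (i, k) x`.
Fubini shows that null sets remain invisible to its integral over `k`; `ae_conf_succAbove` plays the
same role for `creation`. -/
theorem ae_conf_cons {n : ℕ} {p : (Fin (n + 1) → Mode N) → Prop}
    (h : ∀ᵐ x ∂confMeasure N (n + 1), p x) (i : Fin N) :
    ∀ᵐ x ∂confMeasure N n, ∀ᵐ k : ℝ, p (Fin.cons (i, k) x) := by
  have h1 := (measurePreserving_piFinSuccAbove (fun _ : Fin (n + 1) => modeMeasure N) 0).symm
  have h2 := h1.quasiMeasurePreserving.ae h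
  have h3 := (Measure.measurePreserving_swap (μ := confMeasure N n)
    (ν := modeMeasure N)).quasiMeasurePreserving.ae h2
  filter_upwards [Measure.ae_ae_of_ae_prod h3] with x hx
  have h4 := mode_ae hx i
  filter_upwards [h4] with k hk
  simpa [MeasurableEquiv.piFinSuccAbove, Fin.consEquiv] using hk

theorem ae_conf_succAbove {n : ℕ} {p : (Fin n → Mode N) → Prop}
    (h : ∀ᵐ x ∂confMeasure N n, p x) (j : Fin (n + 1)) :
    ∀ᵐ x ∂confMeasure N (n + 1), p (fun l => x (j.succAbove l)) := by
  have h1 := (measurePreserving_piFinSuccAbove (fun _ : Fin (n + 1) => modeMeasure N) j)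
  have h2 : ∀ᵐ z ∂(modeMeasure N).prod (confMeasure N n), p z.2 :=
    Measure.quasiMeasurePreserving_snd.ae h
  exact h1.quasiMeasurePreserving.ae h2

/-- `ψ = a |0⟩Ω + ∑ᵢ bᵢ |i⟩Ω + |0⟩ ⊗ ∑ᵢ ∫ F(i,k) b†_{k,i} dk Ω`. -/
structure IsSector (ψ : TotalSpace N) (a : ℂ) (F : Mode N → ℂ) (b : Fin N → ℂ) : Prop where
  ground_zero : (ψ.component (Sum.inl ())).waveFunctions 0 =ᵐ[confMeasure N 0] fun _ => a
  ground_one : (ψ.component (Sum.inl ())).waveFunctions 1 =ᵐ[confMeasure N 1] fun x => F (x 0)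
  ground_ge : ∀ n, (ψ.component (Sum.inl ())).component (n + 2) = 0
  excited_zero : ∀ i, (ψ.component (Sum.inr i)).waveFunctions 0 =ᵐ[confMeasure N 0] fun _ => b i
  excited_ge : ∀ i n, (ψ.component (Sum.inr i)).component (n + 1) = 0

theorem IsSector.add {ψ ψ' : TotalSpace N} {a a' : ℂ} {F F' : Mode N → ℂ} {b b' : Fin N → ℂ}
    (h : IsSector ψ a F b) (h' : IsSector ψ' a' F' b') :
    IsSector (ψ + ψ') (a + a') (fun m => F m + F' m) (fun i => b i + b' i) where
  ground_zero := by
    filter_upwards [waveFunctions_add (ψ.component (Sum.inl ())) (ψ'.component (Sum.inl ())) 0,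
      h.ground_zero, h'.ground_zero] with x h1 h2 h3
    rw [TotalSpace.component_add, h1, h2, h3]
  ground_one := by
    filter_upwards [waveFunctions_add (ψ.component (Sum.inl ())) (ψ'.component (Sum.inl ())) 1,
      h.ground_one, h'.ground_one] with x h1 h2 h3
    rw [TotalSpace.component_add, h1, h2, h3]
  ground_ge n := by simp [h.ground_ge, h'.ground_ge]
  excited_zero i := by
    filter_upwards [waveFunctions_add (ψ.component (Sum.inr i)) (ψ'.component (Sum.inr i)) 0,
      h.excited_zero i, h'.excited_zero i] with x h1 h2 h3
    rw [TotalSpace.component_add, h1, h2, h3]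
  excited_ge i n := by simp [h.excited_ge, h'.excited_ge]

theorem IsSector.smul {ψ : TotalSpace N} {a : ℂ} {F : Mode N → ℂ} {b : Fin N → ℂ}
    (h : IsSector ψ a F b) (c : ℂ) :
    IsSector (c • ψ) (c * a) (fun m => c * F m) (fun i => c * b i) where
  ground_zero := by
    filter_upwards [waveFunctions_smul c (ψ.component (Sum.inl ())) 0, h.ground_zero] with x h1 h2
    rw [TotalSpace.component_smul, h1, h2]
  ground_one := by
    filter_upwards [waveFunctions_smul c (ψ.component (Sum.inl ())) 1, h.ground_one] with x h1 h2
    rw [TotalSpace.component_smul, h1, h2]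
  ground_ge n := by simp [h.ground_ge]
  excited_zero i := by
    filter_upwards [waveFunctions_smul c (ψ.component (Sum.inr i)) 0, h.excited_zero i]
      with x h1 h2
    rw [TotalSpace.component_smul, h1, h2]
  excited_ge i n := by simp [h.excited_ge]

theorem IsSector.zero : IsSector (0 : TotalSpace N) 0 (fun _ => 0) (fun _ => 0) where
  ground_zero := waveFunctions_eq_zero rfl
  ground_one := waveFunctions_eq_zero rfl
  ground_ge _ := rfl
  excited_zero _ := waveFunctions_eq_zero rfl
  excited_ge _ _ := rfl

theorem IsSector.sum {ι : Type*} (t : Finset ι) {ψ : ι → TotalSpace N} {a : ι → ℂ}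
    {F : ι → Mode N → ℂ} {b : ι → Fin N → ℂ} (h : ∀ l, IsSector (ψ l) (a l) (F l) (b l)) :
    IsSector (∑ l ∈ t, ψ l) (∑ l ∈ t, a l) (fun m => ∑ l ∈ t, F l m) (fun i => ∑ l ∈ t, b l i) := by
  classical
  induction t using Finset.induction_on with
  | empty => simpa using IsSector.zero
  | insert l t hl ih => simpa only [Finset.sum_insert hl] using (h l).add ih

theorem isSector_ground : IsSector (ket (Sum.inl ()) (vacuum N)) 1 (fun _ => 0) (fun _ => 0) where
  ground_zero := by rw [component_ket_same]; exact vacuum_waveFunctions_zero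
  ground_one := waveFunctions_eq_zero (by
    rw [component_ket_same]; exact vacuum_component_ne one_ne_zero)
  ground_ge n := by rw [component_ket_same]; exact vacuum_component_ne (by omega)
  excited_zero i := waveFunctions_eq_zero (by rw [component_ket_ne (by simp)]; rfl)
  excited_ge i n := by rw [component_ket_ne (by simp)]; rfl

theorem isSector_ket (l : Fin N) :
    IsSector (ket (Sum.inr l) (vacuum N)) 0 (fun _ => 0) (fun i => if i = l then 1 else 0) where
  ground_zero := waveFunctions_eq_zero (by rw [component_ket_ne (by simp)]; rfl)
  ground_one := waveFunctions_eq_zero (by rw [component_ket_ne (by simp)]; rfl)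
  ground_ge n := by rw [component_ket_ne (by simp)]; rfl
  excited_zero i := by
    by_cases h : i = l
    · subst h
      rw [component_ket_same]; simpa using vacuum_waveFunctions_zero
    · simp only [h, if_false]
      exact waveFunctions_eq_zero (by rw [component_ket_ne (by simpa using h)]; rfl)
  excited_ge i n := by
    by_cases h : i = l
    · subst h
      rw [component_ket_same]; exact vacuum_component_ne (by omega)
    · rw [component_ket_ne (by simpa using h)]; rfl

theorem isSector_oneBoson (i : Fin N) (f : Lp ℂ 2 (volume : Measure ℝ)) {f' : ℝ → ℂ}
    (hf : f =ᵐ[volume] f') :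
    IsSector (oneBoson i f) 0 (fun m => if m.1 = i then f' m.2 else 0) (fun _ => 0) where
  ground_zero := waveFunctions_eq_zero (oneBoson_component_ne i f _ (by norm_num))
  ground_one := by
    filter_upwards [oneBoson_waveFunctions i f, momentum_ae hf i] with x h1 h2
    rw [h1]
    split_ifs with h
    · exact h2 h
    · rfl
  ground_ge n := oneBoson_component_ne i f _ (by omega)
  excited_zero j := waveFunctions_eq_zero (oneBoson_component_ne i f _ (by norm_num))
  excited_ge j n := by rw [oneBoson_component_inr]; rfl

/-- `∑ᵢ qᵢ |i⟩ ⊗ Ω`. -/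
noncomputable def excited (q : Fin N → ℂ) : TotalSpace N :=
  ∑ l, q l • ket (Sum.inr l) (vacuum N)

theorem isSector_excited (q : Fin N → ℂ) : IsSector (excited q) 0 (fun _ => 0) q := by
  have h := IsSector.sum Finset.univ fun l => (isSector_ket l).smul (q l)
  rw [excited]
  simpa using h

variable {ω : ℝ → ℝ} {g : ℝ → ℂ} {HS : Matrix (Fin N) (Fin N) ℂ} {c : ℝ}

theorem sum_excitedBlock_inl (Φ : Level N → ℂ) (u : Unit) :
    ∑ s', excitedBlock HS (Sum.inl u) s' * Φ s' = 0 := by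
  simp [excitedBlock, Fintype.sum_sum_type]

theorem sum_excitedBlock_inr (Φ : Level N → ℂ) (i : Fin N) :
    ∑ s', excitedBlock HS (Sum.inr i) s' * Φ s' = ∑ j, HS i j * Φ (Sum.inr j) := by
  simp [excitedBlock, Fintype.sum_sum_type]

/-- Conservation of the excitation number: the coefficients `(a, F, b)` are mapped to coefficients
of the same kind, with `a` going to `0`. All other components vanish on both sides. -/
theorem hamiltonianGraph_of_isSector {ψ χ : TotalSpace N} {a : ℂ} {F F' : Mode N → ℂ}
    {b b' : Fin N → ℂ} (h : IsSector ψ a F b) (h' : IsSector χ 0 F' b')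
    (hF : ∀ m, F' m = ω m.2 * F m + c * (conj (g m.2) * b m.1))
    (hb : ∀ i, b' i = (∑ j, HS i j * b j) + c * ∫ k, g k * F (i, k)) :
    HamiltonianGraph ω g HS c ψ χ := by
  refine ⟨⟨2, fun s n hn => ?_⟩, fun s n => ?_⟩
  · obtain ⟨n, rfl⟩ := Nat.exists_eq_add_of_le' hn
    rcases s with ⟨⟩ | i
    · exact h.ground_ge n
    · exact h.excited_ge i (n + 1)
  rcases s with ⟨⟩ | i
  · rcases n with _ | _ | n
    · filter_upwards [h'.ground_zero] with x h1
      rw [h1]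
      simp only [formalHamiltonian]
      rw [sum_excitedBlock_inl]
      simp [fieldEnergy, interaction, creation]
    · filter_upwards [h'.ground_one, h.ground_one] with x h1 h2
      rw [h1, hF]
      simp only [formalHamiltonian]
      rw [sum_excitedBlock_inl]
      have h3 : ∀ i y, (ψ.component (Sum.inr i)).waveFunctions 0 y = b i :=
        fun i y => ae_conf_zero (h.excited_zero i) y
      simp [fieldEnergy, interaction, creation, h2, h3]
    · have h3 : ∀ᵐ x ∂confMeasure N (n + 2), ∀ i : Fin N, ∀ j : Fin (n + 2),
          (ψ.component (Sum.inr i)).waveFunctions (n + 1) (fun l => x (j.succAbove l)) = 0 := by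
        rw [ae_all_iff]; intro i
        rw [ae_all_iff]; intro j
        exact ae_conf_succAbove (waveFunctions_eq_zero (h.excited_ge i n)) j
      filter_upwards [waveFunctions_eq_zero (h'.ground_ge n),
        waveFunctions_eq_zero (h.ground_ge n), h3] with x h1 h2 h3
      rw [h1]
      simp only [formalHamiltonian]
      rw [sum_excitedBlock_inl]
      simp [fieldEnergy, interaction, creation, h2, h3]
  · rcases n with _ | n
    · have h3 : ∀ j y, (ψ.component (Sum.inr j)).waveFunctions 0 y = b j :=
        fun i y => ae_conf_zero (h.excited_zero i) y
      filter_upwards [h'.excited_zero i, ae_conf_cons h.ground_one i] with x h1 h2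
      rw [h1, hb]
      simp only [formalHamiltonian]
      rw [sum_excitedBlock_inr]
      have h4 : (∫ k, g k * (ψ.component (Sum.inl ())).waveFunctions 1 (Fin.cons (i, k) x))
          = ∫ k, g k * F (i, k) := by
        refine integral_congr_ae ?_
        filter_upwards [h2] with k hk
        rw [hk]; rfl
      simp [fieldEnergy, interaction, annihilation, h3, h4]
    · have h5 : ∀ᵐ x ∂confMeasure N (n + 1), ∀ j : Fin N,
          (ψ.component (Sum.inr j)).waveFunctions (n + 1) x = 0 := by
        rw [ae_all_iff]; intro j
        exact waveFunctions_eq_zero (h.excited_ge j n)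
      filter_upwards [waveFunctions_eq_zero (h'.excited_ge i n), h5,
        ae_conf_cons (waveFunctions_eq_zero (h.ground_ge n)) i] with x h1 h2 h3
      rw [h1]
      simp only [formalHamiltonian]
      rw [sum_excitedBlock_inr]
      have h4 : (∫ k, g k * (ψ.component (Sum.inl ())).waveFunctions (n + 2) (Fin.cons (i, k) x))
          = 0 := by
        refine integral_eq_zero_of_ae ?_
        filter_upwards [h3] with k hk
        rw [hk]; simp
      simp [fieldEnergy, interaction, annihilation, h2, h4]

theorem graph_ground : HamiltonianGraph ω g HS c (ket (Sum.inl ()) (vacuum N)) 0 :=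
  hamiltonianGraph_of_isSector isSector_ground IsSector.zero (by simp) (by simp)

/-- The Hamiltonian on the excited states of the system, with `f = g^*`. -/
theorem graph_excited (q : Fin N → ℂ) {f : Lp ℂ 2 (volume : Measure ℝ)}
    (hf : f =ᵐ[volume] fun k => conj (g k)) :
    HamiltonianGraph ω g HS c (excited q)
      (excited (HS *ᵥ q) + (c : ℂ) • ∑ l, q l • oneBoson l f) := by
  refine hamiltonianGraph_of_isSector (isSector_excited q)
    (F' := fun m => 0 + c * ∑ l, q l * (if m.1 = l then conj (g m.2) else 0))
    (b' := fun i => (HS *ᵥ q) i + c * ∑ l, q l * 0) ?_ ?_ ?_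
  · have h := (isSector_excited (HS *ᵥ q)).add ((IsSector.sum Finset.univ fun l =>
      (isSector_oneBoson l f hf).smul (q l)).smul c)
    simpa using h
  · intro m; simp [mul_comm]
  · intro i; simp [mulVec, dotProduct]

/-- The Hamiltonian on the one-boson states, with `f' = ω f`. -/
theorem graph_oneBoson (i : Fin N) {f f' : Lp ℂ 2 (volume : Measure ℝ)}
    (hf' : f' =ᵐ[volume] fun k => ω k * f k) :
    HamiltonianGraph ω g HS c (oneBoson i f)
      (oneBoson i f' + ((c : ℂ) * ∫ k, g k * f k) • ket (Sum.inr i) (vacuum N)) := by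
  have h := (isSector_oneBoson i f' hf').add ((isSector_ket i).smul ((c : ℂ) * ∫ k, g k * f k))
  simp only [mul_zero, add_zero] at h
  refine hamiltonianGraph_of_isSector (isSector_oneBoson i f (ae_eq_refl _)) h ?_ ?_
  · intro m; simp
  · intro j
    by_cases hj : j = i <;> simp [hj]

end sector

/-! ### Unitary groups -/

namespace IsUnitaryGroup

variable {N : ℕ} {graph : TotalSpace N → TotalSpace N → Prop}
  {U : ℝ → TotalSpace N ≃ₗᵢ[ℂ] TotalSpace N} (h : IsUnitaryGroup graph U)
include h

theorem inner_neg_right (t : ℝ) (ψ χ : TotalSpace N) :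
    inner ℂ ψ (U (-t) χ) = inner ℂ (U t ψ) χ := by
  rw [← (U t).inner_map_map ψ, ← h.add, add_neg_cancel, h.zero]

theorem hasDerivAt {ψ χ : TotalSpace N} (hψ : graph ψ χ) (t : ℝ) :
    HasDerivAt (fun t => U t ψ) (U t (-Complex.I • χ)) t := by
  have h1 : HasDerivAt (fun s => U (s - t) ψ) (-Complex.I • χ) t := by
    have h0 := h.generator ψ χ hψ
    rw [← sub_self t] at h0
    exact h0.comp_sub_const t t
  have h2 := ((U t).toContinuousLinearEquiv : TotalSpace N →L[ℂ] TotalSpace N).restrictScalars ℝ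
    |>.hasFDerivAt.comp_hasDerivAt t h1
  refine h2.congr_of_eventuallyEq (Eventually.of_forall fun s => ?_)
  change U s ψ = U t (U (s - t) ψ)
  rw [← h.add, add_sub_cancel]

/-- The curve `e^{iκt} U_t ψ` has derivative zero, hence is constant. -/
theorem apply_eigenvector {ψ : TotalSpace N} {κ : ℂ} (hψ : graph ψ (κ • ψ)) (t : ℝ) :
    U t ψ = Complex.exp (-Complex.I * κ * t) • ψ := by
  have h1 : ∀ t : ℝ, HasDerivAt (fun t : ℝ => Complex.exp (Complex.I * κ * t) • U t ψ) 0 t := by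
    intro t
    have h2 : HasDerivAt (fun t : ℝ => Complex.exp (Complex.I * κ * t))
        (Complex.exp (Complex.I * κ * t) * (Complex.I * κ)) t := by
      have h3 : HasDerivAt (fun t : ℝ => Complex.I * κ * (t : ℂ)) (Complex.I * κ) t := by
        simpa using (Complex.ofRealCLM.hasDerivAt (x := t)).const_mul (Complex.I * κ)
      exact h3.cexp
    convert! h2.smul (h.hasDerivAt hψ t) using 1
    rw [LinearIsometryEquiv.map_smul, LinearIsometryEquiv.map_smul, smul_smul, smul_smul, ← add_smul]
    ring_nf
    rw [zero_smul]
  have h4 := is_const_of_deriv_eq_zero (fun t => (h1 t).differentiableAt)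
    (fun t => (h1 t).deriv) t 0
  simp only [Complex.ofReal_zero, mul_zero, Complex.exp_zero, one_smul, h.zero] at h4
  conv_rhs => rw [← h4, smul_smul, ← Complex.exp_add]
  simp

/-- Since `U` is only strongly continuous, the curve is split as `(c(s') - c(s)) + c(s)`: for the
first part the isometry carries convergent slopes over, for the second only `c(s)` has to lie in the
domain. -/
theorem hasDerivAt_apply_curve {c : ℝ → TotalSpace N} {c' d : TotalSpace N} {t s : ℝ}
    (hc : HasDerivAt c c' s) (hd : graph (c s) d) :
    HasDerivAt (fun s => U (t - s) (c s)) (U (t - s) (c' + Complex.I • d)) s := by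
  have h1 : HasDerivAt (fun s' => U (t - s') (c s)) (U (t - s) (Complex.I • d)) s := by
    have h2 := (h.hasDerivAt hd (t - s)).scomp s ((hasDerivAt_id s).const_sub t)
    simpa [Function.comp_def] using h2
  have h3 : HasDerivAt (fun s' => U (t - s') (c s' - c s)) (U (t - s) c') s := by
    rw [hasDerivAt_iff_tendsto_slope] at hc ⊢
    have h4 : slope (fun s' => U (t - s') (c s' - c s)) s
        = fun s' => U (t - s') (slope c s s') := by
      funext s'
      rw [slope_def_module, slope_def_module, sub_self, LinearIsometryEquiv.map_zero, sub_zero]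
      exact (((U (t - s')).toContinuousLinearEquiv :
        TotalSpace N →L[ℂ] TotalSpace N).restrictScalars ℝ).map_smul _ _ |>.symm
    rw [h4]
    have h5 : Tendsto (fun s' => U (t - s') c') (𝓝[≠] s) (𝓝 (U (t - s) c')) :=
      (((h.continuous c').comp (continuous_const.sub continuous_id)).tendsto s).mono_left
        nhdsWithin_le_nhds
    have h6 : Tendsto (fun s' => U (t - s') (slope c s s' - c')) (𝓝[≠] s) (𝓝 0) := by
      refine squeeze_zero_norm (fun s' => le_of_eq (LinearIsometryEquiv.norm_map _ _)) ?_
      exact tendsto_iff_norm_sub_tendsto_zero.1 hc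
    have h7 := h6.add h5
    rw [zero_add] at h7
    refine h7.congr fun s' => ?_
    rw [← map_add, sub_add_cancel]
  have h8 := h3.add h1
  rw [← map_add] at h8
  refine h8.congr_of_eventuallyEq (Eventually.of_forall fun s' => ?_)
  simp only [Pi.add_apply]
  rw [← map_add, sub_add_cancel]

end IsUnitaryGroup

/-! ### Multiplication by phases and truncations in `L²` -/

section phases

variable {ω : ℝ → ℝ}

theorem norm_phase (x s : ℝ) : ‖Complex.exp (-Complex.I * x * s)‖ = 1 := by
  rw [Complex.norm_exp]; simp

theorem memLp_phase (hω : Measurable ω) (f : Lp ℂ 2 (volume : Measure ℝ)) (s : ℝ) :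
    MemLp (fun k : ℝ => Complex.exp (-Complex.I * ω k * s) * f k) 2 volume := by
  refine (Lp.memLp f).of_le (AEStronglyMeasurable.mul
    (Measurable.aestronglyMeasurable (by fun_prop)) (Lp.aestronglyMeasurable f)) ?_
  exact Eventually.of_forall fun k => by rw [norm_mul, norm_phase, one_mul]

theorem memLp_mul_of_bounded (hω : Measurable ω) (f : Lp ℂ 2 (volume : Measure ℝ)) {M : ℝ}
    (hM : ∀ᵐ k, |ω k| ≤ M ∨ f k = 0) : MemLp (fun k : ℝ => (ω k : ℂ) * f k) 2 volume := by
  refine ((Lp.memLp f).const_mul (M : ℂ)).of_le (AEStronglyMeasurable.mul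
    (Measurable.aestronglyMeasurable (by fun_prop)) (Lp.aestronglyMeasurable f)) ?_
  filter_upwards [hM] with k hk
  rcases hk with hk | hk
  · rw [norm_mul, norm_mul, Complex.norm_real, Complex.norm_real]
    gcongr
    exact hk.trans (le_abs_self M)
  · simp [hk]

/-- `e^{-iωs} f`. -/
noncomputable def phase (hω : Measurable ω) (f : Lp ℂ 2 (volume : Measure ℝ)) (s : ℝ) :
    Lp ℂ 2 (volume : Measure ℝ) := (memLp_phase hω f s).toLp _

theorem coeFn_phase (hω : Measurable ω) (f : Lp ℂ 2 (volume : Measure ℝ)) (s : ℝ) :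
    phase hω f s =ᵐ[volume] fun k : ℝ => Complex.exp (-Complex.I * ω k * s) * f k :=
  (memLp_phase hω f s).coeFn_toLp

theorem phase_zero (hω : Measurable ω) (f : Lp ℂ 2 (volume : Measure ℝ)) : phase hω f 0 = f := by
  refine Lp.ext ?_
  filter_upwards [coeFn_phase hω f 0] with k hk
  simp [hk]

theorem phase_bounded (hω : Measurable ω) {f : Lp ℂ 2 (volume : Measure ℝ)} {M : ℝ}
    (hM : ∀ᵐ k, |ω k| ≤ M ∨ f k = 0) (s : ℝ) : ∀ᵐ k, |ω k| ≤ M ∨ phase hω f s k = 0 := by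
  filter_upwards [hM, coeFn_phase hω f s] with k h1 h2
  rcases h1 with h1 | h1
  · exact Or.inl h1
  · exact Or.inr (by simp [h2, h1])

/-- As `|ω| ≤ M` wherever `f ≠ 0`, the estimate `|e^y - 1 - y| ≤ |y|²` holds uniformly in the
momentum and bounds the remainder by `M²h²‖f‖`. -/
theorem hasDerivAt_phase (hω : Measurable ω) {f : Lp ℂ 2 (volume : Measure ℝ)} {M : ℝ}
    (hM : ∀ᵐ k, |ω k| ≤ M ∨ f k = 0) (s : ℝ) :
    HasDerivAt (phase hω f)
      (-Complex.I • (memLp_mul_of_bounded hω (phase hω f s) (phase_bounded hω hM s)).toLp _) s := by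
  rw [hasDerivAt_iff_isLittleO_nhds_zero]
  have hO : (fun h : ℝ => phase hω f (s + h) - phase hω f s
      - h • (-Complex.I • (memLp_mul_of_bounded hω (phase hω f s)
        (phase_bounded hω hM s)).toLp _)) =O[𝓝 0] fun h : ℝ => h ^ 2 := by
    refine Asymptotics.IsBigO.of_bound (M ^ 2 * ‖f‖) ?_
    have hev : ∀ᶠ h : ℝ in 𝓝 0, |M| * |h| ≤ 1 := by
      have : Tendsto (fun h : ℝ => |M| * |h|) (𝓝 0) (𝓝 0) :=
        Continuous.tendsto' (by fun_prop) _ _ (by simp)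
      exact this.eventually_le_const one_pos
    filter_upwards [hev] with h hh
    rw [norm_pow, Real.norm_eq_abs]
    have h1 : M ^ 2 * ‖f‖ * |h| ^ 2 = (M ^ 2 * |h| ^ 2) * ‖f‖ := by ring
    rw [h1]
    refine Lp.norm_le_mul_norm_of_ae_le_mul ?_
    set w := (memLp_mul_of_bounded hω (phase hω f s) (phase_bounded hω hM s)).toLp _ with hw
    filter_upwards [hM, coeFn_phase hω f s, coeFn_phase hω f (s + h),
      Lp.coeFn_sub (phase hω f (s + h) - phase hω f s) (h • (-Complex.I • w)),
      Lp.coeFn_sub (phase hω f (s + h)) (phase hω f s), Lp.coeFn_smul h (-Complex.I • w),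
      Lp.coeFn_smul (-Complex.I) w,
      (memLp_mul_of_bounded hω (phase hω f s) (phase_bounded hω hM s)).coeFn_toLp]
      with k h0 h1 h2 h3 h4 h5 h6 h7
    rw [h3, Pi.sub_apply, h4, Pi.sub_apply, h5, Pi.smul_apply, h6, Pi.smul_apply, h7, h1, h2]
    rcases h0 with h0 | h0
    · set y : ℂ := -Complex.I * ω k * h with hy
      have hyn : ‖y‖ = |ω k| * |h| := by simp [hy]
      have hy2 : ‖y‖ ≤ |M| * |h| := by
        rw [hyn]
        exact mul_le_mul_of_nonneg_right (h0.trans (le_abs_self M)) (abs_nonneg h)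
      have h8 : Complex.exp (-Complex.I * ω k * (s + h : ℝ)) * f k
          - Complex.exp (-Complex.I * ω k * s) * f k
          - h • (-Complex.I • ((ω k : ℂ) * (Complex.exp (-Complex.I * ω k * s) * f k)))
          = (Complex.exp y - 1 - y) * (Complex.exp (-Complex.I * ω k * s) * f k) := by
        have : -Complex.I * ω k * (s + h : ℝ) = y + -Complex.I * ω k * s := by
          rw [hy]; push_cast; ring
        rw [this, Complex.exp_add, Complex.real_smul, smul_eq_mul, hy]; ring
      rw [h8, norm_mul, norm_mul, norm_phase, one_mul]
      gcongr
      refine (Complex.norm_exp_sub_one_sub_id_le (hy2.trans hh)).trans ?_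
      calc ‖y‖ ^ 2 ≤ (|M| * |h|) ^ 2 := by gcongr
        _ = _ := by rw [mul_pow, sq_abs M]
    · simp only [h0, mul_zero, sub_self, smul_zero, norm_zero, le_refl]
  refine hO.trans_isLittleO ?_
  have := Asymptotics.isLittleO_pow_id (𝕜 := ℝ) one_lt_two
  exact this

/-- `f` restricted to the momenta with `|ω| ≤ n`. -/
noncomputable def truncation (hω : Measurable ω) (f : Lp ℂ 2 (volume : Measure ℝ)) (n : ℕ) :
    Lp ℂ 2 (volume : Measure ℝ) :=
  ((Lp.memLp f).indicator (s := {k | |ω k| ≤ n})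
    (measurableSet_le (by fun_prop) measurable_const)).toLp _

theorem coeFn_truncation (hω : Measurable ω) (f : Lp ℂ 2 (volume : Measure ℝ)) (n : ℕ) :
    truncation hω f n =ᵐ[volume] ({k | |ω k| ≤ n}).indicator f :=
  MemLp.coeFn_toLp _

theorem truncation_bounded (hω : Measurable ω) (f : Lp ℂ 2 (volume : Measure ℝ)) (n : ℕ) :
    ∀ᵐ k, |ω k| ≤ n ∨ truncation hω f n k = 0 := by
  filter_upwards [coeFn_truncation hω f n] with k hk
  by_cases h : |ω k| ≤ n
  · exact Or.inl h
  · exact Or.inr (hk.trans (Set.indicator_of_notMem (s := {k | |ω k| ≤ n}) h f))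

theorem tendsto_integral_mul_truncation (hω : Measurable ω) {u : ℝ → ℂ}
    (hu : MemLp u 2 volume) (f : Lp ℂ 2 (volume : Measure ℝ)) :
    Tendsto (fun n => ∫ k, u k * truncation hω f n k) atTop (𝓝 (∫ k, u k * f k)) := by
  refine tendsto_integral_of_dominated_convergence (fun k => ‖u k * f k‖)
    (fun n => hu.aestronglyMeasurable.mul (Lp.aestronglyMeasurable _))
    (hu.integrable_mul (Lp.memLp f)).norm (fun n => ?_) ?_
  · filter_upwards [coeFn_truncation hω f n] with k hk
    rw [hk, norm_mul, norm_mul]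
    gcongr
    exact norm_indicator_le_norm_self _ _
  · have h1 : ∀ᵐ k, ∀ n : ℕ, truncation hω f n k = ({k | |ω k| ≤ n}).indicator f k :=
      ae_all_iff.2 fun n => coeFn_truncation hω f n
    filter_upwards [h1] with k hk
    refine tendsto_const_nhds.congr' ?_
    obtain ⟨n₀, hn₀⟩ := exists_nat_ge |ω k|
    filter_upwards [eventually_ge_atTop n₀] with n hn
    rw [hk, Set.indicator_of_mem]
    exact hn₀.trans (by exact_mod_cast hn)

/-- Weak convergence of the truncations is all that `duhamel` needs. By Riesz representation it is
dominated convergence for an integral. -/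
theorem tendsto_clm_truncation (hω : Measurable ω) (ℓ : Lp ℂ 2 (volume : Measure ℝ) →L[ℂ] ℂ)
    (f : Lp ℂ 2 (volume : Measure ℝ)) :
    Tendsto (fun n => ℓ (truncation hω f n)) atTop (𝓝 (ℓ f)) := by
  obtain ⟨w, rfl⟩ := (InnerProductSpace.toDual ℂ (Lp ℂ 2 (volume : Measure ℝ))).surjective ℓ
  simp only [InnerProductSpace.toDual_apply_apply, L2.inner_def, RCLike.inner_apply]
  have h := tendsto_integral_mul_truncation hω (u := fun k => conj (w k)) (Lp.memLp w).star f
  simpa only [mul_comm] using h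

end phases

section dynamics

variable {N : ℕ} {ω : ℝ → ℝ} {g : ℝ → ℂ} {HS : Matrix (Fin N) (Fin N) ℂ} {c : ℝ}
  {U : ℝ → TotalSpace N ≃ₗᵢ[ℂ] TotalSpace N}

theorem continuous_integral_phase (hω : Measurable ω) {u : ℝ → ℂ} (hu : Integrable u) :
    Continuous fun s : ℝ => ∫ k, Complex.exp (-Complex.I * ω k * s) * u k := by
  refine continuous_of_dominated (bound := fun k => ‖u k‖) (fun s => ?_) (fun s => ?_) hu.norm ?_
  · exact AEStronglyMeasurable.mul (Measurable.aestronglyMeasurable (by fun_prop))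
      hu.aestronglyMeasurable
  · exact Eventually.of_forall fun k => by rw [norm_mul, norm_phase, one_mul]
  · exact Eventually.of_forall fun k => by fun_prop

theorem norm_integral_phase_le {u : ℝ → ℂ} (s : ℝ) :
    ‖∫ k, Complex.exp (-Complex.I * ω k * s) * u k‖ ≤ ∫ k, ‖u k‖ := by
  refine (norm_integral_le_integral_norm _).trans (le_of_eq ?_)
  simp_rw [norm_mul, norm_phase, one_mul]

/-- The evolution of one-boson states, seen by a functional which vanishes on these states. -/
theorem duhamel_of_bounded (hω : Measurable ω) (hg : MemLp g 2 volume)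
    (hU : IsUnitaryGroup (HamiltonianGraph ω g HS c) U) {ζ : TotalSpace N}
    (hζ : ∀ j f, inner ℂ ζ (oneBoson j f) = 0) (i : Fin N)
    {f : Lp ℂ 2 (volume : Measure ℝ)} {M : ℝ} (hM : ∀ᵐ k, |ω k| ≤ M ∨ f k = 0) (t : ℝ) :
    inner ℂ ζ (U t (oneBoson i f)) = -Complex.I * c *
      ∫ s in (0 : ℝ)..t, (∫ k, Complex.exp (-Complex.I * ω k * s) * (g k * f k)) *
        inner ℂ ζ (U (t - s) (ket (Sum.inr i) (vacuum N))) := by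
  have hgf : Integrable fun k => g k * f k := hg.integrable_mul (Lp.memLp f)
  -- Interpolation between `U_t` applied to the boson (`s = 0`) and the freely evolved boson (`s =
  -- t`): the field energy cancels and only absorption by level `i` remains. At `s = t` the value is
  -- zero by `hζ`.
  have hd : ∀ s : ℝ, HasDerivAt (fun s : ℝ => inner ℂ ζ (U (t - s) (oneBoson i (phase hω f s))))
      (Complex.I * c * ((∫ k, Complex.exp (-Complex.I * ω k * s) * (g k * f k)) *
        inner ℂ ζ (U (t - s) (ket (Sum.inr i) (vacuum N))))) s := by
    intro s
    have h1 : HasDerivAt (fun s => oneBoson i (phase hω f s)) _ s :=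
      ((oneBoson i).restrictScalars ℝ).hasFDerivAt.comp_hasDerivAt s (hasDerivAt_phase hω hM s)
    have h2 := hU.hasDerivAt_apply_curve (t := t) h1 (graph_oneBoson i
      (memLp_mul_of_bounded hω (phase hω f s) (phase_bounded hω hM s)).coeFn_toLp)
    have h3 := ((innerSL ℂ ζ).restrictScalars ℝ).hasFDerivAt.comp_hasDerivAt s h2
    convert! h3 using 1
    have h4 : (∫ k, g k * phase hω f s k)
        = ∫ k, Complex.exp (-Complex.I * ω k * s) * (g k * f k) := by
      refine integral_congr_ae ?_
      filter_upwards [coeFn_phase hω f s] with k hk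
      rw [hk]; ring
    simp only [ContinuousLinearMap.coe_restrictScalars', innerSL_apply_apply, map_smul, smul_add,
      neg_smul, map_neg, h4]
    rw [neg_add_cancel_left, LinearIsometryEquiv.map_smul, LinearIsometryEquiv.map_smul,
      inner_smul_right, inner_smul_right]
    ring
  have hcont : Continuous fun s : ℝ => Complex.I * c *
      ((∫ k, Complex.exp (-Complex.I * ω k * s) * (g k * f k)) *
        inner ℂ ζ (U (t - s) (ket (Sum.inr i) (vacuum N)))) := by
    have h1 := continuous_integral_phase hω hgf
    have h2 : Continuous fun s => U (t - s) (ket (Sum.inr i) (vacuum N)) :=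
      (hU.continuous _).comp (continuous_const.sub continuous_id)
    exact continuous_const.mul (h1.mul (continuous_const.inner h2))
  have hint := intervalIntegral.integral_eq_sub_of_hasDerivAt (a := 0) (b := t)
    (fun s _ => hd s) (hcont.intervalIntegrable _ _)
  rw [sub_self, hU.zero, hζ, zero_sub, sub_zero, phase_zero,
    intervalIntegral.integral_const_mul] at hint
  linear_combination hint

/-- For unbounded `ω` a one-boson state need not lie in the domain, so the formula is obtained from
truncated momenta by passing to the limit on both sides. -/
theorem duhamel (hω : Measurable ω) (hg : MemLp g 2 volume)
    (hU : IsUnitaryGroup (HamiltonianGraph ω g HS c) U) {ζ : TotalSpace N}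
    (hζ : ∀ j f, inner ℂ ζ (oneBoson j f) = 0) (i : Fin N)
    (f : Lp ℂ 2 (volume : Measure ℝ)) (t : ℝ) :
    inner ℂ ζ (U t (oneBoson i f)) = -Complex.I * c *
      ∫ s in (0 : ℝ)..t, (∫ k, Complex.exp (-Complex.I * ω k * s) * (g k * f k)) *
        inner ℂ ζ (U (t - s) (ket (Sum.inr i) (vacuum N))) := by
  set ℓ : Lp ℂ 2 (volume : Measure ℝ) →L[ℂ] ℂ := innerSL ℂ ζ ∘L
    ((U t).toContinuousLinearEquiv : TotalSpace N →L[ℂ] TotalSpace N) ∘L oneBoson i with hℓ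
  have h1 := tendsto_clm_truncation hω ℓ f
  have h2 : ∀ n, ℓ (truncation hω f n) = _ :=
    fun n => duhamel_of_bounded hω hg hU hζ i (truncation_bounded hω f n) t
  simp_rw [h2] at h1
  refine tendsto_nhds_unique h1 (Tendsto.const_mul _ ?_)
  have hcU : Continuous fun s => U (t - s) (ket (Sum.inr i) (vacuum N)) :=
    (hU.continuous _).comp (continuous_const.sub continuous_id)
  have hgf : ∀ f : Lp ℂ 2 (volume : Measure ℝ), Integrable fun k => g k * f k :=
    fun f => hg.integrable_mul (Lp.memLp f)
  refine intervalIntegral.tendsto_integral_filter_of_dominated_convergence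
    (fun _ => (∫ k, ‖g k * f k‖) * (‖ζ‖ * ‖ket (Sum.inr i) (vacuum N)‖)) ?_ ?_
    intervalIntegrable_const ?_
  · refine Eventually.of_forall fun n => Continuous.aestronglyMeasurable ?_
    exact (continuous_integral_phase hω (hgf _)).mul (continuous_const.inner hcU)
  · refine Eventually.of_forall fun n => Eventually.of_forall fun s _ => ?_
    rw [norm_mul]
    have h3 : ‖inner ℂ ζ (U (t - s) (ket (Sum.inr i) (vacuum N)))‖
        ≤ ‖ζ‖ * ‖ket (Sum.inr i) (vacuum N)‖ :=
      (norm_inner_le_norm _ _).trans (by rw [LinearIsometryEquiv.norm_map])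
    have h4 : ∫ k, ‖g k * truncation hω f n k‖ ≤ ∫ k, ‖g k * f k‖ := by
      refine integral_mono_ae (hgf _).norm (hgf _).norm ?_
      filter_upwards [coeFn_truncation hω f n] with k hk
      rw [hk, norm_mul, norm_mul]
      gcongr
      exact norm_indicator_le_norm_self _ _
    exact mul_le_mul ((norm_integral_phase_le s).trans h4) h3 (norm_nonneg _)
      (integral_nonneg fun _ => norm_nonneg _)
  · refine Eventually.of_forall fun s _ => Tendsto.mul_const _ ?_
    have hu : MemLp (fun k : ℝ => Complex.exp (-Complex.I * ω k * s) * g k) 2 volume := by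
      refine hg.of_le (AEStronglyMeasurable.mul
        (Measurable.aestronglyMeasurable (by fun_prop)) hg.aestronglyMeasurable) ?_
      exact Eventually.of_forall fun k => by rw [norm_mul, norm_phase, one_mul]
    simpa only [mul_assoc] using tendsto_integral_mul_truncation hω hu f

/-- The amplitudes of an eigenvector of the system Hamiltonian solve a Volterra equation. -/
theorem hasDerivAt_amplitude (hω : Measurable ω) (hg : MemLp g 2 volume)
    (hU : IsUnitaryGroup (HamiltonianGraph ω g HS c) U) {ζ : TotalSpace N}
    (hζ : ∀ j f, inner ℂ ζ (oneBoson j f) = 0) {q : Fin N → ℂ} {κ : ℂ} (hq : HS *ᵥ q = κ • q)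
    (t : ℝ) :
    HasDerivAt (fun t => inner ℂ ζ (U t (excited q)))
      (-Complex.I * κ * inner ℂ ζ (U t (excited q)) - ((c ^ 2 : ℝ) : ℂ) *
        ∫ s in (0 : ℝ)..t, corr ω g s * inner ℂ ζ (U (t - s) (excited q))) t := by
  have hgs : MemLp (fun k => conj (g k)) 2 volume := hg.star
  set f : Lp ℂ 2 (volume : Measure ℝ) := hgs.toLp _ with hf
  have hfc : f =ᵐ[volume] fun k => conj (g k) := hgs.coeFn_toLp
  have h1 := hU.hasDerivAt (graph_excited q hfc) t
  have h2 := ((innerSL ℂ ζ).restrictScalars ℝ).hasFDerivAt.comp_hasDerivAt t h1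
  convert! h2 using 1
  -- The emitted boson has wave function `g^*`; reabsorption contributes `g`, and the product is the
  -- kernel of `corr`.
  have hcorr : ∀ s : ℝ, (∫ k, Complex.exp (-Complex.I * ω k * s) * (g k * f k)) = corr ω g s := by
    intro s
    refine integral_congr_ae ?_
    filter_upwards [hfc] with k hk
    rw [hk, RCLike.mul_conj]
    push_cast
    rw [mul_comm]; rfl
  have hsmul : excited (HS *ᵥ q) = κ • excited q := by
    simp [hq, excited, Finset.smul_sum, smul_smul]
  -- A boson emitted by level `l` can only be reabsorbed by level `l`, with a kernel independent of
  -- `l`. Hence the equation closes on `excited q`.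
  have hb : ∀ l, inner ℂ ζ (U t (oneBoson l f)) = -Complex.I * c *
      ∫ s in (0 : ℝ)..t, corr ω g s * inner ℂ ζ (U (t - s) (ket (Sum.inr l) (vacuum N))) := by
    intro l
    rw [duhamel hω hg hU hζ l f t]
    simp_rw [hcorr]
  have hcont : ∀ l, Continuous fun s => corr ω g s *
      inner ℂ ζ (U (t - s) (ket (Sum.inr l) (vacuum N))) := fun l =>
    (continuous_corr hω hg).mul (continuous_const.inner
      ((hU.continuous _).comp (continuous_const.sub continuous_id)))
  have hsum : (∫ s in (0 : ℝ)..t, corr ω g s * inner ℂ ζ (U (t - s) (excited q)))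
      = ∑ l, q l * ∫ s in (0 : ℝ)..t,
          corr ω g s * inner ℂ ζ (U (t - s) (ket (Sum.inr l) (vacuum N))) := by
    simp_rw [← intervalIntegral.integral_const_mul]
    rw [← intervalIntegral.integral_finsetSum fun l _ =>
      ((hcont l).const_mul (q l)).intervalIntegrable _ _]
    refine intervalIntegral.integral_congr fun s _ => ?_
    simp only [excited, map_sum, LinearIsometryEquiv.map_smul, inner_sum, inner_smul_right,
      Finset.mul_sum]
    exact Finset.sum_congr rfl fun l _ => by ring
  rw [hsum]
  simp only [ContinuousLinearMap.coe_restrictScalars', innerSL_apply_apply, hsmul, smul_add,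
    map_add, LinearIsometryEquiv.map_smul, inner_smul_right, map_sum, inner_sum,
    hb, Finset.mul_sum]
  rw [sub_eq_add_neg, ← Finset.sum_neg_distrib]
  congr 1
  · ring
  · refine Finset.sum_congr rfl fun l _ => ?_
    push_cast
    linear_combination (-(c : ℂ) ^ 2 * q l * (∫ s in (0 : ℝ)..t,
      corr ω g s * inner ℂ ζ (U (t - s) (ket (Sum.inr l) (vacuum N))))) * Complex.I_sq

end dynamics

/-! ### The reduced density matrix -/

section reduced

variable {N : ℕ}

/-- `∑ᵢ qᵢ |i⟩ ⊗ Ω` as a linear function of `q`. -/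
noncomputable def excitedₗ : EuclideanSpace ℂ (Fin N) →ₗ[ℂ] TotalSpace N where
  toFun q := excited q.ofLp
  map_add' q q' := by simp [excited, add_smul, Finset.sum_add_distrib]
  map_smul' c q := by simp [excited, Finset.smul_sum, smul_smul]

theorem component_excited_inr (q : Fin N → ℂ) (j : Fin N) :
    (excited q).component (Sum.inr j) = q j • vacuum N := by
  rw [excited, TotalSpace.component_sum, Finset.sum_eq_single j]
  · simp
  · intro b _ hb
    rw [TotalSpace.component_smul, component_ket_ne (by simpa using hb.symm), smul_zero]
  · simp

theorem component_excited_inl (q : Fin N → ℂ) (u : Unit) :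
    (excited q).component (Sum.inl u) = 0 := by
  rw [excited, TotalSpace.component_sum]
  refine Finset.sum_eq_zero fun b _ => ?_
  rw [TotalSpace.component_smul, component_ket_ne (by simp), smul_zero]

theorem excited_single (l : Fin N) :
    excited (Pi.single l 1) = ket (Sum.inr l) (vacuum N) := by
  simp [excited, Pi.single_apply]

theorem inner_excited_excited (q q' : Fin N → ℂ) :
    inner ℂ (excited q) (excited q') = star q ⬝ᵥ q' := by
  simp only [inner_eq_sum_component, Fintype.sum_sum_type, component_excited_inl,
    component_excited_inr, inner_smul_left, inner_smul_right, inner_vacuum_vacuum, dotProduct]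
  simp [mul_comm]

theorem inner_excited_oneBoson (q : Fin N → ℂ) (j : Fin N) (f : Lp ℂ 2 (volume : Measure ℝ)) :
    inner ℂ (excited q) (oneBoson j f) = 0 := by
  simp [inner_eq_sum_component, Fintype.sum_sum_type, component_excited_inl, oneBoson_component_inr]

/-- The amplitudes `⟨i, Ω| e^{iH₀t} e^{-iHt} |j, Ω⟩`. -/
noncomputable def amplitude (U₀ U : ℝ → TotalSpace N ≃ₗᵢ[ℂ] TotalSpace N) (t : ℝ) :
    Matrix (Fin N) (Fin N) ℂ :=
  Matrix.of fun i j => inner ℂ (ket (Sum.inr i) (vacuum N))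
    ((U₀ t).symm (U t (ket (Sum.inr j) (vacuum N))))

/-- Parseval's identity in the Fock space carries out the partial trace, so the result does not
depend on the chosen basis. -/
theorem reducedState_apply (U₀ U : ℝ → TotalSpace N ≃ₗᵢ[ℂ] TotalSpace N)
    (ρ : Matrix (Level N) (Level N) ℂ) (t : ℝ) (s s' : Level N) :
    reducedState U₀ U ρ t s s' = ∑ a, ∑ b, ρ a b *
      inner ℂ (((U₀ t).symm (U t (ket b (vacuum N)))).component s')
        (((U₀ t).symm (U t (ket a (vacuum N)))).component s) := by
  have h1 : ∀ e : Fock N, inner ℂ (ket s e) ((toOp (U₀ t).symm ∘L toOp (U t) ∘L initialState ρ ∘L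
      toOp (U t).symm ∘L toOp (U₀ t)) (ket s' e)) = ∑ a, ∑ b, ρ a b *
        (inner ℂ (((U₀ t).symm (U t (ket b (vacuum N)))).component s') e *
          inner ℂ e (((U₀ t).symm (U t (ket a (vacuum N)))).component s)) := by
    intro e
    have h2 : ∀ b : Level N, inner ℂ (ket b (vacuum N)) ((U t).symm (U₀ t (ket s' e)))
        = inner ℂ (((U₀ t).symm (U t (ket b (vacuum N)))).component s') e := by
      intro b
      rw [← inner_ket_right, ← (U t).inner_map_map, LinearIsometryEquiv.apply_symm_apply,
        ← (U₀ t).inner_map_map _ (ket s' e), LinearIsometryEquiv.apply_symm_apply]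
    have h3 : initialState ρ ((U t).symm (U₀ t (ket s' e))) = ∑ a, ∑ b, ρ a b •
        (inner ℂ (((U₀ t).symm (U t (ket b (vacuum N)))).component s') e • ket a (vacuum N)) := by
      simp only [initialState, _root_.sum_apply, _root_.smul_apply,
        InnerProductSpace.rankOne_apply, h2]
    change inner ℂ (ket s e) ((U₀ t).symm (U t (initialState ρ ((U t).symm (U₀ t (ket s' e)))))) = _
    rw [h3]
    simp only [map_sum, LinearIsometryEquiv.map_smul, inner_sum, inner_smul_right, inner_ket_left]
  simp only [reducedState, partialTrace, Matrix.of_apply]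
  refine HasSum.tsum_eq ?_
  simp only [h1]
  refine hasSum_sum fun a _ => hasSum_sum fun b _ => HasSum.mul_left _ ?_
  exact (fockBasis N).hasSum_inner_mul_inner _ _

/-- The reduced density matrix for a decomposition of the evolved states. -/
theorem sum_inner_eq_renormMatrix (ρ : Matrix (Level N) (Level N) ℂ)
    (V : Matrix (Fin N) (Fin N) ℂ) (X : Level N → Level N → Fock N)
    (h00 : X (Sum.inl ()) (Sum.inl ()) = vacuum N)
    (h01 : ∀ j, X (Sum.inl ()) (Sum.inr j) = 0)
    (h11 : ∀ l j, X (Sum.inr l) (Sum.inr j) = V j l • vacuum N)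
    (h10 : ∀ l, inner ℂ (vacuum N) (X (Sum.inr l) (Sum.inl ())) = 0)
    (h : ∀ b a, inner ℂ (X (Sum.inr b) (Sum.inl ())) (X (Sum.inr a) (Sum.inl ()))
      = (if b = a then 1 else 0) - ∑ j, conj (V j b) * V j a) (s s' : Level N) :
    ∑ a, ∑ b, ρ a b * inner ℂ (X b s') (X a s) = renormMatrix V ρ s s' := by
  have h10' : ∀ l, inner ℂ (X (Sum.inr l) (Sum.inl ())) (vacuum N) = 0 := fun l => by
    rw [← inner_conj_symm, h10, map_zero]
  rcases s with ⟨⟩ | i <;> rcases s' with ⟨⟩ | j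
  · simp only [Fintype.sum_sum_type, Finset.univ_unique, Finset.sum_singleton,
      PUnit.default_eq_unit, h00, h10, h10', h, inner_vacuum_vacuum, renormMatrix,
      fromBlocks_apply₁₁, toBlocks₁₁, toBlocks₂₂, Matrix.add_apply, of_apply, trace, diag_apply,
      Matrix.sub_apply, Matrix.mul_apply, conjTranspose_apply, mul_zero, Finset.sum_const_zero,
      add_zero, zero_add, mul_one, mul_sub, Finset.sum_sub_distrib, mul_ite,
      Finset.sum_ite_eq', Finset.mem_univ, if_true, RCLike.star_def,
      Finset.sum_mul, Finset.mul_sum]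
    congr 2
    rw [Finset.sum_comm, Finset.sum_congr rfl fun b _ => Finset.sum_comm, Finset.sum_comm]
    exact Finset.sum_congr rfl fun i _ => Finset.sum_congr rfl fun b _ =>
      Finset.sum_congr rfl fun a _ => by ring
  · simp only [Fintype.sum_sum_type, Finset.univ_unique, Finset.sum_singleton,
      PUnit.default_eq_unit, h00, h01, h11, h10, inner_vacuum_vacuum, renormMatrix,
      fromBlocks_apply₁₂, toBlocks₁₂, of_apply, Matrix.mul_apply, conjTranspose_apply,
      inner_smul_left, inner_zero_left, RCLike.star_def, mul_zero, Finset.sum_const_zero,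
      add_zero, zero_add, mul_one]
  · simp only [Fintype.sum_sum_type, Finset.univ_unique, Finset.sum_singleton,
      PUnit.default_eq_unit, h00, h01, h11, h10', inner_vacuum_vacuum, renormMatrix,
      fromBlocks_apply₂₁, toBlocks₂₁, of_apply, Matrix.mul_apply,
      inner_smul_right, inner_zero_right, mul_zero, Finset.sum_const_zero,
      add_zero, zero_add, mul_one]
    exact Finset.sum_congr rfl fun _ _ => mul_comm _ _
  · simp only [Fintype.sum_sum_type, Finset.univ_unique, Finset.sum_singleton,
      PUnit.default_eq_unit, h01, h11, inner_vacuum_vacuum, renormMatrix,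
      fromBlocks_apply₂₂, toBlocks₂₂, of_apply, Matrix.mul_apply, conjTranspose_apply,
      inner_smul_left, inner_smul_right, inner_zero_left, inner_zero_right, RCLike.star_def,
      mul_zero, Finset.sum_const_zero, zero_add, mul_one, Finset.sum_mul]
    rw [Finset.sum_comm]
    exact Finset.sum_congr rfl fun b _ => Finset.sum_congr rfl fun a _ => by ring

variable {ω : ℝ → ℝ} {g : ℝ → ℂ} {HS : Matrix (Fin N) (Fin N) ℂ} {c : ℝ}
  {U₀ U : ℝ → TotalSpace N ≃ₗᵢ[ℂ] TotalSpace N}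

/-- The amplitude equation is scalar only for eigenvectors of the system Hamiltonian; these span. -/
theorem eq_zero_of_eigenvectors (hHS : HS.IsHermitian) (ℓ : TotalSpace N →ₗ[ℂ] ℂ)
    (h : ∀ (q : Fin N → ℂ) (κ : ℝ), HS *ᵥ q = (κ : ℂ) • q → ℓ (excited q) = 0) (q : Fin N → ℂ) :
    ℓ (excited q) = 0 := by
  have h1 : ℓ ∘ₗ excitedₗ = 0 := by
    refine hHS.eigenvectorBasis.toBasis.ext fun α => ?_
    simp only [OrthonormalBasis.coe_toBasis, LinearMap.comp_apply, LinearMap.zero_apply]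
    refine h _ (hHS.eigenvalues α) ?_
    have := hHS.mulVec_eigenvectorBasis α
    simpa using this
  exact LinearMap.congr_fun h1 (WithLp.toLp 2 q)

theorem free_apply_ground (hU : IsUnitaryGroup (HamiltonianGraph ω g HS c) U) (t : ℝ) :
    U t (ket (Sum.inl ()) (vacuum N)) = ket (Sum.inl ()) (vacuum N) := by
  have h1 := hU.apply_eigenvector (ψ := ket (Sum.inl ()) (vacuum N)) (κ := 0)
    (by rw [zero_smul]; exact graph_ground) t
  simpa using h1

theorem free_apply_excited (hg : MemLp g 2 volume)
    (hU₀ : IsUnitaryGroup (HamiltonianGraph ω g HS 0) U₀) {q : Fin N → ℂ} {κ : ℂ}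
    (hq : HS *ᵥ q = κ • q) (t : ℝ) :
    U₀ t (excited q) = Complex.exp (-Complex.I * κ * t) • excited q := by
  refine hU₀.apply_eigenvector ?_ t
  have hgs : MemLp (fun k => conj (g k)) 2 volume := hg.star
  have h1 := graph_excited (ω := ω) (HS := HS) (c := 0) q hgs.coeFn_toLp
  have hsmul : excited (HS *ᵥ q) = κ • excited q := by
    simp [hq, excited, Finset.smul_sum, smul_smul]
  rw [hsmul] at h1
  simpa using h1

/-- Invariance of the one-excitation sector, proved by duality: a functional vanishing on the sector
yields an amplitude solving the Volterra equation with initial value zero. -/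
theorem inner_evolved_eq_zero (hω : Measurable ω) (hg : MemLp g 2 volume)
    (hHS : HS.IsHermitian) (hU : IsUnitaryGroup (HamiltonianGraph ω g HS c) U) {ζ : TotalSpace N}
    (hζ : ∀ j f, inner ℂ ζ (oneBoson j f) = 0) (hζ' : ∀ q, inner ℂ ζ (excited q) = 0)
    {t : ℝ} (ht : 0 < t) (q : Fin N → ℂ) : inner ℂ ζ (U t (excited q)) = 0 := by
  refine eq_zero_of_eigenvectors hHS ((innerSL ℂ ζ).toLinearMap ∘ₗ
    (U t).toLinearEquiv.toLinearMap) (fun q κ hq => ?_) q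
  have hb : ∀ t, ‖inner ℂ ζ (U t (excited q))‖ ≤ ‖ζ‖ * ‖excited q‖ := fun t =>
    (norm_inner_le_norm _ _).trans (by rw [LinearIsometryEquiv.norm_map])
  have h0 : inner ℂ ζ (U 0 (excited q)) = 0 := by rw [hU.zero, hζ']
  exact volterra_eq_zero (x := fun t => inner ℂ ζ (U t (excited q))) (continuous_corr hω hg)
    norm_corr_le (continuous_const.inner (hU.continuous _)) hb (z := -Complex.I * κ) (ε := c ^ 2)
    (fun t _ => hasDerivAt_amplitude hω hg hU hζ hq t)
    (fun p hp => laplace_corr_re_nonneg hω hg hp) (by simp) (sq_nonneg c) h0 ht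

/-- For `φ ⊥ Ω` the vector `U₀(|j⟩ ⊗ φ)` is orthogonal to the sector, because the free evolution
preserves it. Hence an excited component can only be a multiple of the vacuum. -/
theorem component_evolved_inr (hω : Measurable ω) (hg : MemLp g 2 volume)
    (hHS : HS.IsHermitian) (hU₀ : IsUnitaryGroup (HamiltonianGraph ω g HS 0) U₀)
    (hU : IsUnitaryGroup (HamiltonianGraph ω g HS c) U) {t : ℝ} (ht : 0 < t) (l j : Fin N) :
    ((U₀ t).symm (U t (ket (Sum.inr l) (vacuum N)))).component (Sum.inr j)
      = amplitude U₀ U t j l • vacuum N := by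
  have hperp : ∀ φ : Fock N, inner ℂ φ (vacuum N) = 0 → inner ℂ φ
      (((U₀ t).symm (U t (ket (Sum.inr l) (vacuum N)))).component (Sum.inr j)) = 0 := by
    intro φ hφ
    rw [← inner_ket_left, ← (U₀ t).inner_map_map, LinearIsometryEquiv.apply_symm_apply,
      ← excited_single]
    refine inner_evolved_eq_zero hω hg hHS hU (fun i f => ?_) (fun q => ?_) ht _
    · rw [← hU₀.inner_neg_right, duhamel hω hg hU₀ (fun i f => ?_) i f]
      · simp
      · rw [inner_ket_left, oneBoson_component_inr, inner_zero_right]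
    · refine eq_zero_of_eigenvectors hHS (innerSL ℂ _).toLinearMap (fun q κ hq => ?_) q
      change inner ℂ (U₀ t (ket (Sum.inr j) φ)) (excited q) = 0
      rw [← hU₀.inner_neg_right, free_apply_excited hg hU₀ hq, inner_smul_right, inner_ket_left,
        component_excited_inr, inner_smul_right, hφ, mul_zero, mul_zero]
  set η := ((U₀ t).symm (U t (ket (Sum.inr l) (vacuum N)))).component (Sum.inr j) with hη
  have hamp : amplitude U₀ U t j l = inner ℂ (vacuum N) η := by
    rw [amplitude, Matrix.of_apply, inner_ket_left]
  have h1 : inner ℂ (η - amplitude U₀ U t j l • vacuum N) (vacuum N) = 0 := by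
    rw [inner_sub_left, inner_smul_left, inner_vacuum_vacuum, mul_one, hamp, inner_conj_symm,
      sub_self]
  have h2 := hperp _ h1
  refine sub_eq_zero.1 (inner_self_eq_zero (𝕜 := ℂ).1 ?_)
  -- The part of `η` orthogonal to the vacuum is orthogonal to itself.
  rw [inner_sub_right, h2, inner_smul_right, h1, mul_zero, sub_zero]

/-- The one-boson parts enter only through their inner products, which by unitarity are the entries
of `1 - V⁺V`. -/
theorem reducedState_eq_renormMatrix (hω : Measurable ω) (hg : MemLp g 2 volume)
    (hHS : HS.IsHermitian) (hU₀ : IsUnitaryGroup (HamiltonianGraph ω g HS 0) U₀)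
    (hU : IsUnitaryGroup (HamiltonianGraph ω g HS c) U) {t : ℝ} (ht : 0 < t)
    (ρ : Matrix (Level N) (Level N) ℂ) :
    reducedState U₀ U ρ t = renormMatrix (amplitude U₀ U t) ρ := by
  have hground : (U₀ t).symm (U t (ket (Sum.inl ()) (vacuum N)))
      = ket (Sum.inl ()) (vacuum N) := by
    rw [free_apply_ground hU, LinearIsometryEquiv.symm_apply_eq, free_apply_ground hU₀]
  -- `|0⟩Ω` is fixed by both evolutions, so orthogonality to it is preserved.
  have hinl : ∀ l, inner ℂ (vacuum N)
      (((U₀ t).symm (U t (ket (Sum.inr l) (vacuum N)))).component (Sum.inl ())) = 0 := by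
    intro l
    rw [← inner_ket_left, ← hground, LinearIsometryEquiv.inner_map_map,
      LinearIsometryEquiv.inner_map_map, inner_ket_ket, if_neg (by simp)]
  ext s s'
  rw [reducedState_apply]
  refine sum_inner_eq_renormMatrix ρ (amplitude U₀ U t)
    (fun a s => ((U₀ t).symm (U t (ket a (vacuum N)))).component s) ?_ ?_ ?_ hinl ?_ s s'
  · simp only [hground, component_ket_same]
  · intro j
    simp only [hground]
    exact component_ket_ne (by simp) _
  · intro l j
    exact component_evolved_inr hω hg hHS hU₀ hU ht l j
  · intro b a
    have h1 : inner ℂ ((U₀ t).symm (U t (ket (Sum.inr b) (vacuum N))))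
        ((U₀ t).symm (U t (ket (Sum.inr a) (vacuum N)))) = if b = a then 1 else 0 := by
      rw [LinearIsometryEquiv.inner_map_map, LinearIsometryEquiv.inner_map_map, inner_ket_ket,
        inner_vacuum_vacuum]
      simp
    rw [inner_eq_sum_component, Fintype.sum_sum_type] at h1
    simp only [component_evolved_inr hω hg hHS hU₀ hU ht, inner_smul_left, inner_smul_right,
      inner_vacuum_vacuum, mul_one, Finset.univ_unique, Finset.sum_singleton,
      PUnit.default_eq_unit] at h1
    simp only [mul_comm (conj _)]
    exact eq_sub_of_add_eq h1

end reduced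

/-! ### Functions of Hermitian matrices and their perturbation theory -/

section perturbation

open scoped Matrix.Norms.Operator

variable {N : ℕ}

theorem norm_entry_le (X : Matrix (Fin N) (Fin N) ℂ) (i j : Fin N) : ‖X i j‖ ≤ ‖X‖ := by
  rw [Matrix.linfty_opNorm_def]
  have h1 : ‖X i j‖₊ ≤ ∑ j, ‖X i j‖₊ :=
    Finset.single_le_sum (f := fun j => ‖X i j‖₊) (fun _ _ => zero_le) (Finset.mem_univ j)
  have h2 : ∑ j, ‖X i j‖₊ ≤ Finset.univ.sup fun i => ∑ j, ‖X i j‖₊ :=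
    Finset.le_sup (f := fun i => ∑ j, ‖X i j‖₊) (Finset.mem_univ i)
  exact_mod_cast h1.trans h2

theorem norm_le_of_entry_le {X : Matrix (Fin N) (Fin N) ℂ} {c : ℝ} (hc : 0 ≤ c)
    (h : ∀ i j, ‖X i j‖ ≤ c) : ‖X‖ ≤ N * c := by
  rw [Matrix.linfty_opNorm_def]
  lift c to NNReal using hc
  have : (Finset.univ.sup fun i => ∑ j, ‖X i j‖₊) ≤ N * c := by
    refine Finset.sup_le fun i _ => ?_
    calc ∑ j, ‖X i j‖₊ ≤ ∑ _j : Fin N, c := Finset.sum_le_sum fun j _ => by exact_mod_cast h i j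
      _ = N * c := by simp
  exact_mod_cast this

theorem norm_unitary_le (Q : unitaryGroup (Fin N) ℂ) : ‖(Q : Matrix (Fin N) (Fin N) ℂ)‖ ≤ N := by
  simpa using norm_le_of_entry_le zero_le_one (entry_norm_bound_of_unitary Q.2)

theorem norm_conjTranspose_unitary_le (Q : unitaryGroup (Fin N) ℂ) :
    ‖(Q : Matrix (Fin N) (Fin N) ℂ)ᴴ‖ ≤ N := norm_unitary_le (star Q)

theorem unitary_conjTranspose_mul (Q : unitaryGroup (Fin N) ℂ) :
    (Q : Matrix (Fin N) (Fin N) ℂ)ᴴ * Q = 1 := Unitary.coe_star_mul_self Q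

theorem unitary_mul_conjTranspose (Q : unitaryGroup (Fin N) ℂ) :
    (Q : Matrix (Fin N) (Fin N) ℂ) * (Q : Matrix (Fin N) (Fin N) ℂ)ᴴ = 1 :=
  Unitary.coe_mul_star_self Q

theorem norm_conj_unitary_entry_le (P Q : unitaryGroup (Fin N) ℂ)
    (X : Matrix (Fin N) (Fin N) ℂ) (i j : Fin N) :
    ‖((P : Matrix (Fin N) (Fin N) ℂ)ᴴ * X * Q) i j‖ ≤ N ^ 2 * ‖X‖ := by
  refine (norm_entry_le _ i j).trans ((norm_mul_le _ _).trans ?_)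
  calc ‖(P : Matrix (Fin N) (Fin N) ℂ)ᴴ * X‖ * ‖(Q : Matrix (Fin N) (Fin N) ℂ)‖
      ≤ (‖(P : Matrix (Fin N) (Fin N) ℂ)ᴴ‖ * ‖X‖) * ‖(Q : Matrix (Fin N) (Fin N) ℂ)‖ := by
        gcongr; exact norm_mul_le _ _
    _ ≤ (N * ‖X‖) * N := by
        gcongr
        · exact norm_conjTranspose_unitary_le P
        · exact norm_unitary_le Q
    _ = N ^ 2 * ‖X‖ := by ring

/-- This passes from matrix elements between two different eigenbases to the norm. The norm in use
is not unitarily invariant, whence the powers of `N`. -/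
theorem norm_le_of_conj_unitary_entry_le (P Q : unitaryGroup (Fin N) ℂ)
    {X : Matrix (Fin N) (Fin N) ℂ} {c : ℝ} (hc : 0 ≤ c)
    (h : ∀ i j, ‖((P : Matrix (Fin N) (Fin N) ℂ)ᴴ * X * Q) i j‖ ≤ c) : ‖X‖ ≤ N ^ 3 * c := by
  set Y := (P : Matrix (Fin N) (Fin N) ℂ)ᴴ * X * Q with hY
  have hX : X = P * Y * (Q : Matrix (Fin N) (Fin N) ℂ)ᴴ := by
    rw [hY]
    calc X = 1 * X * 1 := by simp
      _ = ((P : Matrix (Fin N) (Fin N) ℂ) * (P : Matrix (Fin N) (Fin N) ℂ)ᴴ) * X *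
          ((Q : Matrix (Fin N) (Fin N) ℂ) * (Q : Matrix (Fin N) (Fin N) ℂ)ᴴ) := by
        rw [unitary_mul_conjTranspose, unitary_mul_conjTranspose]
      _ = _ := by simp only [Matrix.mul_assoc]
  rw [hX]
  calc ‖P * Y * (Q : Matrix (Fin N) (Fin N) ℂ)ᴴ‖
      ≤ (‖(P : Matrix (Fin N) (Fin N) ℂ)‖ * ‖Y‖) * ‖(Q : Matrix (Fin N) (Fin N) ℂ)ᴴ‖ :=
        (norm_mul_le _ _).trans (by gcongr; exact norm_mul_le _ _)
    _ ≤ (N * (N * c)) * N := by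
        gcongr
        · exact norm_unitary_le P
        · exact norm_le_of_entry_le hc h
        · exact norm_conjTranspose_unitary_le Q
    _ = N ^ 3 * c := by ring

variable {A : Matrix (Fin N) (Fin N) ℂ} (hA : A.IsHermitian)
  {K : Matrix (Fin N) (Fin N) ℂ} (hK : K.IsHermitian)

/-- `f(A) = ∑_E f(E) Π_E`. -/
noncomputable def hermFun (f : ℝ → ℂ) : Matrix (Fin N) (Fin N) ℂ :=
  (hA.eigenvectorUnitary : Matrix (Fin N) (Fin N) ℂ) *
    Matrix.diagonal (fun α => f (hA.eigenvalues α)) *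
    (hA.eigenvectorUnitary : Matrix (Fin N) (Fin N) ℂ)ᴴ

/-- `∑_{E,E'} d(E,E') Π_E B Π_{E'}`. -/
noncomputable def hermOrdered (d : ℝ → ℝ → ℂ) (B : Matrix (Fin N) (Fin N) ℂ) :
    Matrix (Fin N) (Fin N) ℂ :=
  (hA.eigenvectorUnitary : Matrix (Fin N) (Fin N) ℂ) *
    Matrix.of (fun α β => d (hA.eigenvalues α) (hA.eigenvalues β) *
      ((hA.eigenvectorUnitary : Matrix (Fin N) (Fin N) ℂ)ᴴ * B *
        (hA.eigenvectorUnitary : Matrix (Fin N) (Fin N) ℂ)) α β) *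
    (hA.eigenvectorUnitary : Matrix (Fin N) (Fin N) ℂ)ᴴ

theorem hermFun_mul (f g : ℝ → ℂ) :
    hermFun hA f * hermFun hA g = hermFun hA (fun x => f x * g x) := by
  unfold hermFun
  have h := unitary_conjTranspose_mul hA.eigenvectorUnitary
  set Q := (hA.eigenvectorUnitary : Matrix (Fin N) (Fin N) ℂ)
  calc _ = Q * diagonal (fun α => f (hA.eigenvalues α)) * (Qᴴ * Q) *
        diagonal (fun α => g (hA.eigenvalues α)) * Qᴴ := by simp only [Matrix.mul_assoc]
    _ = _ := by rw [h, Matrix.mul_one, Matrix.mul_assoc Q, diagonal_mul_diagonal]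

theorem hermFun_add (f g : ℝ → ℂ) :
    hermFun hA (fun x => f x + g x) = hermFun hA f + hermFun hA g := by
  unfold hermFun
  rw [← Matrix.add_mul, ← Matrix.mul_add, diagonal_add]

theorem hermFun_smul (c : ℂ) (f : ℝ → ℂ) :
    hermFun hA (fun x => c * f x) = c • hermFun hA f := by
  unfold hermFun
  rw [← Matrix.smul_mul, ← Matrix.mul_smul, ← diagonal_smul]
  rfl

theorem hermFun_one : hermFun hA (fun _ => 1) = 1 := by
  unfold hermFun
  rw [diagonal_one, Matrix.mul_one, unitary_mul_conjTranspose]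

theorem hermFun_ofReal : hermFun hA (fun x => (x : ℂ)) = A := by
  conv_rhs => rw [hA.spectral_theorem, Unitary.conjStarAlgAut_apply]
  rfl

theorem exp_hermFun (f : ℝ → ℂ) :
    NormedSpace.exp (hermFun hA f) = hermFun hA fun x => Complex.exp (f x) := by
  unfold hermFun
  have h := unitary_conjTranspose_mul hA.eigenvectorUnitary
  have h' := unitary_mul_conjTranspose hA.eigenvectorUnitary
  set Q := (hA.eigenvectorUnitary : Matrix (Fin N) (Fin N) ℂ)
  have := Matrix.exp_units_conj ⟨Q, Qᴴ, h', h⟩ (diagonal fun α => f (hA.eigenvalues α))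
  simp only [Units.val_mk, Units.inv_mk] at this
  rw [this, Matrix.exp_diagonal]
  congr 3
  ext α
  rw [Pi.coe_exp, Complex.exp_eq_exp_ℂ]

theorem funAt_eq_hermFun (F : ℂ → ℂ) : funAt hA F = hermFun hA fun E => F (-Complex.I * E) := by
  unfold funAt hermFun eigProj eigSet
  set Q := (hA.eigenvectorUnitary : Matrix (Fin N) (Fin N) ℂ)
  have h : ∀ D : Matrix (Fin N) (Fin N) ℂ, ∀ c : ℂ, c • (Q * D * Qᴴ) = Q * (c • D) * Qᴴ := by
    intro D c
    rw [Matrix.mul_smul, Matrix.smul_mul]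
  simp_rw [h, ← Matrix.sum_mul, ← Matrix.mul_sum]
  congr 2
  ext α β
  rw [Matrix.sum_apply]
  by_cases h : α = β
  · subst h
    simp [Finset.sum_ite_eq]
  · simp [h]

theorem orderedFun_eq_hermOrdered (F : ℂ → ℂ → ℂ) (B : Matrix (Fin N) (Fin N) ℂ) :
    orderedFun hA F B
      = hermOrdered hA (fun E E' => F (-Complex.I * E) (-Complex.I * E')) B := by
  unfold orderedFun hermOrdered eigProj eigSet
  set Q := (hA.eigenvectorUnitary : Matrix (Fin N) (Fin N) ℂ)
  have h : ∀ D D' : Matrix (Fin N) (Fin N) ℂ, ∀ c : ℂ,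
      c • (Q * D * Qᴴ * B * (Q * D' * Qᴴ)) = Q * (c • (D * (Qᴴ * B * Q) * D')) * Qᴴ := by
    intro D D' c
    rw [Matrix.mul_smul, Matrix.smul_mul]
    simp only [Matrix.mul_assoc]
  simp_rw [h, ← Matrix.sum_mul, ← Matrix.mul_sum]
  congr 2
  ext α β
  simp_rw [Matrix.sum_apply, Matrix.smul_apply, Matrix.mul_diagonal, Matrix.diagonal_mul]
  simp [Finset.sum_ite_eq]

/-- Between an eigenvector of `A` on the left and one of `K` on the right, both functions become
numbers. The mixed basis avoids any perturbation theory of eigenvectors. -/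
theorem conj_hermFun_sub_apply (f : ℝ → ℂ) (α β : Fin N) :
    ((hA.eigenvectorUnitary : Matrix (Fin N) (Fin N) ℂ)ᴴ * (hermFun hK f - hermFun hA f) *
        hK.eigenvectorUnitary) α β
      = (f (hK.eigenvalues β) - f (hA.eigenvalues α)) *
        ((hA.eigenvectorUnitary : Matrix (Fin N) (Fin N) ℂ)ᴴ * hK.eigenvectorUnitary) α β := by
  unfold hermFun
  have h := unitary_conjTranspose_mul hA.eigenvectorUnitary
  have h' := unitary_conjTranspose_mul hK.eigenvectorUnitary
  set P := (hA.eigenvectorUnitary : Matrix (Fin N) (Fin N) ℂ)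
  set Q := (hK.eigenvectorUnitary : Matrix (Fin N) (Fin N) ℂ)
  set D := diagonal (fun α => f (hA.eigenvalues α))
  set D' := diagonal (fun α => f (hK.eigenvalues α))
  have e : Pᴴ * (Q * D' * Qᴴ - P * D * Pᴴ) * Q = Pᴴ * Q * D' - D * (Pᴴ * Q) := by
    calc _ = Pᴴ * Q * D' * (Qᴴ * Q) - (Pᴴ * P) * D * (Pᴴ * Q) := by noncomm_ring
      _ = _ := by rw [h, h']; simp
  rw [e, Matrix.sub_apply, Matrix.mul_diagonal, Matrix.diagonal_mul]
  ring

theorem conj_sub_apply (α β : Fin N) :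
    ((hA.eigenvectorUnitary : Matrix (Fin N) (Fin N) ℂ)ᴴ * (K - A) * hK.eigenvectorUnitary) α β
      = ((hK.eigenvalues β : ℂ) - hA.eigenvalues α) *
        ((hA.eigenvectorUnitary : Matrix (Fin N) (Fin N) ℂ)ᴴ * hK.eigenvectorUnitary) α β := by
  rw [← conj_hermFun_sub_apply hA hK (fun x => (x : ℂ)), hermFun_ofReal, hermFun_ofReal]

/-- A Lipschitz function of a Hermitian matrix is Lipschitz continuous. -/
theorem norm_hermFun_sub_le {f : ℝ → ℂ} {C : ℝ} (hC : 0 ≤ C)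
    (hf : ∀ α β, ‖f (hK.eigenvalues β) - f (hA.eigenvalues α)‖
      ≤ C * |hK.eigenvalues β - hA.eigenvalues α|) :
    ‖hermFun hK f - hermFun hA f‖ ≤ N ^ 5 * C * ‖K - A‖ := by
  have h := norm_le_of_conj_unitary_entry_le hA.eigenvectorUnitary hK.eigenvectorUnitary
    (X := hermFun hK f - hermFun hA f) (c := C * (N ^ 2 * ‖K - A‖)) (by positivity)
    (fun α β => ?_)
  · calc _ ≤ _ := h
      _ = _ := by ring
  · rw [conj_hermFun_sub_apply, norm_mul]
    calc _ ≤ C * |hK.eigenvalues β - hA.eigenvalues α| *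
          ‖((hA.eigenvectorUnitary : Matrix (Fin N) (Fin N) ℂ)ᴴ * hK.eigenvectorUnitary) α β‖ := by
          gcongr; exact hf α β
      _ = C * ‖((hA.eigenvectorUnitary : Matrix (Fin N) (Fin N) ℂ)ᴴ * (K - A) *
            hK.eigenvectorUnitary) α β‖ := by
          rw [conj_sub_apply, norm_mul, ← Complex.ofReal_sub, Complex.norm_real, Real.norm_eq_abs]
          ring
      _ ≤ _ := by
          gcongr
          exact norm_conj_unitary_entry_le _ _ _ _ _

/-- In the mixed basis the difference `f(K) - f(A)` is `ε d(x, y)` times a matrix element of `B`,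
with `x`, `y` eigenvalues of `A`, `K`. Replacing `y` by eigenvalues of `A` leaves `B` times a
difference of the functions `d(x, ·)` of `K` and `A`. -/
theorem conj_hermFun_sub_sub_apply {B : Matrix (Fin N) (Fin N) ℂ} {ε : ℂ} (hKA : K - A = ε • B)
    {f : ℝ → ℂ} {d : ℝ → ℝ → ℂ} (hd : ∀ x y : ℝ, f y - f x = d x y * (y - x)) (α β : Fin N) :
    ((hA.eigenvectorUnitary : Matrix (Fin N) (Fin N) ℂ)ᴴ *
        (hermFun hK f - hermFun hA f - ε • hermOrdered hA d B) * hK.eigenvectorUnitary) α β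
      = ε * ((hA.eigenvectorUnitary : Matrix (Fin N) (Fin N) ℂ)ᴴ *
        (B * (hermFun hK (d (hA.eigenvalues α)) - hermFun hA (d (hA.eigenvalues α)))) *
          hK.eigenvectorUnitary) α β := by
  have h1 := conj_hermFun_sub_apply hA hK f α β
  have h2 := conj_sub_apply hA hK α β
  rw [hKA] at h2
  have h := unitary_conjTranspose_mul hA.eigenvectorUnitary
  have h' := unitary_conjTranspose_mul hK.eigenvectorUnitary
  rw [Matrix.mul_sub, Matrix.sub_mul, Matrix.sub_apply, h1, hd]
  unfold hermFun hermOrdered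
  set P := (hA.eigenvectorUnitary : Matrix (Fin N) (Fin N) ℂ)
  set Q := (hK.eigenvectorUnitary : Matrix (Fin N) (Fin N) ℂ)
  set D := diagonal (fun γ => d (hA.eigenvalues α) (hA.eigenvalues γ)) with hD
  set D' := diagonal (fun γ => d (hA.eigenvalues α) (hK.eigenvalues γ)) with hD'
  set O := Matrix.of (fun α β => d (hA.eigenvalues α) (hA.eigenvalues β) * (Pᴴ * B * P) α β) with hO
  have e1 : Pᴴ * (ε • (P * O * Pᴴ)) * Q = ε • (O * (Pᴴ * Q)) := by
    rw [Matrix.mul_smul, Matrix.smul_mul]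
    calc _ = ε • ((Pᴴ * P) * O * (Pᴴ * Q)) := by simp only [Matrix.mul_assoc]
      _ = _ := by rw [h, Matrix.one_mul]
  have e2 : Pᴴ * (B * (Q * D' * Qᴴ - P * D * Pᴴ)) * Q
      = Pᴴ * B * Q * D' - (Pᴴ * B * P) * D * (Pᴴ * Q) := by
    calc _ = Pᴴ * B * Q * D' * (Qᴴ * Q) - (Pᴴ * B * P) * D * (Pᴴ * Q) := by noncomm_ring
      _ = _ := by rw [h']; simp
  have e3 : (O * (Pᴴ * Q)) α β = ((Pᴴ * B * P) * D * (Pᴴ * Q)) α β := by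
    rw [Matrix.mul_apply, Matrix.mul_apply]
    refine Finset.sum_congr rfl fun γ _ => ?_
    rw [Matrix.mul_diagonal, hO, Matrix.of_apply, mul_comm (d _ _)]
  rw [e1, e2, Matrix.smul_apply, Matrix.sub_apply, e3, Matrix.mul_diagonal, mul_assoc, ← h2,
    Matrix.mul_smul, Matrix.smul_mul, Matrix.smul_apply]
  simp only [smul_eq_mul]
  ring

/-- First-order perturbation theory: if `f(y) - f(x) = d(x,y) (y - x)` with `d` Lipschitz
continuous in `y`, then `f(A + εB) = f(A) + ε ∑ d(E,E') Π_E B Π_{E'} + O(ε²)`. -/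
theorem norm_hermFun_sub_sub_le {B : Matrix (Fin N) (Fin N) ℂ} {ε : ℂ} (hKA : K - A = ε • B)
    {f : ℝ → ℂ} {d : ℝ → ℝ → ℂ} (hd : ∀ x y : ℝ, f y - f x = d x y * (y - x)) {C : ℝ} (hC : 0 ≤ C)
    (hf : ∀ α β γ, ‖d (hA.eigenvalues α) (hK.eigenvalues β) -
      d (hA.eigenvalues α) (hA.eigenvalues γ)‖ ≤ C * |hK.eigenvalues β - hA.eigenvalues γ|) :
    ‖hermFun hK f - hermFun hA f - ε • hermOrdered hA d B‖ ≤ N ^ 10 * C * ‖B‖ ^ 2 * ‖ε‖ ^ 2 := by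
  have h := norm_le_of_conj_unitary_entry_le hA.eigenvectorUnitary hK.eigenvectorUnitary
    (X := hermFun hK f - hermFun hA f - ε • hermOrdered hA d B)
    (c := ‖ε‖ * (N ^ 2 * (‖B‖ * (N ^ 5 * C * ‖K - A‖)))) (by positivity) (fun α β => ?_)
  · rw [hKA, norm_smul] at h
    calc _ ≤ _ := h
      _ = _ := by ring
  · rw [conj_hermFun_sub_sub_apply hA hK hKA hd, norm_mul]
    gcongr
    refine (norm_conj_unitary_entry_le _ _ _ _ _).trans ?_
    gcongr
    refine (norm_mul_le _ _).trans ?_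
    gcongr
    -- Lipschitz continuity of `d` in its second variable makes this difference `O(K - A)`, which is
    -- the second factor `ε`.
    exact norm_hermFun_sub_le hA hK hC fun γ β => hf α β γ

theorem abs_eigenvalues_le (β : Fin N) : |hA.eigenvalues β| ≤ N ^ 2 * ‖A‖ := by
  have h : ((hA.eigenvectorUnitary : Matrix (Fin N) (Fin N) ℂ)ᴴ * A * hA.eigenvectorUnitary) β β
      = hA.eigenvalues β := by
    have h1 := unitary_conjTranspose_mul hA.eigenvectorUnitary
    have h2 := hermFun_ofReal hA
    unfold hermFun at h2
    set Q := (hA.eigenvectorUnitary : Matrix (Fin N) (Fin N) ℂ)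
    set D := diagonal (fun α => (hA.eigenvalues α : ℂ)) with hD
    have : Qᴴ * A * Q = D := by
      calc _ = Qᴴ * (Q * D * Qᴴ) * Q := by rw [h2]
        _ = (Qᴴ * Q) * D * (Qᴴ * Q) := by simp only [Matrix.mul_assoc]
        _ = D := by rw [h1]; simp
    rw [this, hD, Matrix.diagonal_apply_eq]
  rw [← Real.norm_eq_abs, ← Complex.norm_real, ← h]
  exact norm_conj_unitary_entry_le _ _ _ _ _

end perturbation

/-! ### The amplitudes on the rescaled time scale -/

section amplitude

open scoped Matrix.Norms.Operator

variable {N : ℕ}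

theorem star_dotProduct_amplitude_mulVec (U₀ U : ℝ → TotalSpace N ≃ₗᵢ[ℂ] TotalSpace N) (t : ℝ)
    (q q' : Fin N → ℂ) :
    star q ⬝ᵥ (amplitude U₀ U t *ᵥ q')
      = inner ℂ (excited q) ((U₀ t).symm (U t (excited q'))) := by
  simp only [excited, map_sum, map_smul, sum_inner, inner_sum, inner_smul_left, inner_smul_right,
    dotProduct, mulVec, amplitude, Matrix.of_apply, Finset.mul_sum]
  rw [Finset.sum_comm]
  refine Finset.sum_congr rfl fun i _ => Finset.sum_congr rfl fun j _ => ?_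
  simp only [Pi.star_apply, RCLike.star_def]
  ring

variable {ω : ℝ → ℝ} {g : ℝ → ℂ} {HS : Matrix (Fin N) (Fin N) ℂ} {lam : ℝ}
  {U₀ U : ℝ → TotalSpace N ≃ₗᵢ[ℂ] TotalSpace N}

/-- In an eigenbasis of `HS` the amplitudes have initial values `δ_{αβ}`: diagonal entries follow
`volterra_asymptotics`, the others vanish exactly. -/
theorem norm_amplitude_sub_le (hω : Measurable ω) (hg : MemLp g 2 volume) (hHS : HS.IsHermitian)
    (hU₀ : IsUnitaryGroup (HamiltonianGraph ω g HS 0) U₀)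
    (hU : IsUnitaryGroup (HamiltonianGraph ω g HS lam) U) {F' F'' : ℂ → ℂ} {M : ℝ}
    (hb : ∀ β, HalfPlaneBounds (laplace (corr ω g)) F' F'' M (-Complex.I * hHS.eigenvalues β))
    (hlam : lam ≠ 0) (hlamM : 48 * M ^ 2 * lam ^ 2 ≤ 1) {t : ℝ} (ht : 0 < t) :
    ‖amplitude U₀ U (t / lam ^ 2) - hermFun hHS (fun κ =>
        (1 - (lam : ℂ) ^ 2 * F' (-Complex.I * κ)) * Complex.exp (t *
          -(laplace (corr ω g) (-Complex.I * κ) * (1 - (lam : ℂ) ^ 2 * F' (-Complex.I * κ)))))‖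
      ≤ N ^ 3 * (200000 * (16 * M) ^ 6 * (2 + 1 / t) * Real.exp t / (2 * Real.pi * t))
        * lam ^ 4 := by
  have hε : 0 < lam ^ 2 := by positivity
  set Cst := 200000 * (16 * M) ^ 6 * (2 + 1 / t) * Real.exp t / (2 * Real.pi * t) with hCst
  -- For `N = 0` nothing forces `1 ≤ M`; the even power of `M` suffices.
  have hC0 : 0 ≤ Cst := by
    rcases isEmpty_or_nonempty (Fin N) with h | ⟨⟨β⟩⟩
    · have : 0 ≤ (16 * M) ^ 6 := by positivity
      positivity
    · have := (hb β).one_le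
      positivity
  have h := norm_le_of_conj_unitary_entry_le hHS.eigenvectorUnitary hHS.eigenvectorUnitary
    (X := amplitude U₀ U (t / lam ^ 2) - hermFun hHS (fun κ =>
        (1 - (lam : ℂ) ^ 2 * F' (-Complex.I * κ)) * Complex.exp (t *
          -(laplace (corr ω g) (-Complex.I * κ) * (1 - (lam : ℂ) ^ 2 * F' (-Complex.I * κ))))))
    (c := Cst * (lam ^ 2) ^ 2) (by positivity) (fun α β => ?_)
  · calc _ ≤ _ := h
      _ = _ := by ring
  set q : Fin N → Fin N → ℂ := fun α => (hHS.eigenvectorBasis α).ofLp with hq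
  have hqe : ∀ α, HS *ᵥ q α = ((hHS.eigenvalues α : ℝ) : ℂ) • q α := fun α => by
    rw [hq]; exact hHS.mulVec_eigenvectorBasis α
  have hQ := unitary_conjTranspose_mul hHS.eigenvectorUnitary
  have hcol : ∀ X : Matrix (Fin N) (Fin N) ℂ,
      ((hHS.eigenvectorUnitary : Matrix (Fin N) (Fin N) ℂ)ᴴ * X * hHS.eigenvectorUnitary) α β
        = star (q α) ⬝ᵥ (X *ᵥ q β) := by
    intro X
    rw [Matrix.mul_assoc, Matrix.mul_apply]
    refine Finset.sum_congr rfl fun i _ => ?_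
    rfl
  have hortho : star (q α) ⬝ᵥ q β = (1 : Matrix (Fin N) (Fin N) ℂ) α β := by
    rw [← hQ, ← Matrix.mul_one (hHS.eigenvectorUnitary : Matrix (Fin N) (Fin N) ℂ)ᴴ, hcol,
      Matrix.one_mulVec]
  set φ : ℝ → ℂ := fun κ => (1 - (lam : ℂ) ^ 2 * F' (-Complex.I * κ)) * Complex.exp (t *
    -(laplace (corr ω g) (-Complex.I * κ) * (1 - (lam : ℂ) ^ 2 * F' (-Complex.I * κ)))) with hφ
  set x : ℝ → ℂ := fun s => inner ℂ (excited (q α)) (U s (excited (q β))) with hx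
  have hx0 : x 0 = (1 : Matrix (Fin N) (Fin N) ℂ) α β := by
    simp only [hx, hU.zero, inner_excited_excited, hortho]
  have h1 : ((hHS.eigenvectorUnitary : Matrix (Fin N) (Fin N) ℂ)ᴴ *
      amplitude U₀ U (t / lam ^ 2) * hHS.eigenvectorUnitary) α β
      = Complex.exp (-(-Complex.I * hHS.eigenvalues α) * (t / lam ^ 2 : ℝ)) * x (t / lam ^ 2) := by
    rw [hcol, star_dotProduct_amplitude_mulVec, ← (U₀ (t / lam ^ 2)).inner_map_map,
      LinearIsometryEquiv.apply_symm_apply, free_apply_excited hg hU₀ (hqe α), inner_smul_left]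
    congr 1
    rw [← Complex.exp_conj]
    congr 1
    simp only [map_mul, map_neg, Complex.conj_I, Complex.conj_ofReal]
    ring
  have h2 : ((hHS.eigenvectorUnitary : Matrix (Fin N) (Fin N) ℂ)ᴴ * hermFun hHS φ *
      hHS.eigenvectorUnitary) α β = φ (hHS.eigenvalues β) * (1 : Matrix (Fin N) (Fin N) ℂ) α β := by
    unfold hermFun
    set Q := (hHS.eigenvectorUnitary : Matrix (Fin N) (Fin N) ℂ)
    set D := diagonal (fun α => φ (hHS.eigenvalues α)) with hD
    have : Qᴴ * (Q * D * Qᴴ) * Q = 1 * D := by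
      calc _ = (Qᴴ * Q) * D * (Qᴴ * Q) := by simp only [Matrix.mul_assoc]
        _ = 1 * D := by rw [hQ]; simp
    rw [this, hD, Matrix.mul_diagonal, mul_comm]
  have h3 := volterra_asymptotics (G := corr ω g) (x := x)
    (B := ∫ k : ℝ, ‖g k‖ ^ 2) (C := ‖excited (q α)‖ * ‖excited (q β)‖)
    (continuous_corr hω hg) norm_corr_le
    (continuous_const.inner (hU.continuous _))
    (fun s => (norm_inner_le_norm _ _).trans_eq (by rw [LinearIsometryEquiv.norm_map]))
    (hb β) hε hlamM
    (fun s _ => by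
      have := hasDerivAt_amplitude hω hg hU (ζ := excited (q α))
        (fun j f => inner_excited_oneBoson (q α) j f) (hqe β) s
      exact this) ht
  rw [Matrix.mul_sub, Matrix.sub_mul, Matrix.sub_apply, h1, h2]
  rw [hx0] at h3
  by_cases hαβ : α = β
  · subst hαβ
    rw [Matrix.one_apply_eq, norm_one, one_mul, one_mul] at h3
    rw [Matrix.one_apply_eq, mul_one]
    convert h3 using 3
    simp only [hφ]
    push_cast
    congr 2
    ring
  · rw [Matrix.one_apply_ne hαβ] at h3 ⊢
    rw [zero_mul, sub_zero, norm_zero, zero_mul, zero_mul, norm_mul] at h3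
    -- The bound is proportional to `‖x 0‖ = 0`.
    have : x (t / lam ^ 2) = 0 := by
      have hpos := Complex.exp_ne_zero (-(-Complex.I * hHS.eigenvalues β) * (t / lam ^ 2 : ℝ))
      rw [← norm_pos_iff] at hpos
      have := nonpos_of_mul_nonpos_right h3 hpos
      exact norm_le_zero_iff.1 this
    rw [this, mul_zero, mul_zero, sub_zero, norm_zero]
    positivity

end amplitude

/-! ### The amplitudes in the limit of weak coupling -/

section weakCoupling

open scoped Matrix.Norms.Operator
open Asymptotics

theorem isBigO_mul_sub_mul {R : Type*} [NormedRing R] {l : Filter ℝ} {X X' Y Y' : ℝ → R}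
    {f : ℝ → ℝ} (hX : (fun s => X s - X' s) =O[l] f) (hY : (fun s => Y s - Y' s) =O[l] f)
    (hX' : X' =O[l] fun _ => (1 : ℝ)) (hYb : Y =O[l] fun _ => (1 : ℝ)) :
    (fun s => X s * Y s - X' s * Y' s) =O[l] f := by
  have h1 := hX.mul hYb
  have h2 := hX'.mul hY
  simp only [mul_one, one_mul] at h1 h2
  refine (h1.add h2).congr_left fun s => ?_
  noncomm_ring

variable {N : ℕ} {H0 H2 : Matrix (Fin N) (Fin N) ℂ} (h0 : H0.IsHermitian)
  (hK : ∀ lam : ℝ, (H0 + (lam : ℂ) ^ 2 • H2).IsHermitian)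

theorem abs_eigenvalues_le_of_perturbation {lam : ℝ} (hlam : |lam| ≤ 1) (β : Fin N) :
    |(hK lam).eigenvalues β| ≤ N ^ 2 * (‖H0‖ + ‖H2‖) := by
  refine (abs_eigenvalues_le (hK lam) β).trans ?_
  gcongr
  refine (norm_add_le _ _).trans ?_
  gcongr
  rw [norm_smul, norm_pow, Complex.norm_real, Real.norm_eq_abs]
  exact mul_le_of_le_one_left (norm_nonneg _) (pow_le_one₀ (abs_nonneg _) hlam)

theorem abs_eigenvalues_le_add (α : Fin N) : |h0.eigenvalues α| ≤ N ^ 2 * (‖H0‖ + ‖H2‖) := by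
  refine (abs_eigenvalues_le h0 α).trans ?_
  gcongr
  exact le_add_of_nonneg_right (norm_nonneg _)

theorem eventually_abs_le_one : ∀ᶠ lam in 𝓝 (0 : ℝ), |lam| ≤ 1 := by
  filter_upwards [Metric.closedBall_mem_nhds (0 : ℝ) one_pos] with lam h
  simpa using h

theorem isBigO_pow_four : (fun lam : ℝ => lam ^ 4) =O[𝓝 0] fun lam : ℝ => lam ^ 2 := by
  refine IsBigO.of_bound 1 ?_
  filter_upwards [eventually_abs_le_one] with lam hlam
  rw [one_mul, norm_pow, norm_pow]
  exact pow_le_pow_of_le_one (norm_nonneg _) hlam (by norm_num)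

theorem isBigO_hermFun_sub {f : ℝ → ℂ} {C : ℝ} (hC : 0 ≤ C)
    (hf : ∀ x y : ℝ, |x| ≤ N ^ 2 * (‖H0‖ + ‖H2‖) → |y| ≤ N ^ 2 * (‖H0‖ + ‖H2‖) →
      ‖f x - f y‖ ≤ C * |x - y|) :
    (fun lam => hermFun (hK lam) f - hermFun h0 f) =O[𝓝 0] fun lam : ℝ => lam ^ 2 := by
  refine IsBigO.of_bound (N ^ 5 * C * ‖H2‖) ?_
  filter_upwards [eventually_abs_le_one] with lam hlam
  refine (norm_hermFun_sub_le h0 (hK lam) hC fun α β => hf _ _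
    (abs_eigenvalues_le_of_perturbation hK hlam β) (abs_eigenvalues_le_add h0 α)).trans_eq ?_
  rw [add_sub_cancel_left, norm_smul, norm_pow, norm_pow, Complex.norm_real]
  ring

variable {F : ℂ → ℂ} (hF : ContDiffOn ℂ 2 F rightHalfPlane)

theorem sub_axis_eq_diffQuot_mul (F : ℂ → ℂ) (x y : ℝ) : F (-Complex.I * y) - F (-Complex.I * x)
    = -Complex.I * diffQuot F (-Complex.I * x) (-Complex.I * y) * (y - x) := by
  rw [← neg_sub, sub_eq_diffQuot_mul]
  ring

include hF

/-- The parametrization `κ ↦ -iκ` of the axis contributes a factor `-i` to the divided difference,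
whence the sign of the correction. -/
theorem isBigO_hermFun_sub_sub :
    (fun lam => hermFun (hK lam) (fun κ => F (-Complex.I * κ))
      - hermFun h0 (fun κ => F (-Complex.I * κ))
      + ((lam : ℂ) ^ 2) • Complex.I • orderedFun h0 (diffQuot F) H2)
      =O[𝓝 0] fun lam : ℝ => lam ^ 4 := by
  obtain ⟨M, hM0, -, hM⟩ := exists_diffQuot_bounds hF (N ^ 2 * (‖H0‖ + ‖H2‖))
  refine IsBigO.of_bound (N ^ 10 * M * ‖H2‖ ^ 2) ?_
  filter_upwards [eventually_abs_le_one] with lam hlam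
  have h := norm_hermFun_sub_sub_le h0 (hK lam) (B := H2) (ε := (lam : ℂ) ^ 2)
    (add_sub_cancel_left _ _) (f := fun κ => F (-Complex.I * κ))
    (d := fun x y => -Complex.I * diffQuot F (-Complex.I * x) (-Complex.I * y))
    (sub_axis_eq_diffQuot_mul F) hM0 (fun α β γ => by
      rw [← mul_sub, norm_mul, norm_neg, Complex.norm_I, one_mul]
      exact hM _ _ _ (abs_eigenvalues_le_add h0 α) (abs_eigenvalues_le_of_perturbation hK hlam β)
        (abs_eigenvalues_le_add h0 γ))
  have e : hermOrdered h0 (fun x y => -Complex.I * diffQuot F (-Complex.I * x) (-Complex.I * y)) H2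
      = -(Complex.I • orderedFun h0 (diffQuot F) H2) := by
    rw [orderedFun_eq_hermOrdered, ← neg_smul]
    unfold hermOrdered
    rw [← Matrix.smul_mul, ← Matrix.mul_smul]
    congr 2
    ext α β
    simp [mul_assoc]
  rw [e, smul_neg, sub_neg_eq_add] at h
  refine h.trans_eq ?_
  rw [norm_pow, norm_pow, Complex.norm_real]
  ring

theorem isBigO_hermFun_derivRHP_sub :
    (fun lam => hermFun (hK lam) (fun κ => derivRHP F (-Complex.I * κ))
      - hermFun h0 (fun κ => derivRHP F (-Complex.I * κ))) =O[𝓝 0] fun lam : ℝ => lam ^ 2 := by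
  obtain ⟨M, hM0, hM, -⟩ := exists_diffQuot_bounds hF (N ^ 2 * (‖H0‖ + ‖H2‖))
  exact isBigO_hermFun_sub h0 hK hM0 hM

theorem isBigO_hermFun_laplace_sub :
    (fun lam => hermFun (hK lam) (fun κ => F (-Complex.I * κ))
      - hermFun h0 (fun κ => F (-Complex.I * κ))) =O[𝓝 0] fun lam : ℝ => lam ^ 2 := by
  have h1 := isBigO_hermFun_sub_sub (H2 := H2) h0 hK hF
  have h2 : (fun lam : ℝ => ((lam : ℂ) ^ 2) • Complex.I • orderedFun h0 (diffQuot F) H2)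
      =O[𝓝 0] fun lam : ℝ => lam ^ 2 := by
    refine IsBigO.of_bound ‖Complex.I • orderedFun h0 (diffQuot F) H2‖
      (Eventually.of_forall fun lam => ?_)
    rw [norm_smul, norm_pow, norm_pow, Complex.norm_real, mul_comm]
  exact ((h1.trans isBigO_pow_four).sub h2).congr_left fun lam => by abel

theorem tendsto_hermFun_laplace :
    Tendsto (fun lam => hermFun (hK lam) fun κ => F (-Complex.I * κ)) (𝓝 0)
      (𝓝 (hermFun h0 fun κ => F (-Complex.I * κ))) := by
  have h := (isBigO_hermFun_laplace_sub h0 hK hF).trans_tendsto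
    ((continuous_pow 2).tendsto' (0 : ℝ) 0 (by simp))
  have h' := h.add_const (hermFun h0 fun κ => F (-Complex.I * κ))
  simp only [sub_add_cancel, zero_add] at h'
  exact h'

omit hF in
theorem isBigO_smul_sq {X : ℝ → Matrix (Fin N) (Fin N) ℂ} (hX : X =O[𝓝 0] fun lam : ℝ => lam ^ 2) :
    (fun lam : ℝ => ((lam : ℂ) ^ 2) • X lam) =O[𝓝 0] fun lam : ℝ => lam ^ 4 := by
  have h : (fun lam : ℝ => ((lam : ℂ) ^ 2)) =O[𝓝 0] fun lam : ℝ => lam ^ 2 :=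
    IsBigO.of_bound 1 (Eventually.of_forall fun lam => by
      rw [norm_pow, norm_pow, Complex.norm_real, one_mul])
  exact (h.smul hX).congr_right fun lam => by rw [smul_eq_mul]; ring

theorem isBigO_renorm_sub :
    (fun lam : ℝ => (1 - ((lam : ℂ) ^ 2) • hermFun (hK lam) fun κ => derivRHP F (-Complex.I * κ))
      - rMatrix h0 F lam) =O[𝓝 0] fun lam : ℝ => lam ^ 4 := by
  refine (isBigO_smul_sq (isBigO_hermFun_derivRHP_sub h0 hK hF)).neg_left.congr_left fun lam => ?_
  rw [rMatrix, funAt_eq_hermFun, smul_sub]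
  abel

/-- Only the leading term `-G̃` needs the correction by `H_S⁽²⁾`: the product `G̃'G̃` already
carries `λ²`, so there `H_S⁽⁰⁾` may simply replace `H_{S,λ}`. -/
theorem isBigO_generator_sub :
    (fun lam : ℝ => (-(hermFun (hK lam) fun κ => F (-Complex.I * κ)) + ((lam : ℂ) ^ 2) •
      ((hermFun (hK lam) fun κ => derivRHP F (-Complex.I * κ)) *
        hermFun (hK lam) fun κ => F (-Complex.I * κ))) - LMatrix h0 H2 F lam)
      =O[𝓝 0] fun lam : ℝ => lam ^ 4 := by
  have h1 := isBigO_hermFun_sub_sub (H2 := H2) h0 hK hF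
  have h2 := isBigO_smul_sq (isBigO_mul_sub_mul (isBigO_hermFun_derivRHP_sub h0 hK hF)
    (isBigO_hermFun_laplace_sub h0 hK hF) (isBigO_const_const _ one_ne_zero _)
    ((tendsto_hermFun_laplace h0 hK hF).isBigO_one ℝ))
  refine (h1.neg_left.add h2).congr_left fun lam => ?_
  rw [LMatrix, funAt_eq_hermFun, funAt_eq_hermFun, smul_sub, smul_add]
  abel

omit hF in
theorem hermFun_renorm_exp {A : Matrix (Fin N) (Fin N) ℂ} (hA : A.IsHermitian) (a b : ℝ → ℂ)
    (c t : ℂ) :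
    hermFun hA (fun κ => (1 - c * b κ) * Complex.exp (t * -(a κ * (1 - c * b κ))))
      = (1 - c • hermFun hA b) *
        NormedSpace.exp (t • (-hermFun hA a + c • (hermFun hA b * hermFun hA a))) := by
  have e1 : hermFun hA (fun κ => 1 - c * b κ) = 1 - c • hermFun hA b := by
    rw [← hermFun_one hA, sub_eq_add_neg, ← neg_smul, ← hermFun_smul, ← hermFun_add]
    simp only [neg_mul, sub_eq_add_neg]
  have e2 : hermFun hA (fun κ => t * -(a κ * (1 - c * b κ)))
      = t • (-hermFun hA a + c • (hermFun hA b * hermFun hA a)) := by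
    rw [hermFun_mul, ← neg_one_smul ℂ (hermFun hA a), ← hermFun_smul, ← hermFun_smul,
      ← hermFun_add, ← hermFun_smul]
    congr 1
    ext κ
    ring
  rw [← hermFun_mul hA (fun κ => 1 - c * b κ), ← exp_hermFun, e1, e2]

-- Both factors are functions of the same Hermitian matrix. This is why renormalization may precede
-- or follow the evolution, although `r` and `L` need not commute.
omit hF in
theorem commute_renorm_exp {A : Matrix (Fin N) (Fin N) ℂ} (hA : A.IsHermitian) (a b : ℝ → ℂ)
    (c t : ℂ) :
    (1 - c • hermFun hA b) *
        NormedSpace.exp (t • (-hermFun hA a + c • (hermFun hA b * hermFun hA a)))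
      = NormedSpace.exp (t • (-hermFun hA a + c • (hermFun hA b * hermFun hA a))) *
        (1 - c • hermFun hA b) := by
  have h : Commute (hermFun hA b) (hermFun hA a) := by
    rw [commute_iff_eq, hermFun_mul, hermFun_mul]
    congr 1
    ext κ
    ring
  have h1 : Commute (1 - c • hermFun hA b)
      (t • (-hermFun hA a + c • (hermFun hA b * hermFun hA a))) := by
    refine Commute.smul_right (Commute.add_right (Commute.neg_right ?_) ?_) t
    · exact (Commute.one_left _).sub_left (h.smul_left c)
    · refine Commute.smul_right ?_ c
      exact (Commute.one_left _).sub_left (((Commute.refl _).mul_right h).smul_left c)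
  exact h1.exp_right.eq

omit hF in
theorem continuous_rMatrix (F : ℂ → ℂ) : Continuous (rMatrix h0 F) := by
  unfold rMatrix
  fun_prop

omit hF in
theorem continuous_LMatrix (F : ℂ → ℂ) : Continuous (LMatrix h0 H2 F) := by
  unfold LMatrix
  fun_prop

-- The exponential is strictly differentiable at `Z`, hence Lipschitz continuous near it.
omit hF in
theorem isBigO_exp_sub_exp {X Y : ℝ → Matrix (Fin N) (Fin N) ℂ} {Z : Matrix (Fin N) (Fin N) ℂ}
    {l : Filter ℝ} {f : ℝ → ℝ} (hX : Tendsto X l (𝓝 Z)) (hY : Tendsto Y l (𝓝 Z))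
    (h : (fun s => X s - Y s) =O[l] f) :
    (fun s => NormedSpace.exp (X s) - NormedSpace.exp (Y s)) =O[l] f := by
  have h1 := (NormedSpace.exp_analytic (𝕂 := ℂ) Z).hasStrictFDerivAt.isBigO_sub
  exact (h1.comp_tendsto (hX.prodMk_nhds hY)).trans h

omit hF in
include hK in
/-- The amplitudes converge to the renormalized semigroup with an error of fourth order. -/
theorem isBigO_amplitude_sub {ω : ℝ → ℝ} {g : ℝ → ℂ} (hω : Measurable ω) (hg : MemLp g 2 volume)
    {U₀ U : ℝ → ℝ → TotalSpace N ≃ₗᵢ[ℂ] TotalSpace N}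
    (hU₀ : ∀ lam : ℝ, IsUnitaryGroup
      (HamiltonianGraph ω g (H0 + (lam : ℂ) ^ 2 • H2) 0) (U₀ lam))
    (hU : ∀ lam : ℝ, IsUnitaryGroup
      (HamiltonianGraph ω g (H0 + (lam : ℂ) ^ 2 • H2) lam) (U lam))
    (hF : ContDiffOn ℂ 2 (laplace (corr ω g)) rightHalfPlane)
    (hbdd : ∃ C : ℝ, ∀ p ∈ rightHalfPlane, ‖derivRHP (laplace (corr ω g)) p‖ ≤ C)
    {t : ℝ} (ht : 0 < t) :
    ((fun lam => amplitude (U₀ lam) (U lam) (t / lam ^ 2) -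
        rMatrix h0 (laplace (corr ω g)) lam *
          NormedSpace.exp ((t : ℂ) • LMatrix h0 H2 (laplace (corr ω g)) lam))
      =O[𝓝[≠] 0] fun lam : ℝ => lam ^ 4) ∧
    ((fun lam => amplitude (U₀ lam) (U lam) (t / lam ^ 2) -
        NormedSpace.exp ((t : ℂ) • LMatrix h0 H2 (laplace (corr ω g)) lam) *
          rMatrix h0 (laplace (corr ω g)) lam)
      =O[𝓝[≠] 0] fun lam : ℝ => lam ^ 4) := by
  obtain ⟨M, hM⟩ := exists_halfPlaneBounds hF (fun p hp => laplace_corr_re_nonneg hω hg hp) hbdd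
    (N ^ 2 * (‖H0‖ + ‖H2‖))
  set F := laplace (corr ω g)
  set a : ℝ → ℂ := fun κ => F (-Complex.I * κ) with ha
  set b : ℝ → ℂ := fun κ => derivRHP F (-Complex.I * κ) with hb
  set r' : ℝ → Matrix (Fin N) (Fin N) ℂ := fun lam => 1 - ((lam : ℂ) ^ 2) • hermFun (hK lam) b
    with hr'
  set L' : ℝ → Matrix (Fin N) (Fin N) ℂ := fun lam => -hermFun (hK lam) a + ((lam : ℂ) ^ 2) •
    (hermFun (hK lam) b * hermFun (hK lam) a) with hL'
  have hsmall : ∀ᶠ lam in 𝓝 (0 : ℝ), 48 * M ^ 2 * lam ^ 2 < 1 :=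
    ((by fun_prop : Continuous fun lam : ℝ => 48 * M ^ 2 * lam ^ 2).tendsto' 0 0
      (by simp)).eventually_lt_const one_pos
  have h1 : (fun lam => amplitude (U₀ lam) (U lam) (t / lam ^ 2)
      - r' lam * NormedSpace.exp ((t : ℂ) • L' lam)) =O[𝓝[≠] 0] fun lam : ℝ => lam ^ 4 := by
    refine IsBigO.of_bound (N ^ 3 *
      (200000 * (16 * M) ^ 6 * (2 + 1 / t) * Real.exp t / (2 * Real.pi * t))) ?_
    filter_upwards [self_mem_nhdsWithin, nhdsWithin_le_nhds eventually_abs_le_one,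
      nhdsWithin_le_nhds hsmall] with lam hne hle hs
    have h := norm_amplitude_sub_le hω hg (hK lam) (hU₀ lam) (hU lam)
      (fun β => hM _ (abs_eigenvalues_le_of_perturbation hK hle β)) hne hs.le ht
    rw [hermFun_renorm_exp (hK lam) a b] at h
    rw [Real.norm_eq_abs, abs_of_nonneg (by positivity : (0 : ℝ) ≤ lam ^ 4)]
    exact h
  have h2 : (fun lam => r' lam - rMatrix h0 F lam) =O[𝓝[≠] 0] fun lam : ℝ => lam ^ 4 :=
    (isBigO_renorm_sub h0 hK hF).mono nhdsWithin_le_nhds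
  have h3 : (fun lam => L' lam - LMatrix h0 H2 F lam) =O[𝓝[≠] 0] fun lam : ℝ => lam ^ 4 :=
    (isBigO_generator_sub h0 hK hF).mono nhdsWithin_le_nhds
  have h4 : (fun lam => (t : ℂ) • L' lam - (t : ℂ) • LMatrix h0 H2 F lam)
      =O[𝓝[≠] 0] fun lam : ℝ => lam ^ 4 := by
    simp_rw [← smul_sub]
    exact h3.const_smul_left (t : ℂ)
  have hr : Tendsto (rMatrix h0 F) (𝓝[≠] 0) (𝓝 (rMatrix h0 F 0)) :=
    (continuous_rMatrix h0 F).continuousAt.mono_left nhdsWithin_le_nhds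
  have hL : Tendsto (fun lam => (t : ℂ) • LMatrix h0 H2 F lam) (𝓝[≠] 0)
      (𝓝 ((t : ℂ) • LMatrix h0 H2 F 0)) :=
    ((continuous_LMatrix h0 F).const_smul (t : ℂ)).continuousAt.mono_left nhdsWithin_le_nhds
  have h40 : Tendsto (fun lam : ℝ => lam ^ 4) (𝓝[≠] 0) (𝓝 0) :=
    ((continuous_pow 4).tendsto' (0 : ℝ) 0 (by simp)).mono_left nhdsWithin_le_nhds
  have hr'' : Tendsto r' (𝓝[≠] 0) (𝓝 (rMatrix h0 F 0)) := by
    have h := (h2.trans_tendsto h40).add hr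
    simp only [sub_add_cancel, zero_add] at h
    exact h
  have hL'' : Tendsto (fun lam => (t : ℂ) • L' lam) (𝓝[≠] 0) (𝓝 ((t : ℂ) • LMatrix h0 H2 F 0)) := by
    have h := (h4.trans_tendsto h40).add hL
    simp only [sub_add_cancel, zero_add] at h
    exact h
  have h5 := isBigO_exp_sub_exp hL'' hL h4
  have hexp : Continuous (NormedSpace.exp : Matrix (Fin N) (Fin N) ℂ → Matrix (Fin N) (Fin N) ℂ) :=
    NormedSpace.exp_continuous
  have hE := (hexp.tendsto _).comp hL
  have hE' := (hexp.tendsto _).comp hL''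
  constructor
  · exact (h1.add (isBigO_mul_sub_mul h2 h5 (hr.isBigO_one ℝ) (hE'.isBigO_one ℝ))).congr_left
      fun lam => by simp only [sub_add_sub_cancel]
  · refine (h1.add (isBigO_mul_sub_mul h5 h2 (hE.isBigO_one ℝ) (hr''.isBigO_one ℝ))).congr_left
      fun lam => ?_
    rw [hr', hL', commute_renorm_exp]
    simp only [sub_add_sub_cancel]

end weakCoupling

/-! ### Superoperators -/

section superoperators

variable {N : ℕ}

/-- The ground entry merely restores the trace, so composition is decided by the other blocks. -/
theorem renormMatrix_mul (A B : Matrix (Fin N) (Fin N) ℂ) (ρ : Matrix (Level N) (Level N) ℂ) :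
    renormMatrix A (renormMatrix B ρ) = renormMatrix (A * B) ρ := by
  unfold renormMatrix
  simp only [toBlocks_fromBlocks₁₁, toBlocks_fromBlocks₁₂, toBlocks_fromBlocks₂₁,
    toBlocks_fromBlocks₂₂, conjTranspose_mul, Matrix.mul_assoc]
  congr 1
  ext i j
  simp only [Matrix.add_apply, Matrix.of_apply, Matrix.trace_sub]
  ring

theorem excitedBlock_add (A B : Matrix (Fin N) (Fin N) ℂ) :
    excitedBlock (A + B) = excitedBlock A + excitedBlock B := by
  simp [excitedBlock, fromBlocks_add]

theorem trace_fromBlocks (A : Matrix Unit Unit ℂ) (B : Matrix Unit (Fin N) ℂ)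
    (C : Matrix (Fin N) Unit ℂ) (D : Matrix (Fin N) (Fin N) ℂ) :
    (fromBlocks A B C D).trace = A.trace + D.trace := by
  simp [trace, Fintype.sum_sum_type]

theorem excitedBlock_smul {S : Type*} [Monoid S] [DistribMulAction S ℂ] (c : S)
    (A : Matrix (Fin N) (Fin N) ℂ) : excitedBlock (c • A) = c • excitedBlock A := by
  simp [excitedBlock, fromBlocks_smul]

theorem excitedBlock_sum {ι : Type*} (s : Finset ι) (A : ι → Matrix (Fin N) (Fin N) ℂ) :
    excitedBlock (∑ i ∈ s, A i) = ∑ i ∈ s, excitedBlock (A i) := by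
  classical
  induction s using Finset.induction_on with
  | empty => simp [excitedBlock]
  | insert a s ha ih => rw [Finset.sum_insert ha, Finset.sum_insert ha, excitedBlock_add, ih]

theorem excitedBlock_mul (A B : Matrix (Fin N) (Fin N) ℂ) :
    excitedBlock A * excitedBlock B = excitedBlock (A * B) := by
  simp [excitedBlock, fromBlocks_multiply]

theorem excitedBlock_conjTranspose (A : Matrix (Fin N) (Fin N) ℂ) :
    (excitedBlock A)ᴴ = excitedBlock Aᴴ := by
  simp [excitedBlock, fromBlocks_conjTranspose]

theorem groundProj_eq : groundProj N = fromBlocks 1 0 0 0 := by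
  ext (i | i) (j | j) <;> simp [groundProj]

theorem excitedBlock_mul_groundProj (A : Matrix (Fin N) (Fin N) ℂ) :
    excitedBlock A * groundProj N = 0 := by
  simp [excitedBlock, groundProj_eq, fromBlocks_multiply]

theorem groundProj_mul_excitedBlock (A : Matrix (Fin N) (Fin N) ℂ) :
    groundProj N * excitedBlock A = 0 := by
  simp [excitedBlock, groundProj_eq, fromBlocks_multiply]

theorem trace_excitedBlock_mul (A : Matrix (Fin N) (Fin N) ℂ)
    (ρ : Matrix (Level N) (Level N) ℂ) :
    (excitedBlock A * ρ).trace = (A * ρ.toBlocks₂₂).trace := by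
  conv_lhs => rw [← fromBlocks_toBlocks ρ]
  simp [excitedBlock, fromBlocks_multiply, trace_fromBlocks]

theorem smul_effHam_sub_decay (L : Matrix (Fin N) (Fin N) ℂ) :
    -Complex.I • effHam L - (1 / 2 : ℂ) • decay L = L := by
  ext i j
  simp only [effHam, decay, Matrix.sub_apply, Matrix.smul_apply, Matrix.neg_apply,
    Matrix.add_apply, smul_eq_mul]
  linear_combination (-(L i j - Lᴴ i j) / 2) * Complex.I_mul_I

theorem smul_effHam_sub_decay' (L : Matrix (Fin N) (Fin N) ℂ) :
    Complex.I • effHam L - (1 / 2 : ℂ) • decay L = Lᴴ := by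
  ext i j
  simp only [effHam, decay, Matrix.sub_apply, Matrix.smul_apply, Matrix.neg_apply,
    Matrix.add_apply, smul_eq_mul]
  linear_combination ((L i j - Lᴴ i j) / 2) * Complex.I_mul_I

/-- In this form the generator is the infinitesimal version of `renormMatrix_eq`: a non-Hermitian
evolution whose loss of trace is returned to the ground state. -/
theorem generator_apply (L : Matrix (Fin N) (Fin N) ℂ) (ρ : Matrix (Level N) (Level N) ℂ) :
    generator L ρ = excitedBlock L * ρ + ρ * excitedBlock Lᴴ
      - (excitedBlock L * ρ + ρ * excitedBlock Lᴴ).trace • groundProj N := by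
  have h1 : (excitedBlock L * ρ + ρ * excitedBlock Lᴴ).trace
      = -(decay L * ρ.toBlocks₂₂).trace := by
    rw [trace_add, trace_mul_comm ρ, ← trace_add, ← Matrix.add_mul, ← excitedBlock_add,
      trace_excitedBlock_mul, ← trace_neg, ← Matrix.neg_mul, decay, neg_neg]
  rw [h1]
  conv_rhs =>
    rw [← smul_effHam_sub_decay' L]
    enter [1, 1, 1, 1]
    rw [← smul_effHam_sub_decay L]
  simp only [sub_eq_add_neg, ← neg_smul, excitedBlock_add, excitedBlock_smul]
  simp only [generator, LinearMap.coe_mk, AddHom.coe_mk, add_mul, mul_add, Matrix.smul_mul,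
    Matrix.mul_smul, Matrix.neg_mul, Matrix.mul_neg, smul_add, smul_sub, neg_smul, neg_neg]
  abel

theorem renormMatrix_eq (V : Matrix (Fin N) (Fin N) ℂ) (ρ : Matrix (Level N) (Level N) ℂ) :
    renormMatrix V ρ = (excitedBlock V + groundProj N) * ρ * (excitedBlock V + groundProj N)ᴴ
      + (ρ.trace - ((excitedBlock V + groundProj N) * ρ *
        (excitedBlock V + groundProj N)ᴴ).trace) • groundProj N := by
  have h : excitedBlock V + groundProj N = fromBlocks 1 0 0 V := by
    simp [excitedBlock, groundProj_eq, fromBlocks_add]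
  have h2 : (excitedBlock V + groundProj N) * ρ * (excitedBlock V + groundProj N)ᴴ
      = fromBlocks ρ.toBlocks₁₁ (ρ.toBlocks₁₂ * Vᴴ) (V * ρ.toBlocks₂₁)
        (V * ρ.toBlocks₂₂ * Vᴴ) := by
    rw [h]
    conv_lhs => rw [← fromBlocks_toBlocks ρ]
    simp [fromBlocks_multiply, fromBlocks_conjTranspose]
  have h3 : ρ.trace = ρ.toBlocks₁₁.trace + ρ.toBlocks₂₂.trace := by
    conv_lhs => rw [← fromBlocks_toBlocks ρ, trace_fromBlocks]
  rw [h2, h3, trace_fromBlocks, groundProj_eq, fromBlocks_smul, fromBlocks_add]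
  simp only [renormMatrix, smul_zero, add_zero]
  congr 1
  ext i j
  simp only [Matrix.add_apply, Matrix.of_apply, Matrix.smul_apply, trace_sub, smul_eq_mul]
  rw [Subsingleton.elim i j, Matrix.one_apply_eq]
  ring

end superoperators

/-! ### The semigroup -/

section semigroup

open scoped Matrix.Norms.Operator

variable {N : ℕ}

/-- `0 ⊕ A` as a linear function of `A`. -/
noncomputable def excitedBlockₗ (N : ℕ) :
    Matrix (Fin N) (Fin N) ℂ →ₗ[ℝ] Matrix (Level N) (Level N) ℂ where
  toFun := excitedBlock
  map_add' := excitedBlock_add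
  map_smul' := excitedBlock_smul

/-- The adjoint as a real-linear function. -/
noncomputable def conjTransposeₗ (N : ℕ) :
    Matrix (Level N) (Level N) ℂ →ₗ[ℝ] Matrix (Level N) (Level N) ℂ where
  toFun := conjTranspose
  map_add' := conjTranspose_add
  map_smul' c A := by simp

theorem hasDerivAt_excitedBlock_exp (L : Matrix (Fin N) (Fin N) ℂ) (t : ℝ) :
    HasDerivAt (fun t : ℝ => excitedBlock (NormedSpace.exp (t • L)) + groundProj N)
      (excitedBlock L * (excitedBlock (NormedSpace.exp (t • L)) + groundProj N)) t := by
  have h := hasDerivAt_exp_smul_const' (𝕂 := ℝ) L t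
  have h2 := ((excitedBlockₗ N).toContinuousLinearMap.hasFDerivAt.comp_hasDerivAt t h).add_const
    (groundProj N)
  rw [Matrix.mul_add, excitedBlock_mul_groundProj, add_zero, excitedBlock_mul]
  exact h2

/-- The solutions of a linear differential equation are given by the exponential series. -/
theorem hasSum_of_hasDerivAt {V : Type*} [NormedAddCommGroup V] [NormedSpace ℂ V]
    [FiniteDimensional ℂ V] (A : Module.End ℂ V) {u : ℝ → V}
    (hu : ∀ t, HasDerivAt u (A (u t)) t) (t : ℝ) :
    HasSum (fun n : ℕ => ((t : ℂ) ^ n / (n.factorial : ℂ)) • (A ^ n) (u 0)) (u t) := by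
  have : CompleteSpace V := FiniteDimensional.complete ℂ V
  set T : V →L[ℂ] V := LinearMap.toContinuousLinearMap A with hT
  have h2 : (fun s : ℝ => NormedSpace.exp (s • T) (u 0)) = u := by
    refine ODE_solution_unique_univ (v := fun _ => T) (s := fun _ => Set.univ) (K := ‖T‖₊) (t₀ := 0)
      (fun _ => T.lipschitz.lipschitzOnWith) (fun s => ⟨?_, trivial⟩)
      (fun s => ⟨hu s, trivial⟩) ?_
    · have h := hasDerivAt_exp_smul_const' (𝕂 := ℝ) T s
      exact (((ContinuousLinearMap.apply ℂ V (u 0)).restrictScalars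
        ℝ).hasFDerivAt.comp_hasDerivAt s h)
    · simp
  rw [← congrFun h2 t]
  have hs := (ContinuousLinearMap.apply ℂ V (u 0)).hasSum
    (NormedSpace.exp_series_hasSum_exp' (𝕂 := ℂ) ((t : ℂ) • T))
  convert hs using 1
  swap
  · rfl
  ext n : 1
  rw [ContinuousLinearMap.apply_apply, smul_pow, smul_smul, _root_.smul_apply,
    div_eq_inv_mul]
  congr 1
  induction n with
  | zero => rfl
  | succ n ih => rw [pow_succ', pow_succ', Module.End.mul_apply, ih]; rfl

theorem hasDerivAt_renormMatrix_exp (L : Matrix (Fin N) (Fin N) ℂ)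
    (ρ : Matrix (Level N) (Level N) ℂ) (t : ℝ) :
    HasDerivAt (fun t : ℝ => renormMatrix (NormedSpace.exp (t • L)) ρ)
      (generator L (renormMatrix (NormedSpace.exp (t • L)) ρ)) t := by
  have h1 := hasDerivAt_excitedBlock_exp L t
  set E := excitedBlock (NormedSpace.exp (t • L)) + groundProj N with hE
  have h2 : HasDerivAt (fun t : ℝ => (excitedBlock (NormedSpace.exp (t • L)) + groundProj N) * ρ *
      (excitedBlock (NormedSpace.exp (t • L)) + groundProj N)ᴴ)
      (excitedBlock L * (E * ρ * Eᴴ) + (E * ρ * Eᴴ) * excitedBlock Lᴴ) t := by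
    have h := (h1.mul_const ρ).mul
      ((conjTransposeₗ N).toContinuousLinearMap.hasFDerivAt.comp_hasDerivAt t h1)
    refine h.congr_deriv ?_
    change excitedBlock L * E * ρ * Eᴴ + E * ρ * (excitedBlock L * E)ᴴ = _
    simp only [conjTranspose_mul, excitedBlock_conjTranspose,
      Matrix.mul_assoc]
  have h3 := ((traceLinearMap (Level N) ℝ ℂ).toContinuousLinearMap.hasFDerivAt.comp_hasDerivAt t h2)
  have h4 := h2.add ((h3.const_sub ρ.trace).smul_const (groundProj N))
  -- The trace correction is a multiple of `groundProj N`, which `excitedBlock L` annihilates from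
  -- either side.
  have h5 : generator L (renormMatrix (NormedSpace.exp (t • L)) ρ)
      = excitedBlock L * (E * ρ * Eᴴ) + (E * ρ * Eᴴ) * excitedBlock Lᴴ
        + (-(excitedBlock L * (E * ρ * Eᴴ) + (E * ρ * Eᴴ) * excitedBlock Lᴴ).trace) •
          groundProj N := by
    rw [generator_apply, renormMatrix_eq, ← hE]
    simp only [Matrix.mul_add, Matrix.add_mul, Matrix.mul_smul, Matrix.smul_mul,
      excitedBlock_mul_groundProj, groundProj_mul_excitedBlock, smul_zero, add_zero, neg_smul,
      sub_eq_add_neg]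
  rw [h5]
  refine HasDerivAt.congr_deriv (h4.congr_of_eventuallyEq (Eventually.of_forall fun s => ?_)) ?_
  · exact renormMatrix_eq _ _
  · rfl

theorem renormMatrix_one (ρ : Matrix (Level N) (Level N) ℂ) : renormMatrix 1 ρ = ρ := by
  have h : (Matrix.of fun _ _ => 0 : Matrix Unit Unit ℂ) = 0 := rfl
  simp [renormMatrix, h, fromBlocks_toBlocks]

/-- Both sides solve the same linear differential equation with initial value `ρ`. -/
theorem semigroup_eq (L : Matrix (Fin N) (Fin N) ℂ) (t : ℝ) (ρ : Matrix (Level N) (Level N) ℂ) :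
    semigroup (generator L) t ρ = renormMatrix (NormedSpace.exp ((t : ℂ) • L)) ρ := by
  have h := hasSum_of_hasDerivAt (generator L)
    (u := fun s : ℝ => renormMatrix (NormedSpace.exp (s • L)) ρ)
    (fun s => hasDerivAt_renormMatrix_exp L ρ s) t
  simp only [zero_smul, NormedSpace.exp_zero, renormMatrix_one] at h
  exact h.tsum_eq

end semigroup

/-! ### Asymptotics of the reduced density matrix -/

section reducedAsymptotics

open scoped Matrix.Norms.Operator
open Asymptotics

variable {N : ℕ} {l : Filter ℝ} {f : ℝ → ℝ}

theorem isBigO_entry {X : ℝ → Matrix (Fin N) (Fin N) ℂ} (hX : X =O[l] f) (i j : Fin N) :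
    (fun s => X s i j) =O[l] f :=
  (IsBigO.of_bound 1 (Eventually.of_forall fun s => by
    rw [one_mul]; exact norm_entry_le _ _ _)).trans hX

theorem isBigO_conjTranspose {X : ℝ → Matrix (Fin N) (Fin N) ℂ} (hX : X =O[l] f) :
    (fun s => (X s)ᴴ) =O[l] f := by
  refine (IsBigO.of_bound N (Eventually.of_forall fun s => ?_)).trans hX
  refine norm_le_of_entry_le (norm_nonneg _) fun i j => ?_
  rw [conjTranspose_apply, norm_star]
  exact norm_entry_le _ _ _

/-- The superoperator `renormMatrix V` depends continuously on `V`. -/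
theorem isBigO_renormMatrix_sub {V W : ℝ → Matrix (Fin N) (Fin N) ℂ}
    (h : (fun s => V s - W s) =O[l] f) (hV : V =O[l] fun _ => (1 : ℝ))
    (hW : W =O[l] fun _ => (1 : ℝ)) (ρ : Matrix (Level N) (Level N) ℂ) (s s' : Level N) :
    (fun x => renormMatrix (V x) ρ s s' - renormMatrix (W x) ρ s s') =O[l] f := by
  have hstar : (fun x => (V x)ᴴ - (W x)ᴴ) =O[l] f := by
    simpa only [conjTranspose_sub] using isBigO_conjTranspose h
  have h1 : (fun x => V x * ρ.toBlocks₂₂ - W x * ρ.toBlocks₂₂) =O[l] f := by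
    simp_rw [← Matrix.sub_mul]
    simpa using h.mul (isBigO_const_const ρ.toBlocks₂₂ (one_ne_zero (α := ℝ)) l)
  have hWρ : (fun x => W x * ρ.toBlocks₂₂) =O[l] fun _ => (1 : ℝ) := by
    simpa using hW.mul (isBigO_const_const ρ.toBlocks₂₂ (one_ne_zero (α := ℝ)) l)
  have h22 := isBigO_mul_sub_mul h1 hstar hWρ (isBigO_conjTranspose hV)
  rcases s with u | i <;> rcases s' with u' | j
  · simp only [renormMatrix, fromBlocks_apply₁₁, Matrix.add_apply, Matrix.of_apply, trace_sub]
    have : (fun x => -∑ i, (V x * ρ.toBlocks₂₂ * (V x)ᴴ - W x * ρ.toBlocks₂₂ * (W x)ᴴ) i i)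
        =O[l] f := (IsBigO.fun_sum fun i _ => isBigO_entry h22 i i).neg_left
    refine this.congr_left fun x => ?_
    simp only [Matrix.sub_apply, Finset.sum_sub_distrib, trace, diag_apply]
    ring
  · simp only [renormMatrix, fromBlocks_apply₁₂, Matrix.mul_apply, ← Finset.sum_sub_distrib,
      ← mul_sub]
    refine IsBigO.fun_sum fun k _ => ?_
    simpa only [Matrix.sub_apply] using
      (isBigO_entry hstar k j).const_mul_left (ρ.toBlocks₁₂ u k)
  · simp only [renormMatrix, fromBlocks_apply₂₁, Matrix.mul_apply, ← Finset.sum_sub_distrib,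
      ← sub_mul]
    refine IsBigO.fun_sum fun k _ => ?_
    simpa only [mul_comm, Matrix.sub_apply] using
      (isBigO_entry h i k).const_mul_left (ρ.toBlocks₂₁ k u')
  · simpa only [renormMatrix, fromBlocks_apply₂₂, Matrix.sub_apply] using isBigO_entry h22 i j

end reducedAsymptotics

/-! ### The GKSL form -/

section gksl

variable {N : ℕ}

theorem conj_eq_dotProduct_smul (u w : Level N → ℂ) (v v' : Level N → ℂ)
    (ρ : Matrix (Level N) (Level N) ℂ) :
    ketBra u v * ρ * ketBra v' w = (star v ⬝ᵥ (ρ *ᵥ v')) • ketBra u w := by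
  unfold ketBra
  rw [vecMulVec_mul, vecMulVec_mul_vecMulVec, dotProduct_mulVec, vecMulVec_smul]

theorem ketBra_mul_ketBra (u v v' w : Level N → ℂ) :
    ketBra u v * ketBra v' w = (star v ⬝ᵥ v') • ketBra u w := by
  unfold ketBra
  rw [vecMulVec_mul_vecMulVec, vecMulVec_smul]

theorem ketBra_groundKet : ketBra (groundKet N) (groundKet N) = groundProj N := by
  rw [groundProj_eq]
  ext (i | i) (j | j) <;> simp [ketBra, groundKet, vecMulVec_apply]

theorem ketBra_excitedKet (v w : EuclideanSpace ℂ (Fin N)) :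
    ketBra (excitedKet v) (excitedKet w) = excitedBlock (vecMulVec v.ofLp (star w.ofLp)) := by
  ext (i | i) (j | j) <;> simp [ketBra, excitedKet, excitedBlock, vecMulVec_apply]

theorem star_groundKet_dotProduct : star (groundKet N) ⬝ᵥ groundKet N = 1 := by
  simp [groundKet, dotProduct, Fintype.sum_sum_type]

theorem star_excitedKet_dotProduct (v : EuclideanSpace ℂ (Fin N))
    (ρ : Matrix (Level N) (Level N) ℂ) :
    star (excitedKet v) ⬝ᵥ (ρ *ᵥ excitedKet v)
      = (vecMulVec v.ofLp (star v.ofLp) * ρ.toBlocks₂₂).trace := by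
  rw [vecMulVec_mul, trace_vecMulVec, dotProduct_comm v.ofLp, ← dotProduct_mulVec]
  simp [dotProduct, mulVec, Fintype.sum_sum_type, excitedKet, toBlocks₂₂, mul_comm]

/-- A matrix is determined by its eigenvalues and an orthonormal basis of eigenvectors. -/
theorem eq_sum_of_eigenvectors (v : OrthonormalBasis (Fin N) ℂ (EuclideanSpace ℂ (Fin N)))
    {X : Matrix (Fin N) (Fin N) ℂ} {z : Fin N → ℂ}
    (h : ∀ l, X *ᵥ (v l).ofLp = z l • (v l).ofLp) :
    X = ∑ l, z l • vecMulVec (v l).ofLp (star (v l).ofLp) := by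
  refine (Matrix.toEuclideanLin (𝕜 := ℂ)).injective (v.toBasis.ext fun l => ?_)
  rw [OrthonormalBasis.coe_toBasis]
  have h1 : ∀ k, star (v k).ofLp ⬝ᵥ (v l).ofLp = if k = l then 1 else 0 := fun k => by
    rw [← orthonormal_iff_ite.1 v.orthonormal k l, EuclideanSpace.inner_eq_star_dotProduct,
      dotProduct_comm]
  have h2 : (∑ k, z k • vecMulVec (v k).ofLp (star (v k).ofLp)) *ᵥ (v l).ofLp
      = z l • (v l).ofLp := by
    rw [Matrix.sum_mulVec]
    simp only [Matrix.smul_mulVec, vecMulVec_mulVec, h1]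
    simp
  rw [Matrix.toLpLin_apply, Matrix.toLpLin_apply, h, h2]

/-- Only the decay matrix has to be diagonal in the basis `v`; no condition on `effHam L` or on the
signs of the rates enters. -/
theorem generator_eq_gkslForm {L : Matrix (Fin N) (Fin N) ℂ}
    (v : OrthonormalBasis (Fin N) ℂ (EuclideanSpace ℂ (Fin N))) {Γ : Fin N → ℝ}
    (h : decay L = ∑ l, (Γ l : ℂ) • vecMulVec (v l).ofLp (star (v l).ofLp))
    (ρ : Matrix (Level N) (Level N) ℂ) :
    generator L ρ = gkslForm (excitedBlock (effHam L)) v Γ ρ := by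
  unfold gkslForm
  simp only [generator, LinearMap.coe_mk, AddHom.coe_mk]
  rw [add_sub_assoc]
  congr 1
  simp only [conj_eq_dotProduct_smul, ketBra_mul_ketBra, star_groundKet_dotProduct, one_smul,
    ketBra_groundKet, ketBra_excitedKet, star_excitedKet_dotProduct, h, smul_sub,
    Finset.sum_sub_distrib]
  simp only [Matrix.sum_mul, trace_sum, Finset.sum_smul, excitedBlock_sum, Matrix.mul_sum,
    Finset.smul_sum, ← Finset.sum_add_distrib, Matrix.smul_mul, Matrix.mul_smul, trace_smul,
    excitedBlock_smul, smul_smul, smul_eq_mul, smul_add, mul_comm]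

theorem sum_eigenvectors_conjTranspose
    (v : OrthonormalBasis (Fin N) ℂ (EuclideanSpace ℂ (Fin N))) (z : Fin N → ℂ) :
    (∑ l, z l • vecMulVec (v l).ofLp (star (v l).ofLp))ᴴ
      = ∑ l, conj (z l) • vecMulVec (v l).ofLp (star (v l).ofLp) := by
  simp only [conjTranspose_sum, conjTranspose_smul, conjTranspose_vecMulVec, star_star,
    RCLike.star_def]

theorem isHermitian_effHam (L : Matrix (Fin N) (Fin N) ℂ) : (effHam L).IsHermitian := by
  ext i j
  simp only [effHam, conjTranspose_apply, Matrix.smul_apply, Matrix.sub_apply, smul_eq_mul,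
    RCLike.star_def, map_mul, map_sub, map_div₀, Complex.conj_I, Complex.conj_conj,
    map_ofNat]
  ring

theorem isHermitian_decay (L : Matrix (Fin N) (Fin N) ℂ) : (decay L).IsHermitian := by
  unfold decay
  rw [Matrix.IsHermitian, conjTranspose_neg, conjTranspose_add, conjTranspose_conjTranspose,
    add_comm]

theorem re_decay (L : Matrix (Fin N) (Fin N) ℂ) (v : Fin N → ℂ) :
    (star v ⬝ᵥ (decay L *ᵥ v)).re = -2 * (star v ⬝ᵥ (L *ᵥ v)).re := by
  have h : star v ⬝ᵥ (Lᴴ *ᵥ v) = conj (star v ⬝ᵥ (L *ᵥ v)) := by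
    rw [star_dotProduct, star_mulVec, conjTranspose_conjTranspose, ← dotProduct_mulVec,
      RCLike.star_def]
  rw [decay, Matrix.neg_mulVec, Matrix.add_mulVec, dotProduct_neg, dotProduct_add, h]
  simp only [Complex.neg_re, Complex.add_re, Complex.conj_re]
  ring

/-- The generator of a dissipative `L` has GKSL form. -/
theorem exists_gkslForm {L : Matrix (Fin N) (Fin N) ℂ} (hL : IsDissipative L) :
    ∃ (H : Matrix (Fin N) (Fin N) ℂ)
      (v : OrthonormalBasis (Fin N) ℂ (EuclideanSpace ℂ (Fin N))) (Γ : Fin N → ℝ),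
      H.IsHermitian ∧ (∀ l, 0 ≤ Γ l) ∧
      ∀ σ, generator L σ = gkslForm (excitedBlock H) v Γ σ := by
  have hd := isHermitian_decay L
  refine ⟨effHam L, hd.eigenvectorBasis, hd.eigenvalues, isHermitian_effHam L, fun l => ?_,
    generator_eq_gkslForm _ (eq_sum_of_eigenvectors _ fun l => ?_)⟩
  · rw [hd.eigenvalues_eq]
    have h1 := re_decay L (hd.eigenvectorBasis l).ofLp
    have h2 := hL (hd.eigenvectorBasis l).ofLp
    rw [RCLike.re_eq_complex_re, h1]
    linarith
  · exact hd.mulVec_eigenvectorBasis l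

/-- The GKSL form in terms of an orthonormal basis of eigenvectors of `L`. -/
theorem gkslForm_of_eigenvectors {L : Matrix (Fin N) (Fin N) ℂ}
    (v : OrthonormalBasis (Fin N) ℂ (EuclideanSpace ℂ (Fin N))) {ε Γ : Fin N → ℝ}
    (h : ∀ l, L *ᵥ (v l).ofLp = (-Complex.I * ε l - Γ l / 2) • (v l).ofLp)
    (σ : Matrix (Level N) (Level N) ℂ) :
    generator L σ = gkslForm
      (∑ l, (ε l : ℂ) • ketBra (excitedKet (v l)) (excitedKet (v l))) v Γ σ := by
  have hL := eq_sum_of_eigenvectors v h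
  -- Orthonormality of the eigenvectors makes `L` normal, so `L⁺` has the same eigenvectors with
  -- conjugate eigenvalues.
  have hL' : Lᴴ = _ := (congrArg conjTranspose hL).trans (sum_eigenvectors_conjTranspose v _)
  have hdec : decay L = ∑ l, (Γ l : ℂ) • vecMulVec (v l).ofLp (star (v l).ofLp) := by
    rw [decay, hL', hL, ← Finset.sum_add_distrib, ← Finset.sum_neg_distrib]
    refine Finset.sum_congr rfl fun l _ => ?_
    rw [← add_smul, ← neg_smul]
    congr 1
    simp only [map_sub, map_mul, map_neg, Complex.conj_I, Complex.conj_ofReal, map_div₀, map_ofNat]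
    ring
  have heff : effHam L = ∑ l, (ε l : ℂ) • vecMulVec (v l).ofLp (star (v l).ofLp) := by
    rw [effHam, hL', hL, ← Finset.sum_sub_distrib, Finset.smul_sum]
    refine Finset.sum_congr rfl fun l _ => ?_
    rw [← sub_smul, smul_smul]
    congr 1
    simp only [map_sub, map_mul, map_neg, Complex.conj_I, Complex.conj_ofReal, map_div₀, map_ofNat]
    linear_combination (-(ε l : ℂ)) * Complex.I_mul_I
  rw [generator_eq_gkslForm v hdec, heff]
  simp only [excitedBlock_sum, excitedBlock_smul, ketBra_excitedKet]

theorem rate_nonneg_of_isDissipative {L : Matrix (Fin N) (Fin N) ℂ} (hL : IsDissipative L)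
    (v : OrthonormalBasis (Fin N) ℂ (EuclideanSpace ℂ (Fin N))) {ε Γ : ℝ} {l : Fin N}
    (h : L *ᵥ (v l).ofLp = (-Complex.I * ε - Γ / 2) • (v l).ofLp) : 0 ≤ Γ := by
  have h1 := hL (v l).ofLp
  have h2 : star (v l).ofLp ⬝ᵥ (v l).ofLp = 1 := by
    rw [dotProduct_comm, ← EuclideanSpace.inner_eq_star_dotProduct,
      orthonormal_iff_ite.1 v.orthonormal l l, if_pos rfl]
  rw [h, dotProduct_smul, h2] at h1
  simp at h1
  linarith

end gksl

/-! ### Dissipativity at weak coupling -/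

section dissipativity

variable {N : ℕ}

theorem norm_dotProduct_mulVec_le (D : Matrix (Fin N) (Fin N) ℂ) (v : Fin N → ℂ) :
    ‖star v ⬝ᵥ (D *ᵥ v)‖ ≤ (∑ i, ∑ j, ‖D i j‖) * ∑ k, ‖v k‖ ^ 2 := by
  have h1 : ∀ i, ‖v i‖ ^ 2 ≤ ∑ k, ‖v k‖ ^ 2 := fun i =>
    Finset.single_le_sum (f := fun k => ‖v k‖ ^ 2) (fun _ _ => by positivity) (Finset.mem_univ i)
  generalize ∑ k, ‖v k‖ ^ 2 = S at h1 ⊢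
  simp only [dotProduct, mulVec, Finset.mul_sum, Finset.sum_mul]
  refine (norm_sum_le _ _).trans (Finset.sum_le_sum fun i _ => ?_)
  refine (norm_sum_le _ _).trans (Finset.sum_le_sum fun j _ => ?_)
  rw [norm_mul, norm_mul, Pi.star_apply, norm_star]
  have h2 : ‖v i‖ * ‖v j‖ ≤ S := by
    nlinarith [h1 i, h1 j, sq_nonneg (‖v i‖ - ‖v j‖)]
  calc ‖v i‖ * (‖D i j‖ * ‖v j‖) = ‖D i j‖ * (‖v i‖ * ‖v j‖) := by ring
    _ ≤ _ := by gcongr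

theorem star_dotProduct_self (v : Fin N → ℂ) :
    star v ⬝ᵥ v = ((∑ k, ‖v k‖ ^ 2 : ℝ) : ℂ) := by
  simp only [dotProduct, Pi.star_apply, RCLike.star_def, Complex.conj_mul']
  push_cast
  rfl

/-- In the coordinates `w = Q⁺v` the form is `∑ f(Eₖ)|wₖ|²`, and `‖w‖ = ‖v‖`. -/
theorem le_re_hermFun {A : Matrix (Fin N) (Fin N) ℂ} (hA : A.IsHermitian) {f : ℝ → ℂ} {δ : ℝ}
    (hf : ∀ α, δ ≤ (f (hA.eigenvalues α)).re) (v : Fin N → ℂ) :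
    δ * ∑ k, ‖v k‖ ^ 2 ≤ (star v ⬝ᵥ (hermFun hA f *ᵥ v)).re := by
  have hQ := unitary_mul_conjTranspose hA.eigenvectorUnitary
  unfold hermFun
  set Q := (hA.eigenvectorUnitary : Matrix (Fin N) (Fin N) ℂ)
  set w := Qᴴ *ᵥ v with hw
  have hwstar : star w = star v ᵥ* Q := by rw [hw, star_mulVec, conjTranspose_conjTranspose]
  have h1 : ∑ k, ‖v k‖ ^ 2 = ∑ k, ‖w k‖ ^ 2 := by
    have h := star_dotProduct_self w
    rw [hwstar, ← dotProduct_mulVec, hw, mulVec_mulVec, hQ, one_mulVec, star_dotProduct_self] at h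
    exact_mod_cast h
  rw [← mulVec_mulVec, ← mulVec_mulVec, dotProduct_mulVec, ← hwstar, ← hw, h1, Finset.mul_sum,
    dotProduct, Complex.re_sum]
  refine Finset.sum_le_sum fun k _ => ?_
  rw [mulVec_diagonal, Pi.star_apply, RCLike.star_def, mul_left_comm, Complex.conj_mul',
    ← Complex.ofReal_pow, Complex.re_mul_ofReal]
  gcongr
  exact hf k

/-- The leading part `-G̃(-iH_S⁽⁰⁾)` contributes at most `-δ‖v‖²` and the correction at most
`λ²S‖v‖²`. -/
theorem eventually_isDissipative {H0 : Matrix (Fin N) (Fin N) ℂ} (h0 : H0.IsHermitian)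
    (H2 : Matrix (Fin N) (Fin N) ℂ) {F : ℂ → ℂ} (h : ∀ E ∈ eigSet h0, 0 < (F (-Complex.I * E)).re) :
    ∀ᶠ lam in 𝓝 (0 : ℝ), IsDissipative (LMatrix h0 H2 F lam) := by
  -- `δ` is the minimum over the eigenvalues, and `1` if there are none.
  obtain ⟨δ, hδ, hδF⟩ : ∃ δ > 0, ∀ α, δ ≤ (F (-Complex.I * h0.eigenvalues α)).re := by
    rcases isEmpty_or_nonempty (Fin N) with hN | hN
    · exact ⟨1, one_pos, fun α => hN.elim α⟩
    · obtain ⟨α, hα⟩ := Finite.exists_min fun α => (F (-Complex.I * h0.eigenvalues α)).re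
      exact ⟨_, h _ (Finset.mem_image_of_mem _ (Finset.mem_univ α)), hα⟩
  set D := funAt h0 (derivRHP F) * funAt h0 F + Complex.I • orderedFun h0 (diffQuot F) H2 with hD
  set S := ∑ i, ∑ j, ‖D i j‖ with hS
  have hsmall : ∀ᶠ lam in 𝓝 (0 : ℝ), lam ^ 2 * S < δ :=
    ((by fun_prop : Continuous fun lam : ℝ => lam ^ 2 * S).tendsto' 0 0
      (by simp)).eventually_lt_const hδ
  filter_upwards [hsmall] with lam hlam v
  have h1 := le_re_hermFun h0 (f := fun E => F (-Complex.I * E)) hδF v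
  have h2 := (Complex.re_le_norm _).trans (norm_dotProduct_mulVec_le D v)
  rw [LMatrix, ← hD, funAt_eq_hermFun, Matrix.add_mulVec, Matrix.neg_mulVec, Matrix.smul_mulVec,
    dotProduct_add, dotProduct_neg, dotProduct_smul, Complex.add_re, Complex.neg_re, smul_eq_mul,
    ← Complex.ofReal_pow, Complex.re_ofReal_mul]
  have h3 : 0 ≤ ∑ k, ‖v k‖ ^ 2 := by positivity
  have h4 : lam ^ 2 * (star v ⬝ᵥ (D *ᵥ v)).re ≤ lam ^ 2 * (S * ∑ k, ‖v k‖ ^ 2) := by gcongr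
  nlinarith

end dissipativity

/-! ### The reduced dynamics at weak coupling -/

section reducedDynamics

open scoped Matrix.Norms.Operator
open Asymptotics

variable {N : ℕ} {H0 H2 : Matrix (Fin N) (Fin N) ℂ}

theorem reducedState_asymptotics (h0 : H0.IsHermitian)
    (hK : ∀ lam : ℝ, (H0 + (lam : ℂ) ^ 2 • H2).IsHermitian) {ω : ℝ → ℝ} {g : ℝ → ℂ}
    (hω : Measurable ω) (hg : MemLp g 2 volume)
    {U₀ U : ℝ → ℝ → TotalSpace N ≃ₗᵢ[ℂ] TotalSpace N}
    (hU₀ : ∀ lam : ℝ, IsUnitaryGroup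
      (HamiltonianGraph ω g (H0 + (lam : ℂ) ^ 2 • H2) 0) (U₀ lam))
    (hU : ∀ lam : ℝ, IsUnitaryGroup
      (HamiltonianGraph ω g (H0 + (lam : ℂ) ^ 2 • H2) lam) (U lam))
    (hF : ContDiffOn ℂ 2 (laplace (corr ω g)) rightHalfPlane)
    (hbdd : ∃ C : ℝ, ∀ p ∈ rightHalfPlane, ‖derivRHP (laplace (corr ω g)) p‖ ≤ C)
    {t : ℝ} (ht : 0 < t) (ρ : Matrix (Level N) (Level N) ℂ) :
    EqUpToFourthOrder (fun lam => reducedState (U₀ lam) (U lam) ρ (t / lam ^ 2))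
      (fun lam => semigroup (generator (LMatrix h0 H2 (laplace (corr ω g)) lam)) t
        (renormMatrix (rMatrix h0 (laplace (corr ω g)) lam) ρ)) ∧
    EqUpToFourthOrder (fun lam => reducedState (U₀ lam) (U lam) ρ (t / lam ^ 2))
      (fun lam => renormMatrix (rMatrix h0 (laplace (corr ω g)) lam)
        (semigroup (generator (LMatrix h0 H2 (laplace (corr ω g)) lam)) t ρ)) := by
  obtain ⟨h1, h2⟩ := isBigO_amplitude_sub h0 hK hω hg hU₀ hU hF hbdd ht
  set r := rMatrix h0 (laplace (corr ω g))
  set E := fun lam => NormedSpace.exp ((t : ℂ) • LMatrix h0 H2 (laplace (corr ω g)) lam)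
  have hr : Continuous r := continuous_rMatrix h0 _
  have hE : Continuous E :=
    (NormedSpace.exp_continuous (𝔸 := Matrix (Fin N) (Fin N) ℂ)).comp
      ((continuous_LMatrix h0 _).const_smul (t : ℂ))
  have hb : ∀ {X : ℝ → Matrix (Fin N) (Fin N) ℂ}, Continuous X →
      X =O[𝓝[≠] 0] fun _ => (1 : ℝ) := fun hX =>
    ((hX.tendsto 0).mono_left nhdsWithin_le_nhds).isBigO_one ℝ
  have h4 : (fun lam : ℝ => lam ^ 4) =O[𝓝[≠] 0] fun _ => (1 : ℝ) :=
    (((continuous_pow 4).tendsto (0 : ℝ)).mono_left nhdsWithin_le_nhds).isBigO_one ℝ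
  have hV : (fun lam => amplitude (U₀ lam) (U lam) (t / lam ^ 2)) =O[𝓝[≠] 0]
      fun _ => (1 : ℝ) :=
    ((h1.trans h4).add (hb (hr.mul hE))).congr_left fun lam => sub_add_cancel _ _
  have hred : ∀ᶠ lam in 𝓝[≠] (0 : ℝ), reducedState (U₀ lam) (U lam) ρ (t / lam ^ 2)
      = renormMatrix (amplitude (U₀ lam) (U lam) (t / lam ^ 2)) ρ := by
    filter_upwards [self_mem_nhdsWithin] with lam hlam
    have : lam ≠ 0 := hlam
    exact reducedState_eq_renormMatrix hω hg (hK lam) (hU₀ lam) (hU lam) (by positivity) ρ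
  refine ⟨fun s s' => ?_, fun s s' => ?_⟩
  · refine (isBigO_renormMatrix_sub h2 hV (hb (hE.mul hr)) ρ s s').congr' ?_ EventuallyEq.rfl
    filter_upwards [hred] with lam h
    rw [h, semigroup_eq, renormMatrix_mul]
  · refine (isBigO_renormMatrix_sub h1 hV (hb (hr.mul hE)) ρ s s').congr' ?_ EventuallyEq.rfl
    filter_upwards [hred] with lam h
    rw [h, semigroup_eq, renormMatrix_mul]

end reducedDynamics

end MultiLevel

theorem mainTheorem2 (N : ℕ)
    (ω : ℝ → ℝ) (hω : Measurable ω)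
    (g : ℝ → ℂ) (hg : MemLp g 2 volume)
    (H0 H2 : Matrix (Fin N) (Fin N) ℂ) (h0 : H0.IsHermitian) (h2 : H2.IsHermitian)
    (hconv : ∀ p ∈ MultiLevel.rightHalfPlane,
      ∃ l, MultiLevel.LaplaceConverges (MultiLevel.corr ω g) p l)
    (hC2 : ContDiffOn ℂ 2 (MultiLevel.laplace (MultiLevel.corr ω g)) MultiLevel.rightHalfPlane)
    (hbdd : ∃ C : ℝ, ∀ p ∈ MultiLevel.rightHalfPlane,
      ‖MultiLevel.derivRHP (MultiLevel.laplace (MultiLevel.corr ω g)) p‖ ≤ C)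
    (U₀ U : ℝ → ℝ → MultiLevel.TotalSpace N ≃ₗᵢ[ℂ] MultiLevel.TotalSpace N)
    (hU₀ : ∀ lam : ℝ, MultiLevel.IsUnitaryGroup
      (MultiLevel.HamiltonianGraph ω g (H0 + (lam : ℂ) ^ 2 • H2) 0) (U₀ lam))
    (hU : ∀ lam : ℝ, MultiLevel.IsUnitaryGroup
      (MultiLevel.HamiltonianGraph ω g (H0 + (lam : ℂ) ^ 2 • H2) lam) (U lam))
    (ρ : Matrix (MultiLevel.Level N) (MultiLevel.Level N) ℂ)
    (hρ : MultiLevel.IsDensityMatrix ρ) :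
    let Gt : ℂ → ℂ := MultiLevel.laplace (MultiLevel.corr ω g)
    let r : ℝ → Matrix (Fin N) (Fin N) ℂ := MultiLevel.rMatrix h0 Gt
    let L : ℝ → Matrix (Fin N) (Fin N) ℂ := MultiLevel.LMatrix h0 H2 Gt
    -- renormalize the initial condition, then evolve; or evolve, then renormalize
    (∀ t : ℝ, 0 < t →
      MultiLevel.EqUpToFourthOrder
        (fun lam => MultiLevel.reducedState (U₀ lam) (U lam) ρ (t / lam ^ 2))
        (fun lam => MultiLevel.semigroup (MultiLevel.generator (L lam)) t
          (MultiLevel.renormMatrix (r lam) ρ)) ∧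
      MultiLevel.EqUpToFourthOrder
        (fun lam => MultiLevel.reducedState (U₀ lam) (U lam) ρ (t / lam ^ 2))
        (fun lam => MultiLevel.renormMatrix (r lam)
          (MultiLevel.semigroup (MultiLevel.generator (L lam)) t ρ))) ∧
    -- the generator has GKSL form if `L` is dissipative
    (∀ lam : ℝ, MultiLevel.IsDissipative (L lam) →
      ∃ (H : Matrix (Fin N) (Fin N) ℂ)
        (v : OrthonormalBasis (Fin N) ℂ (EuclideanSpace ℂ (Fin N))) (Γ : Fin N → ℝ),
        H.IsHermitian ∧ (∀ l, 0 ≤ Γ l) ∧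
        ∀ σ, MultiLevel.generator (L lam) σ
          = MultiLevel.gkslForm (MultiLevel.excitedBlock H) v Γ σ) ∧
    -- its form in terms of an orthonormal basis of eigenvectors of `L`
    (∀ (lam : ℝ) (v : OrthonormalBasis (Fin N) ℂ (EuclideanSpace ℂ (Fin N))) (ε Γ : Fin N → ℝ),
      (∀ l, L lam *ᵥ (v l).ofLp = (-Complex.I * ε l - Γ l / 2) • (v l).ofLp) →
      (∀ σ, MultiLevel.generator (L lam) σ = MultiLevel.gkslForm
        (∑ l, (ε l : ℂ) • MultiLevel.ketBra (MultiLevel.excitedKet (v l))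
          (MultiLevel.excitedKet (v l))) v Γ σ) ∧
      (MultiLevel.IsDissipative (L lam) → ∀ l, 0 ≤ Γ l)) ∧
    -- dissipativity for small values of the parameter
    ((∀ E ∈ MultiLevel.eigSet h0, (Gt (-Complex.I * E)).re ≠ 0) →
      ∀ᶠ lam in 𝓝[≠] (0 : ℝ), MultiLevel.IsDissipative (L lam)) := by
  intro Gt r L
  have hK : ∀ lam : ℝ, (H0 + (lam : ℂ) ^ 2 • H2).IsHermitian := fun lam => by
    rw [Matrix.IsHermitian, conjTranspose_add, conjTranspose_smul, h0.eq, h2.eq, star_pow,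
      RCLike.star_def, Complex.conj_ofReal]
  refine ⟨fun t ht => ?_, fun lam => MultiLevel.exists_gkslForm,
    fun lam v ε Γ h => ⟨MultiLevel.gkslForm_of_eigenvectors v h,
      fun hL l => MultiLevel.rate_nonneg_of_isDissipative hL v (h l)⟩, fun h => ?_⟩
  · exact MultiLevel.reducedState_asymptotics h0 hK hω hg hU₀ hU hC2 hbdd ht ρ
  · refine nhdsWithin_le_nhds (MultiLevel.eventually_isDissipative h0 H2 fun E hE => ?_)
    refine lt_of_le_of_ne ?_ (h E hE).symm
    exact MultiLevel.re_nonneg_of_re_pos hC2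
      (fun p hp => MultiLevel.laplace_corr_re_nonneg hω hg hp) (MultiLevel.imagAxis_mem E)
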